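/- Let $\mathbb{T}=\mathbb{R}/2\pi\mathbb{Z}$, $\widehat f(n)=(2\pi)^{-1/2}\int_{\mathbb T} f(x)e^{-inx}\,dx$. For $0<\delta<\infty$ let $\mathcal{G}_\delta$ be the Fourier multiplier operator with symbol $-i\big(\coth(\delta n)-\frac1{\delta n}\big)$ for $n\neq 0$ and $0$ for $n=0$, and let $\mathcal{H}$ be the one with symbol $-i\,\mathrm{sgn}(n)$ ($0$ at $n=0$). All functions $u$ are real-valued with mean zero on $\mathbb{T}$; $H^s_0(\mathbb{T})$ is the space of mean-zero functions in $H^s(\mathbb{T})$. The ILW and BO equations are $$\partial_t u-\mathcal{G}_\delta\partial_x^2u=\partial_x(u^2)\quad\text{(ILW)},\qquad \partial_t u-\mathcal{H}\partial_x^2u=\partial_x(u^2)\quad\text{(BO)}.$$ For smooth $u$ define $\chi^\delta_n$, $n\ge1$, by $\chi_1^\delta=2u$ and, for $n\ge 2$, $$\chi^\delta_n=-\sum_{j=2}^n\frac1{j!}\sum_{\substack{n_1,\dots,n_j\ge1\\ n_1+\dots+n_j=n}}\chi^\delta_{n_1}\cdots\chi^\delta_{n_j}-\big((\mathcal{G}_\delta-i)\partial_x+\delta^{-1}\big)\chi^\delta_{n-1},$$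 and define $\chi^{\rm BO}_n$ in the same way with $(\mathcal{H}-i)\partial_x$ in place of $(\mathcal{G}_\delta-i)\partial_x+\delta^{-1}$. For $k\ge 0$ put $$b_k=\sum_{\substack{0\le \ell\le k\\ \ell\text{ even}}}\binom{k+1}{\ell+1},\qquad a_{k,\ell}=\frac1{b_k}\binom{k+1}{\ell+1},$$ and, recursively in $k$, $$E^\delta_{k/2}(u)=\frac{(-1)^{k+1}}{4b_k}\Big[\mathrm{Re}\int_{\mathbb T}\chi^\delta_{k+2}\,dx-4(-1)^{k+1}\sum_{j=0}^{k-1}\frac1{\delta^{k-j}}\binom{k+2}{j+2}b_j\,E^\delta_{j/2}(u)\Big],\qquad E^{\rm BO}_{k/2}(u)=\frac{(-1)^{k+1}}{4b_k}\,\mathrm{Re}\int_{\mathbb T}\chi^{\rm BO}_{k+2}\,dx .$$ **Theorem.** Let $k\ge0$ be an integer. (1) For every $0<\delta<\infty$, $E^\delta_{k/2}$ and $E^{\rm BO}_{k/2}$ extend continuously (and uniquely) from smooth mean-zero functions to $H^{k/2}_0(\mathbb{T})$. For all $u\in H^{k/2}_0(\mathbb T)$, $$E^\delta_{k/2}(u)=\frac12\sum_{\substack{0\le\ell\le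 k\\ \ell\text{ even}}}a_{k,\ell}\,\|\mathcal{G}_\delta^{\frac{k-\ell}2}u\|^2_{\dot H^{k/2}}+R^\delta_{k/2}(u),\qquad E^{\rm BO}_{k/2}(u)=\frac12\|u\|^2_{\dot H^{k/2}}+R^{\rm BO}_{k/2}(u),$$ where $\|\mathcal{G}_\delta^{\frac{k-\ell}2}u\|^2_{\dot H^{k/2}}=\sum_n |n|^k\,\big|\coth(\delta n)-\tfrac1{\delta n}\big|^{k-\ell}|\widehat u(n)|^2$ (sum over $n\ne0$), and $R^\delta_{k/2}$, $R^{\rm BO}_{k/2}$ are sums of homogeneous terms of degrees $3,\dots,k+2$ in $u$, given by bounded multilinear forms on $H^{k/2}_0(\mathbb{T})$. Moreover $a_{k,\ell}>0$ and $\sum_{\ell}a_{k,\ell}=1$, and the quadratic part is sign-definite: for each $\delta_0>0$ there is $c>0$ such that $c\|u\|^2_{\dot H^{k/2}}\le\sum_\ell a_{k,\ell}\|\mathcal{G}_\delta^{\frac{k-\ell}2}u\|^2_{\dot H^{k/2}}\le\|u\|^2_{\dot H^{k/2}}$ for all $\delta\ge\delta_0$ and $u\in H^{k/2}_0(\mathbb{T})$.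 (2) For every $0<\delta<\infty$, $E^\delta_{k/2}(u(t))$ is independent of $t$ for every smooth mean-zero solution $u$ of ILW on an open time interval; likewise $E^{\rm BO}_{k/2}(u(t))$ for every smooth mean-zero solution of BO. (3) For every $u\in H^{k/2}_0(\mathbb{T})$, $\displaystyle\lim_{\delta\to\infty}E^\delta_{k/2}(u)=E^{\rm BO}_{k/2}(u)$. -/

import Mathlib

open Filter Topology MeasureTheory
open scoped ContDiff Real

noncomputable section

namespace ILW

/-! Functions on the torus `ℝ / 2πℤ` are represented by `2π`-periodic functions on `ℝ`. -/

/-- A real function regarded as a complex one. -/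
def cplx (u : ℝ → ℝ) : ℝ → ℂ := fun x => (u x : ℂ)

/-- Fourier coefficient `f̂(n) = (2π)^(-1/2) ∫₀^{2π} f(x) e^{-inx} dx`. -/
def fourierCoef (f : ℝ → ℂ) (n : ℤ) : ℂ :=
  ((√(2 * π) : ℝ) : ℂ)⁻¹ *
    ∫ x in (0 : ℝ)..(2 * π), f x * Complex.exp (-(Complex.I * (n : ℂ) * (x : ℂ)))

/-- Fourier multiplier operator with symbol `σ`: the function
`(2π)^(-1/2) ∑ₙ σ(n) f̂(n) e^{inx}`. -/
def fourierMul (σ : ℤ → ℂ) (f : ℝ → ℂ) : ℝ → ℂ := fun x =>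
  ((√(2 * π) : ℝ) : ℂ)⁻¹ *
    ∑' n : ℤ, σ n * fourierCoef f n * Complex.exp (Complex.I * (n : ℂ) * (x : ℂ))

/-- The symbol `-i (coth (δ n) - 1 / (δ n))` of `𝒢_δ`, set to be `0` at `n = 0`. -/
def symG (δ : ℝ) (n : ℤ) : ℂ :=
  if n = 0 then 0
  else -Complex.I *
    ((Real.cosh (δ * n) / Real.sinh (δ * n) - 1 / (δ * n) : ℝ) : ℂ)

/-- The symbol `-i sgn n` of the Hilbert transform, equal to `0` at `n = 0`. -/
def symH (n : ℤ) : ℂ := -Complex.I * (n.sign : ℂ)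

/-- The operator `(𝒢_δ - i) ∂ₓ + δ⁻¹`. -/
def opILW (δ : ℝ) (f : ℝ → ℂ) : ℝ → ℂ := fun x =>
  fourierMul (symG δ) (deriv f) x - Complex.I * deriv f x + ((δ⁻¹ : ℝ) : ℂ) * f x

/-- The operator `(ℋ - i) ∂ₓ`. -/
def opBO (f : ℝ → ℂ) : ℝ → ℂ := fun x =>
  fourierMul symH (deriv f) x - Complex.I * deriv f x

/-- The microscopic conservation laws generated by the Bäcklund transform with linear
operator `L`:
`χ₁ = 2u` and, for `n ≥ 2`,
`χₙ = - ∑_{j=2}^n (1/j!) ∑_{n₁ + ⋯ + n_j = n, nᵢ ≥ 1} χ_{n₁} ⋯ χ_{n_j} - L χ_{n-1}`.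
(The value at the unused index `0` is `0`.) -/
def chi (L : (ℝ → ℂ) → ℝ → ℂ) (u : ℝ → ℝ) : ℕ → ℝ → ℂ
  | 0 => fun _ => 0
  | 1 => fun x => 2 * (u x : ℂ)
  | n + 2 => fun x =>
      -(∑ j ∈ Finset.Icc 2 (n + 2), (1 / (Nat.factorial j : ℂ)) *
          ∑ m ∈ (Finset.univ : Finset (Fin j → Fin (n + 2))).filter
              (fun m => (∀ i, 1 ≤ (m i : ℕ)) ∧ ∑ i, (m i : ℕ) = n + 2),
            ∏ i, chi L u (m i : ℕ) x)
        - L (chi L u (n + 1)) x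
  termination_by n => n
  decreasing_by
    · exact (m i).isLt
    · omega

/-- `b_k = ∑_{0 ≤ ℓ ≤ k, ℓ even} binom (k+1) (ℓ+1)`. -/
def bCoef (k : ℕ) : ℝ :=
  ∑ l ∈ (Finset.range (k + 1)).filter (fun l => Even l), ((k + 1).choose (l + 1) : ℝ)

/-- `a_{k,ℓ} = binom (k+1) (ℓ+1) / b_k`. -/
def aCoef (k l : ℕ) : ℝ := ((k + 1).choose (l + 1) : ℝ) / bCoef k

/-- The functional `E^δ_{k/2}` on smooth functions, defined recursively by
`E^δ_{k/2}(u) = (-1)^{k+1} / (4 b_k) *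
  [ Re ∫ χ_{k+2} dx - 4 (-1)^{k+1} ∑_{j<k} δ^{-(k-j)} binom (k+2) (j+2) b_j E^δ_{j/2}(u) ]`. -/
def smoothEnergyILW (δ : ℝ) (k : ℕ) (u : ℝ → ℝ) : ℝ :=
  (-1) ^ (k + 1) / (4 * bCoef k) *
    ((∫ x in (0 : ℝ)..(2 * π), chi (opILW δ) u (k + 2) x).re
      - 4 * (-1) ^ (k + 1) * ∑ j : Fin k,
          1 / δ ^ (k - (j : ℕ)) * ((k + 2).choose ((j : ℕ) + 2) : ℝ) * bCoef j
            * smoothEnergyILW δ j u)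
  termination_by k
  decreasing_by exact j.isLt

/-- The functional `E^BO_{k/2}(u) = (-1)^{k+1} / (4 b_k) * Re ∫ χ^BO_{k+2} dx` on smooth
functions. -/
def smoothEnergyBO (k : ℕ) (u : ℝ → ℝ) : ℝ :=
  (-1) ^ (k + 1) / (4 * bCoef k) *
    (∫ x in (0 : ℝ)..(2 * π), chi opBO u (k + 2) x).re

/-- Smooth, real-valued, mean-zero functions on the torus. -/
def IsSmoothMeanZero (u : ℝ → ℝ) : Prop :=
  ContDiff ℝ ∞ u ∧ Function.Periodic u (2 * π) ∧ ∫ x in (0 : ℝ)..(2 * π), u x = 0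

/-- The Sobolev norm `‖u‖_{H^s} = (∑ₙ (1 + n²)^s |û(n)|²)^{1/2}`. -/
def sobolevNorm (s : ℝ) (u : ℝ → ℝ) : ℝ :=
  √(∑' n : ℤ, (1 + (n : ℝ) ^ 2) ^ s * ‖fourierCoef (cplx u) n‖ ^ 2)

theorem intervalIntegrable_of_memLp {u : ℝ → ℝ}
    (hu : MemLp u 2 (volume.restrict (Set.Ioc 0 (2 * π)))) :
    IntervalIntegrable u volume 0 (2 * π) := by
  rw [intervalIntegrable_iff_integrableOn_Ioc_of_le Real.two_pi_pos.le]
  exact hu.integrable (by norm_num)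

theorem intervalIntegrable_cplx_mul_exp {u : ℝ → ℝ}
    (hu : IntervalIntegrable u volume 0 (2 * π)) (n : ℤ) :
    IntervalIntegrable (fun x : ℝ => cplx u x *
      Complex.exp (-(Complex.I * (n : ℂ) * (x : ℂ)))) volume 0 (2 * π) := by
  apply IntervalIntegrable.mul_continuousOn
  · have h := hu
    rw [intervalIntegrable_iff] at h ⊢
    exact h.ofReal
  · fun_prop

theorem fourierCoef_add {u v : ℝ → ℝ} (hu : IntervalIntegrable u volume 0 (2 * π))
    (hv : IntervalIntegrable v volume 0 (2 * π)) (n : ℤ) :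
    fourierCoef (cplx (u + v)) n = fourierCoef (cplx u) n + fourierCoef (cplx v) n := by
  unfold fourierCoef
  rw [← mul_add, ← intervalIntegral.integral_add (intervalIntegrable_cplx_mul_exp hu n)
    (intervalIntegrable_cplx_mul_exp hv n)]
  congr 2
  funext x
  simp [cplx, add_mul]

theorem fourierCoef_smul (c : ℝ) (u : ℝ → ℝ) (n : ℤ) :
    fourierCoef (cplx (c • u)) n = (c : ℂ) * fourierCoef (cplx u) n := by
  have h : (fun x : ℝ => cplx (c • u) x * Complex.exp (-(Complex.I * (n : ℂ) * (x : ℂ)))) =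
      fun x : ℝ => (c : ℂ) * (cplx u x * Complex.exp (-(Complex.I * (n : ℂ) * (x : ℂ)))) := by
    funext x
    simp [cplx, mul_assoc]
  unfold fourierCoef
  rw [h, intervalIntegral.integral_const_mul]
  ring

/-- The space `H^s` (for `s ≥ 0`) of real-valued mean-zero functions on the torus. -/
def sobolevZero (s : ℝ) : Submodule ℝ (ℝ → ℝ) where
  carrier := {u | Function.Periodic u (2 * π) ∧
    MemLp u 2 (volume.restrict (Set.Ioc 0 (2 * π))) ∧
    ∫ x in (0 : ℝ)..(2 * π), u x = 0 ∧
    Summable fun n : ℤ => (1 + (n : ℝ) ^ 2) ^ s * ‖fourierCoef (cplx u) n‖ ^ 2}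
  zero_mem' := by
    refine ⟨fun x => rfl, MemLp.zero, by simp, ?_⟩
    have : ∀ n : ℤ, fourierCoef (cplx 0) n = 0 := fun n => by simp [fourierCoef, cplx]
    simp [this, summable_zero]
  add_mem' := by
    rintro u v ⟨hu1, hu2, hu3, hu4⟩ ⟨hv1, hv2, hv3, hv4⟩
    have iu := intervalIntegrable_of_memLp hu2
    have iv := intervalIntegrable_of_memLp hv2
    refine ⟨hu1.add hv1, hu2.add hv2, ?_, ?_⟩
    · simp only [Pi.add_apply]
      rw [intervalIntegral.integral_add iu iv, hu3, hv3, add_zero]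
    · refine Summable.of_nonneg_of_le (fun n => by positivity) (fun n => ?_)
        ((hu4.add hv4).mul_left 2)
      rw [fourierCoef_add iu iv, ← mul_add, mul_left_comm]
      refine mul_le_mul_of_nonneg_left ?_ (by positivity)
      have h := norm_add_le (fourierCoef (cplx u) n) (fourierCoef (cplx v) n)
      nlinarith [norm_nonneg (fourierCoef (cplx u) n + fourierCoef (cplx v) n),
        sq_nonneg (‖fourierCoef (cplx u) n‖ - ‖fourierCoef (cplx v) n‖)]
  smul_mem' := by
    rintro c u ⟨hu1, hu2, hu3, hu4⟩
    refine ⟨fun x => by simp [hu1 x], hu2.const_smul c, ?_, ?_⟩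
    · simp [hu3]
    · refine (hu4.mul_left (c ^ 2)).congr fun n => ?_
      rw [fourierCoef_smul, norm_mul, Complex.norm_real, mul_pow, Real.norm_eq_abs, sq_abs]
      ring

/-- Smooth mean-zero functions tending to `u` in the norm of `H^s`. -/
def smoothNear (s : ℝ) (u : ℝ → ℝ) : Filter (ℝ → ℝ) :=
  comap (fun v => sobolevNorm s (v - u)) (𝓝 0) ⊓ 𝓟 {v | IsSmoothMeanZero v}

/-- `E^δ_{k/2}` on `H^{k/2}`: the limit of its values at smooth mean-zero functions
converging to `u` in `H^{k/2}`. -/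
def energyILW (δ : ℝ) (k : ℕ) (u : ℝ → ℝ) : ℝ :=
  limUnder (smoothNear ((k : ℝ) / 2) u) (smoothEnergyILW δ k)

/-- `E^BO_{k/2}` on `H^{k/2}`: the limit of its values at smooth mean-zero functions
converging to `u` in `H^{k/2}`. -/
def energyBO (k : ℕ) (u : ℝ → ℝ) : ℝ :=
  limUnder (smoothNear ((k : ℝ) / 2) u) (smoothEnergyBO k)

/-- `‖u‖²` in the homogeneous Sobolev space of order `k/2`. -/
def homSq (k : ℕ) (u : ℝ → ℝ) : ℝ :=
  ∑' n : ℤ, |(n : ℝ)| ^ k * ‖fourierCoef (cplx u) n‖ ^ 2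

/-- `‖𝒢_δ^{m/2} u‖²` in the homogeneous Sobolev space of order `k/2`. The operator `𝒢_δ ∂ₓ` has
the symbol `|n| |𝒢_δ(n)|`, so for even `l` and `m = k - l` this is the integral of
`∂ₓ^{l/2} u · (𝒢_δ ∂ₓ)^{k-l} ∂ₓ^{l/2} u`, for every parity of `k`. -/
def homSqG (δ : ℝ) (m k : ℕ) (u : ℝ → ℝ) : ℝ :=
  ∑' n : ℤ, |(n : ℝ)| ^ k * ‖symG δ n‖ ^ m * ‖fourierCoef (cplx u) n‖ ^ 2

/-- `∑_{0 ≤ ℓ ≤ k, ℓ even} a_{k,ℓ} ‖𝒢_δ^{(k-ℓ)/2} u‖²` with the homogeneous norm of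
order `k/2`. -/
def quadILW (δ : ℝ) (k : ℕ) (u : ℝ → ℝ) : ℝ :=
  ∑ l ∈ (Finset.range (k + 1)).filter (fun l => Even l), aCoef k l * homSqG δ (k - l) k u

/-- `R` is a polynomial functional on the mean-zero space `H^s` all of whose terms have degree
between `3` and `N`, each being given by a bounded multilinear form. -/
def IsCubicAndHigher (s : ℝ) (N : ℕ) (R : (ℝ → ℝ) → ℝ) : Prop :=
  ∃ M : (j : ℕ) → MultilinearMap ℝ (fun _ : Fin j => sobolevZero s) ℝ,
    (∀ j, ∃ C : ℝ, ∀ v : Fin j → sobolevZero s,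
      |M j v| ≤ C * ∏ i, sobolevNorm s (v i : ℝ → ℝ)) ∧
    ∀ u : sobolevZero s, R u = ∑ j ∈ Finset.Icc 3 N, M j (fun _ => u)

/-- `u` is a smooth, real-valued, spatially mean-zero solution, on the time interval `I` and
the torus, of `∂ₜ u - T ∂ₓ² u = ∂ₓ (u²)`, where `T` is the Fourier multiplier operator with
symbol `σ`. -/
def IsSmoothSolution (σ : ℤ → ℂ) (I : Set ℝ) (u : ℝ → ℝ → ℝ) : Prop :=
  ContDiffOn ℝ ∞ (fun p : ℝ × ℝ => u p.1 p.2) (I ×ˢ Set.univ) ∧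
  (∀ t ∈ I, Function.Periodic (u t) (2 * π) ∧ ∫ x in (0 : ℝ)..(2 * π), u t x = 0) ∧
  ∀ t ∈ I, ∀ x : ℝ,
    ((deriv (fun τ => u τ x) t : ℝ) : ℂ) - fourierMul σ (iteratedDeriv 2 (cplx (u t))) x
      = ((deriv (fun y => u t y ^ 2) x : ℝ) : ℂ)

end ILW

end

/-!
Both equations have the form `∂ₜ u = 𝒢 ∂ₓ² u + ∂ₓ (u²)`, where `𝒢` has the symbol
`-i sgn(n) g(n)`; they are treated together by means of `GoodSymbol g s`, with `s = δ⁻¹` for ILW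
and `s = 0` for BO. Put `L = (𝒢 - i) ∂ₓ + s`.

**Conservation.** The recursion for the `χₙ` says that their generating function
`U = ∑ₙ χₙ εⁿ` solves the Bäcklund relation `e^U - 1 + ε L U = 2 ε u` (`expS_genU`). The operator
`L` satisfies a bilinear identity, which is the addition theorem of the hyperbolic cotangent read on
the Fourier side (`SymbolIdentities.isDispersive`). By this identity the time derivative of `U` and
the explicit expression `evolution` solve the same linearization of the Bäcklund relation, whose
solution is unique (`eq_zero_of_linearized`); hence they agree (`IsDispersive.hat_genU_eq`), and the
integral of `evolution` vanishes (`IsDispersive.hat_evolution`). All of this is algebra over a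
commutative `ℂ`-algebra. Applied to polynomials with coefficients in the smooth functions, it shows
that the derivative of `∫ χₙ` at `u` in the direction of the flow is zero
(`IsDispersive.coeff_one_eq_zero`). As the derivative along a curve depends only on the velocity
(`hasDerivAt_formSum`), the energies of smooth solutions are constant
(`GoodSymbol.smE_conserved`).

**Structure of the energies.** Induction over the recursion shows that `χₙ` is a sum of
homogeneous polynomial maps of degrees `d ≤ n` in the Fourier coefficients of `u`, with symbols that
are bounded by the power `n - d` of the frequencies and depend continuously on the symbol of `L`
(`isPoly_chiF`). The linear part of the integral vanishes for mean zero. The quadratic part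
follows from the linear and quadratic parts of the Bäcklund relation: it is a telescoping sum, and
expanding it by the binomial theorem gives the combination of quadratic forms that the recursion for
the energies inverts (`hasSum_quadU`, `GoodSymbol.quadSym_eq`, `engC_eq`). It is comparable to the
homogeneous Sobolev norm since `coth x - 1 / x` lies between a positive constant and `1` for
`x ≥ x₀ > 0` (`exists_le_lang`).

**Sobolev spaces.** A form of degree `d ≥ 3` is a sum over frequencies with `∑ νᵢ = 0`, where the
two largest are comparable (`exists_two_largest`). Its symbol grows like the power `k + 2 - d` of
the largest frequency, and summation over the `d - 2` remaining frequencies costs one power for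
each; this makes `k` powers, which the weights of `H^{k/2}` at the two largest frequencies provide
(`term_bound`, `norm_formL_le`). Thus the energies are restrictions of continuous functionals on `ℓ²`
(`GoodSymbol.smE_eq_engL`, `GoodSymbol.continuous_engL`), which yields the extension from the dense
subspace of smooth functions. The bounds are uniform for `δ ≥ 1` and the symbols converge pointwise
as `δ → ∞`, so the limit follows by dominated convergence (`tendsto_engL`).
-/

noncomputable section

namespace ILW

/-! ### Fourier series of smooth periodic functions -/

/-- The character `x ↦ e^{inx}`. -/
def chr (n : ℤ) (x : ℝ) : ℂ := Complex.exp (Complex.I * (n : ℂ) * (x : ℂ))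

theorem chr_add (m n : ℤ) (x : ℝ) : chr (m + n) x = chr m x * chr n x := by
  simp only [chr, ← Complex.exp_add]
  congr 1
  push_cast
  ring

@[simp] theorem chr_zero (x : ℝ) : chr 0 x = 1 := by simp [chr]

@[simp] theorem norm_chr (n : ℤ) (x : ℝ) : ‖chr n x‖ = 1 := by
  have h : Complex.I * (n : ℂ) * (x : ℂ) = ((n * x : ℝ) : ℂ) * Complex.I := by
    push_cast
    ring
  rw [chr, h, Complex.norm_exp_ofReal_mul_I]

theorem chr_neg (n : ℤ) (x : ℝ) :
    chr (-n) x = Complex.exp (-(Complex.I * (n : ℂ) * (x : ℂ))) := by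
  simp only [chr]
  congr 1
  push_cast
  ring

theorem conj_chr (n : ℤ) (x : ℝ) : (starRingEnd ℂ) (chr n x) = chr (-n) x := by
  rw [chr, chr, ← Complex.exp_conj]
  simp

theorem hasDerivAt_chr (n : ℤ) (x : ℝ) :
    HasDerivAt (chr n) (Complex.I * n * chr n x) x := by
  have h : HasDerivAt (fun y : ℝ => Complex.I * (n : ℂ) * (y : ℂ)) (Complex.I * n) x := by
    simpa using (Complex.ofRealCLM.hasDerivAt (x := x)).const_mul (Complex.I * (n : ℂ))
  have h2 := h.cexp
  rw [mul_comm (Complex.exp _)] at h2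
  exact h2

theorem continuous_chr (n : ℤ) : Continuous (chr n) := by
  unfold chr
  fun_prop

theorem chr_periodic (n : ℤ) : Function.Periodic (chr n) (2 * π) := by
  intro x
  simp only [chr]
  rw [Complex.exp_eq_exp_iff_exists_int]
  exact ⟨n, by push_cast; ring⟩

theorem integral_chr (n : ℤ) :
    ∫ x in (0 : ℝ)..(2 * π), chr n x = if n = 0 then 2 * π else 0 := by
  split_ifs with h
  · simp [h]
  · have h2 : Complex.I * (n : ℂ) ≠ 0 := by simp [h]
    simp only [chr]
    rw [integral_exp_mul_complex h2]
    have := chr_periodic n 0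
    simp only [chr, zero_add] at this
    rw [this]
    simp

/-- The normalized Fourier coefficient `(2π)⁻¹ ∫₀^{2π} f(x) e^{-inx} dx`, for which
`f = ∑ₙ coef f n e^{inx}`. -/
def coef (f : ℝ → ℂ) (n : ℤ) : ℂ := ((√(2 * π) : ℝ) : ℂ)⁻¹ * fourierCoef f n

theorem sqrt_two_pi_ne_zero : ((√(2 * π) : ℝ) : ℂ) ≠ 0 := by
  have : 0 < √(2 * π) := Real.sqrt_pos.2 Real.two_pi_pos
  exact_mod_cast this.ne'

theorem sqrt_two_pi_sq : ((√(2 * π) : ℝ) : ℂ) * ((√(2 * π) : ℝ) : ℂ) = 2 * π := by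
  rw [← Complex.ofReal_mul, Real.mul_self_sqrt Real.two_pi_pos.le]
  push_cast
  rfl

theorem two_pi_ne_zero : (2 * π : ℂ) ≠ 0 := by
  exact_mod_cast Real.two_pi_pos.ne'

theorem coef_eq (f : ℝ → ℂ) (n : ℤ) :
    coef f n = (2 * π : ℂ)⁻¹ * ∫ x in (0 : ℝ)..(2 * π), f x * chr (-n) x := by
  simp only [coef, fourierCoef, chr_neg]
  rw [← mul_assoc, ← mul_inv, sqrt_two_pi_sq]

theorem fourierCoef_eq (f : ℝ → ℂ) (n : ℤ) :
    fourierCoef f n = ((√(2 * π) : ℝ) : ℂ) * coef f n := by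
  rw [coef, mul_inv_cancel_left₀ sqrt_two_pi_ne_zero]

theorem fourierMul_eq (σ : ℤ → ℂ) (f : ℝ → ℂ) (x : ℝ) :
    fourierMul σ f x = ∑' n : ℤ, σ n * coef f n * chr n x := by
  rw [fourierMul, ← tsum_mul_left]
  refine tsum_congr fun n => ?_
  rw [fourierCoef_eq, chr]
  have := sqrt_two_pi_ne_zero
  field_simp

/-- The sum of an absolutely convergent trigonometric series with coefficients `c i` and
frequencies `κ i`. -/
def trigSum {ι : Type*} (c : ι → ℂ) (κ : ι → ℤ) (x : ℝ) : ℂ := ∑' i, c i * chr (κ i) x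

theorem summable_trig {ι : Type*} {c : ι → ℂ} (hc : Summable fun i => ‖c i‖) (κ : ι → ℤ)
    (x : ℝ) : Summable fun i => c i * chr (κ i) x :=
  Summable.of_norm (by simpa using hc)

theorem continuous_trigSum {ι : Type*} {c : ι → ℂ} (hc : Summable fun i => ‖c i‖)
    (κ : ι → ℤ) : Continuous (trigSum c κ) :=
  continuous_tsum (fun i => continuous_const.mul (continuous_chr _)) hc (by simp)

theorem integral_trigSum_mul {ι : Type*} [Countable ι] {c : ι → ℂ}
    (hc : Summable fun i => ‖c i‖) (κ : ι → ℤ) {g : ℝ → ℂ} (hg : Continuous g) :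
    ∫ x in (0 : ℝ)..(2 * π), trigSum c κ x * g x =
      ∑' i, c i * ∫ x in (0 : ℝ)..(2 * π), chr (κ i) x * g x := by
  obtain ⟨B, hB⟩ := (isCompact_Icc (a := (0 : ℝ)) (b := 2 * π)).exists_bound_of_continuousOn
    hg.continuousOn
  have h := intervalIntegral.hasSum_integral_of_dominated_convergence
    (F := fun i x => c i * (chr (κ i) x * g x)) (f := fun x => trigSum c κ x * g x)
    (a := 0) (b := 2 * π) (μ := volume) (fun i _ => ‖c i‖ * B)
    (fun i => (continuous_const.mul
      ((continuous_chr (κ i)).mul hg)).aestronglyMeasurable)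
    (fun i => by
      refine Eventually.of_forall fun x hx => ?_
      rw [Set.uIoc_of_le Real.two_pi_pos.le] at hx
      simp only [norm_mul, norm_chr, one_mul]
      exact mul_le_mul_of_nonneg_left (hB x ⟨hx.1.le, hx.2⟩) (norm_nonneg _))
    (Eventually.of_forall fun x _ => hc.mul_right B)
    (by simp)
    (Eventually.of_forall fun x _ => by
      have := ((summable_trig hc κ x).hasSum).mul_right (g x)
      simpa [trigSum, mul_assoc] using this)
  rw [← h.tsum_eq]
  refine tsum_congr fun i => ?_
  rw [intervalIntegral.integral_const_mul]

theorem coef_trigSum {ι : Type*} [Countable ι] {c : ι → ℂ} (hc : Summable fun i => ‖c i‖)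
    (κ : ι → ℤ) (n : ℤ) : coef (trigSum c κ) n = ∑' i, if κ i = n then c i else 0 := by
  rw [coef_eq, integral_trigSum_mul hc κ (continuous_chr _), ← tsum_mul_left]
  refine tsum_congr fun i => ?_
  simp only [← chr_add, integral_chr]
  have h : κ i + -n = 0 ↔ κ i = n := by omega
  simp only [h]
  split_ifs
  · have := two_pi_ne_zero
    push_cast
    field_simp
  · simp

theorem integral_eq_coef_zero (f : ℝ → ℂ) :
    ∫ x in (0 : ℝ)..(2 * π), f x = 2 * π * coef f 0 := by
  rw [coef_eq, mul_inv_cancel_left₀ two_pi_ne_zero]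
  simp

/-- The weight `1 + |n|`. -/
def wt (n : ℤ) : ℝ := 1 + |(n : ℝ)|

theorem one_le_wt (n : ℤ) : 1 ≤ wt n := by simp [wt]

theorem wt_pos (n : ℤ) : 0 < wt n := zero_lt_one.trans_le (one_le_wt n)

theorem summable_wt_inv_sq : Summable fun n : ℤ => (wt n ^ 2)⁻¹ := by
  have h1 : Summable fun n : ℤ => ((1 : ℝ) + (n : ℝ) ^ 2)⁻¹ := by
    have h := (Real.summable_one_div_int_pow (p := 2)).2 (by norm_num)
    have h0 : Summable fun n : ℤ => (1 / (n : ℝ) ^ 2 + if n = 0 then 1 else 0) :=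
      h.add (summable_of_ne_finset_zero (s := {0}) (by intro b hb; simpa using hb))
    refine Summable.of_nonneg_of_le (fun n => by positivity) (fun n => ?_) h0
    rcases eq_or_ne n 0 with rfl | hn
    · simp
    · have : (0 : ℝ) < (n : ℝ) ^ 2 := by positivity
      simp only [hn, if_false, add_zero, one_div]
      exact inv_anti₀ this (by linarith)
  refine Summable.of_nonneg_of_le (fun n => by positivity) (fun n => ?_) h1
  refine inv_anti₀ (by positivity) ?_
  have := sq_abs (n : ℝ)
  simp only [wt]
  nlinarith [abs_nonneg (n : ℝ)]

/-- Symbols of at most polynomial growth. -/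
def PolyGrowth (σ : ℤ → ℂ) : Prop := ∃ (C : ℝ) (N : ℕ), ∀ n, ‖σ n‖ ≤ C * wt n ^ N

/-- The coefficients `c i` decrease faster than every power of the frequencies `κ i`. -/
def RapidOn {ι : Type*} (c : ι → ℂ) (κ : ι → ℤ) : Prop :=
  ∀ N : ℕ, Summable fun i => wt (κ i) ^ N * ‖c i‖

theorem RapidOn.summable {ι : Type*} {c : ι → ℂ} {κ : ι → ℤ} (hc : RapidOn c κ) :
    Summable fun i => ‖c i‖ := by
  simpa using hc 0

theorem RapidOn.mul {ι : Type*} {c : ι → ℂ} {κ : ι → ℤ} (hc : RapidOn c κ) {σ : ℤ → ℂ}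
    (hσ : PolyGrowth σ) : RapidOn (fun i => σ (κ i) * c i) κ := by
  obtain ⟨C, M, h⟩ := hσ
  intro N
  refine Summable.of_nonneg_of_le (fun i => by have := wt_pos (κ i); positivity) (fun i => ?_)
    ((hc (N + M)).mul_left C)
  rw [norm_mul, pow_add]
  have h1 := mul_le_mul_of_nonneg_right (h (κ i)) (norm_nonneg (c i))
  have h2 := mul_le_mul_of_nonneg_left h1 (pow_pos (wt_pos (κ i)) N).le
  linarith

/-- Sequences decreasing faster than every power. -/
abbrev Rapid (a : ℤ → ℂ) : Prop := RapidOn a id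

theorem Rapid.mul {a σ : ℤ → ℂ} (ha : Rapid a) (hσ : PolyGrowth σ) :
    Rapid fun n => σ n * a n := RapidOn.mul ha hσ

theorem rapid_of_pow_bound {a : ℤ → ℂ} (h : ∀ N : ℕ, ∃ C, ∀ n, wt n ^ N * ‖a n‖ ≤ C) :
    Rapid a := by
  intro N
  obtain ⟨C, hC⟩ := h (N + 2)
  refine Summable.of_nonneg_of_le (fun n => by have := wt_pos n; positivity) (fun n => ?_)
    (summable_wt_inv_sq.mul_left C)
  have hw := pow_pos (wt_pos n) 2
  rw [← div_eq_mul_inv, le_div_iff₀ hw]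
  have := hC n
  rw [pow_add] at this
  simp only [id]
  linarith

theorem polyGrowth_I_mul : PolyGrowth fun n => Complex.I * n :=
  ⟨1, 1, fun n => by simp [wt]⟩

theorem hasDerivAt_trigSum {ι : Type*} {c : ι → ℂ} {κ : ι → ℤ} (hc : RapidOn c κ) (x : ℝ) :
    HasDerivAt (trigSum c κ) (trigSum (fun i => Complex.I * κ i * c i) κ x) x := by
  have h := hasDerivAt_tsum (g := fun i x => c i * chr (κ i) x)
    (g' := fun i x => Complex.I * κ i * c i * chr (κ i) x)
    (hc.mul (σ := fun n => Complex.I * n) polyGrowth_I_mul).summable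
    (fun i y => by
      have := (hasDerivAt_chr (κ i) y).const_mul (c i)
      convert! this using 1
      ring) (fun i y => by simp) (summable_trig hc.summable κ 0) x
  exact h

theorem contDiff_trigSum {ι : Type*} {c : ι → ℂ} {κ : ι → ℤ} (hc : RapidOn c κ) :
    ContDiff ℝ ∞ (trigSum c κ) := by
  rw [contDiff_infty]
  intro n
  induction n generalizing c with
  | zero => exact contDiff_zero.2 (continuous_trigSum hc.summable κ)
  | succ n ih =>
    push_cast
    rw [contDiff_succ_iff_deriv]
    refine ⟨fun x => (hasDerivAt_trigSum hc x).differentiableAt, by simp, ?_⟩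
    have : deriv (trigSum c κ) = trigSum (fun i => Complex.I * κ i * c i) κ :=
      funext fun x => (hasDerivAt_trigSum hc x).deriv
    rw [this]
    exact ih (hc.mul (σ := fun n => Complex.I * n) polyGrowth_I_mul)

theorem trigSum_periodic {ι : Type*} (c : ι → ℂ) (κ : ι → ℤ) :
    Function.Periodic (trigSum c κ) (2 * π) := fun x =>
  tsum_congr fun i => by rw [chr_periodic (κ i) x]

theorem coef_trigSum_id {a : ℤ → ℂ} (ha : Rapid a) (n : ℤ) : coef (trigSum a id) n = a n := by
  rw [coef_trigSum ha.summable, tsum_eq_single n]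
  · simp
  · intro m hm
    simp [hm]

theorem norm_coef_le {f : ℝ → ℂ} {B : ℝ} (hB : ∀ x ∈ Set.Icc 0 (2 * π), ‖f x‖ ≤ B) (n : ℤ) :
    ‖coef f n‖ ≤ B := by
  have h := intervalIntegral.norm_integral_le_of_norm_le_const (a := 0) (b := 2 * π) (C := B)
    (f := fun x => f x * chr (-n) x) (by
      intro x hx
      rw [Set.uIoc_of_le Real.two_pi_pos.le] at hx
      simpa using hB x ⟨hx.1.le, hx.2⟩)
  rw [coef_eq, norm_mul]
  have h2 : ‖(2 * π : ℂ)⁻¹‖ = (2 * π)⁻¹ := by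
    rw [norm_inv]
    simp [abs_of_pos Real.pi_pos]
  rw [h2, inv_mul_le_iff₀ Real.two_pi_pos]
  rw [sub_zero, abs_of_pos Real.two_pi_pos] at h
  linarith

theorem coef_of_hasDerivAt {f f' : ℝ → ℂ} (hf : ∀ x, HasDerivAt f (f' x) x)
    (hf' : Continuous f') (hp : Function.Periodic f (2 * π)) (n : ℤ) :
    coef f' n = Complex.I * n * coef f n := by
  have h := intervalIntegral.integral_mul_deriv_eq_deriv_mul (a := 0) (b := 2 * π)
    (u := f) (u' := f') (v := chr (-n)) (v' := fun x => Complex.I * (-n : ℤ) * chr (-n) x)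
    (fun x _ => hf x) (fun x _ => hasDerivAt_chr _ x) (hf'.intervalIntegrable _ _)
    ((continuous_const.mul (continuous_chr _)).intervalIntegrable _ _)
  have h1 : f (2 * π) = f 0 := by simpa using hp 0
  have h2 : chr (-n) (2 * π) = chr (-n) 0 := by simpa using chr_periodic (-n) 0
  rw [h1, h2, sub_self, zero_sub] at h
  rw [coef_eq, coef_eq]
  have h3 : ∫ x in (0 : ℝ)..(2 * π), f x * (Complex.I * (-n : ℤ) * chr (-n) x) =
      (Complex.I * (-n : ℤ)) * ∫ x in (0 : ℝ)..(2 * π), f x * chr (-n) x := by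
    rw [← intervalIntegral.integral_const_mul]
    congr 1
    funext x
    ring
  rw [h3] at h
  rw [← neg_eq_iff_eq_neg] at h
  rw [← h]
  push_cast
  ring

/-- The algebra of smooth complex functions of period `2π`, the smooth functions on the torus. -/
def Sm : Subalgebra ℂ (ℝ → ℂ) where
  carrier := {f | ContDiff ℝ ∞ f ∧ Function.Periodic f (2 * π)}
  mul_mem' := fun hf hg => ⟨hf.1.mul hg.1, hf.2.mul hg.2⟩
  add_mem' := fun hf hg => ⟨hf.1.add hg.1, hf.2.add hg.2⟩
  algebraMap_mem' := fun _ => ⟨contDiff_const, fun _ => rfl⟩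

theorem periodic_deriv {f : ℝ → ℂ} (hp : Function.Periodic f (2 * π)) :
    Function.Periodic (deriv f) (2 * π) := by
  intro x
  rw [← deriv_comp_add_const]
  congr 1
  exact funext hp

theorem deriv_mem_Sm {f : ℝ → ℂ} (hf : f ∈ Sm) : deriv f ∈ Sm :=
  ⟨(contDiff_infty_iff_deriv.1 hf.1).2, periodic_deriv hf.2⟩

theorem Sm_hasDerivAt {f : ℝ → ℂ} (hf : f ∈ Sm) (x : ℝ) : HasDerivAt f (deriv f x) x :=
  (hf.1.differentiable (by simp) x).hasDerivAt

theorem coef_deriv {f : ℝ → ℂ} (hf : f ∈ Sm) (n : ℤ) :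
    coef (deriv f) n = Complex.I * n * coef f n :=
  coef_of_hasDerivAt (Sm_hasDerivAt hf) (deriv_mem_Sm hf).1.continuous hf.2 n

theorem abs_pow_mul_norm_coef {f : ℝ → ℂ} (hf : f ∈ Sm) (N : ℕ) :
    ∃ C, ∀ n : ℤ, |(n : ℝ)| ^ N * ‖coef f n‖ ≤ C := by
  induction N generalizing f with
  | zero =>
    obtain ⟨B, hB⟩ := (isCompact_Icc (a := (0 : ℝ)) (b := 2 * π)).exists_bound_of_continuousOn
      hf.1.continuous.continuousOn
    exact ⟨B, fun n => by simpa using norm_coef_le hB n⟩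
  | succ N ih =>
    obtain ⟨C, hC⟩ := ih (deriv_mem_Sm hf)
    refine ⟨C, fun n => ?_⟩
    have := hC n
    rw [coef_deriv hf, norm_mul, norm_mul, Complex.norm_I, one_mul, Complex.norm_intCast] at this
    rw [pow_succ]
    linarith

theorem wt_pow_le (n : ℤ) (N : ℕ) : wt n ^ N ≤ 2 ^ N * (1 + |(n : ℝ)| ^ N) := by
  have h0 := abs_nonneg (n : ℝ)
  rcases le_total |(n : ℝ)| 1 with h | h
  · calc wt n ^ N ≤ 2 ^ N := pow_le_pow_left₀ (wt_pos n).le (by simp only [wt]; linarith) N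
      _ ≤ _ := le_mul_of_one_le_right (by positivity) (by simp [pow_nonneg h0])
  · calc wt n ^ N ≤ (2 * |(n : ℝ)|) ^ N :=
          pow_le_pow_left₀ (wt_pos n).le (by simp only [wt]; linarith) N
      _ = 2 ^ N * |(n : ℝ)| ^ N := mul_pow _ _ _
      _ ≤ _ := mul_le_mul_of_nonneg_left (by linarith) (by positivity)

theorem rapid_coef {f : ℝ → ℂ} (hf : f ∈ Sm) : Rapid (coef f) := by
  refine rapid_of_pow_bound fun N => ?_
  obtain ⟨C, hC⟩ := abs_pow_mul_norm_coef hf N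
  obtain ⟨D, hD⟩ := abs_pow_mul_norm_coef hf 0
  refine ⟨2 ^ N * (D + C), fun n => ?_⟩
  calc wt n ^ N * ‖coef f n‖ ≤ 2 ^ N * (1 + |(n : ℝ)| ^ N) * ‖coef f n‖ :=
        mul_le_mul_of_nonneg_right (wt_pow_le n N) (norm_nonneg _)
    _ = 2 ^ N * (‖coef f n‖ + |(n : ℝ)| ^ N * ‖coef f n‖) := by ring
    _ ≤ _ := by
        have h1 := hC n
        have h2 := hD n
        simp only [pow_zero, one_mul] at h2
        gcongr

/-- Fourier inversion for smooth periodic functions. -/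
theorem trigSum_coef {f : ℝ → ℂ} (hf : f ∈ Sm) : trigSum (coef f) id = f := by
  have : Fact (0 < 2 * π) := ⟨Real.two_pi_pos⟩
  let F : C(AddCircle (2 * π), ℂ) := ⟨hf.2.lift,
    continuous_coinduced_dom.2 hf.1.continuous⟩
  have hF : ∀ x : ℝ, F (x : AddCircle (2 * π)) = f x := fun x => hf.2.lift_coe x
  have hchr : ∀ (n : ℤ) (x : ℝ), fourier n (x : AddCircle (2 * π)) = chr n x := by
    intro n x
    rw [fourier_coe_apply, chr]
    congr 1
    have := two_pi_ne_zero
    push_cast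
    field_simp
  have hco : ∀ n, fourierCoeff F n = coef f n := by
    intro n
    rw [fourierCoeff_eq_intervalIntegral _ n 0, coef_eq]
    simp only [hchr, hF, zero_add, smul_eq_mul, Complex.real_smul]
    push_cast
    rw [one_div]
    congr 2
    funext x
    ring
  have hs : Summable (fourierCoeff F) := by
    have : Summable (coef f) := (rapid_coef hf).summable.of_norm
    exact this.congr fun n => (hco n).symm
  funext x
  have h := (has_pointwise_sum_fourier_series_of_summable hs (x : AddCircle (2 * π))).tsum_eq
  rw [hF] at h
  rw [← h, trigSum]
  refine tsum_congr fun n => ?_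
  rw [hco, hchr]
  rfl

theorem trigSum_mem_Sm {ι : Type*} {c : ι → ℂ} {κ : ι → ℤ} (hc : RapidOn c κ) :
    trigSum c κ ∈ Sm :=
  ⟨contDiff_trigSum hc, trigSum_periodic _ _⟩

theorem eq_of_coef_eq {f g : ℝ → ℂ} (hf : f ∈ Sm) (hg : g ∈ Sm) (h : ∀ n, coef f n = coef g n) :
    f = g := by
  rw [← trigSum_coef hf, ← trigSum_coef hg, funext h]

theorem fourierMul_eq_trigSum (σ : ℤ → ℂ) (f : ℝ → ℂ) :
    fourierMul σ f = trigSum (fun n => σ n * coef f n) id :=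
  funext fun x => fourierMul_eq σ f x

theorem fourierMul_trigSum {ι : Type*} [Countable ι] {c : ι → ℂ} {κ : ι → ℤ}
    (hc : RapidOn c κ) {σ : ℤ → ℂ} (hσ : PolyGrowth σ) :
    fourierMul σ (trigSum c κ) = trigSum (fun i => σ (κ i) * c i) κ := by
  funext x
  have h := ((summable_trig (hc.mul hσ).summable κ x).hasSum).tsum_fiberwise κ
  rw [fourierMul_eq, trigSum, ← h.tsum_eq]
  refine tsum_congr fun n => ?_
  rw [coef_trigSum hc.summable, ← tsum_mul_left, ← tsum_mul_right,
    tsum_subtype (κ ⁻¹' {n}) fun i => σ (κ i) * c i * chr (κ i) x]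
  refine tsum_congr fun i => ?_
  by_cases hi : κ i = n
  · simp [hi]
  · simp [hi]

theorem fourierMul_mem_Sm {σ : ℤ → ℂ} (hσ : PolyGrowth σ) {f : ℝ → ℂ} (hf : f ∈ Sm) :
    fourierMul σ f ∈ Sm := by
  rw [fourierMul_eq_trigSum]
  exact trigSum_mem_Sm ((rapid_coef hf).mul hσ)

theorem coef_fourierMul {σ : ℤ → ℂ} (hσ : PolyGrowth σ) {f : ℝ → ℂ} (hf : f ∈ Sm) (n : ℤ) :
    coef (fourierMul σ f) n = σ n * coef f n := by
  rw [fourierMul_eq_trigSum, coef_trigSum_id ((rapid_coef hf).mul hσ)]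

theorem Sm_intervalIntegrable {f : ℝ → ℂ} (hf : f ∈ Sm) (n : ℤ) :
    IntervalIntegrable (fun x => f x * chr n x) volume 0 (2 * π) :=
  (hf.1.continuous.mul (continuous_chr n)).intervalIntegrable _ _

theorem coef_add {f g : ℝ → ℂ} (hf : f ∈ Sm) (hg : g ∈ Sm) (n : ℤ) :
    coef (f + g) n = coef f n + coef g n := by
  simp only [coef_eq, Pi.add_apply, add_mul]
  rw [intervalIntegral.integral_add (Sm_intervalIntegrable hf _) (Sm_intervalIntegrable hg _),
    mul_add]

theorem coef_smul (c : ℂ) (f : ℝ → ℂ) (n : ℤ) : coef (c • f) n = c * coef f n := by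
  simp only [coef_eq, Pi.smul_apply, smul_eq_mul, mul_assoc]
  rw [intervalIntegral.integral_const_mul]
  ring

/-- The coefficients of a product are the convolution of the coefficients. -/
theorem coef_mul {f g : ℝ → ℂ} (hf : f ∈ Sm) (hg : g ∈ Sm) (n : ℤ) :
    coef (f * g) n = ∑' m, coef f m * coef g (n - m) := by
  rw [coef_eq]
  have h := integral_trigSum_mul (rapid_coef hf).summable id
    (g := fun x => g x * chr (-n) x) (hg.1.continuous.mul (continuous_chr _))
  rw [trigSum_coef hf] at h
  simp only [Pi.mul_apply, mul_assoc]
  rw [h, ← tsum_mul_left]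
  refine tsum_congr fun m => ?_
  rw [coef_eq g]
  have : ∀ x, chr (id m) x * (g x * chr (-n) x) = g x * chr (-(n - m)) x := by
    intro x
    rw [show -(n - m) = m + -n by ring, chr_add]
    simp only [id]
    ring
  simp only [this]
  ring

theorem summable_coef_mul {f g : ℝ → ℂ} (hf : f ∈ Sm) (hg : g ∈ Sm) (n : ℤ) :
    Summable fun m => coef f m * coef g (n - m) := by
  obtain ⟨C, hC⟩ := abs_pow_mul_norm_coef hg 0
  refine Summable.of_norm_bounded ((rapid_coef hf).summable.mul_right C) fun m => ?_
  rw [norm_mul]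
  have := hC (n - m)
  simp only [pow_zero, one_mul] at this
  exact mul_le_mul_of_nonneg_left this (norm_nonneg _)

/-! ### The generating function of the microscopic conservation laws -/

open scoped PowerSeries

section Algebraic

variable {R S : Type*} [CommRing R] [Algebra ℂ R] [CommRing S] [Algebra ℂ S]

/-- The recursion defining `chi`, over an arbitrary commutative `ℂ`-algebra. Taking polynomials
with coefficients in an algebra of functions gives the expansion of `χₙ` along a line. -/
def absChi (L : R → R) (u : R) : ℕ → R
  | 0 => 0
  | 1 => 2 * u
  | n + 2 =>
      -(∑ j ∈ Finset.Icc 2 (n + 2), (1 / (Nat.factorial j : ℂ)) •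
          ∑ m ∈ (Finset.univ : Finset (Fin j → Fin (n + 2))).filter
              (fun m => (∀ i, 1 ≤ (m i : ℕ)) ∧ ∑ i, (m i : ℕ) = n + 2),
            ∏ i, absChi L u (m i : ℕ))
        - L (absChi L u (n + 1))
  termination_by n => n
  decreasing_by
    · exact (m i).isLt
    · omega

theorem chi_eq_absChi (L : (ℝ → ℂ) → ℝ → ℂ) (u : ℝ → ℝ) (n : ℕ) :
    chi L u n = absChi L (cplx u) n := by
  induction n using Nat.strong_induction_on with
  | _ n ih =>
    match n with
    | 0 => rw [chi, absChi]; rfl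
    | 1 => rw [chi, absChi]; rfl
    | n + 2 =>
      rw [chi, absChi]
      funext x
      rw [ih (n + 1) (by omega)]
      simp only [Pi.sub_apply, Pi.neg_apply, Finset.sum_apply, Pi.smul_apply, smul_eq_mul,
        Finset.prod_apply]
      congr 2
      refine Finset.sum_congr rfl fun j _ => ?_
      congr 1
      refine Finset.sum_congr rfl fun m _ => ?_
      refine Finset.prod_congr rfl fun i _ => ?_
      rw [ih _ (m i).isLt]

/-- The recursion is natural: homomorphisms that intertwine the operators preserve it. -/
theorem map_absChi (φ : R →ₐ[ℂ] S) {L : R → R} {L' : S → S} (h : ∀ f, φ (L f) = L' (φ f))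
    (u : R) (n : ℕ) : φ (absChi L u n) = absChi L' (φ u) n := by
  induction n using Nat.strong_induction_on with
  | _ n ih =>
    match n with
    | 0 => simp [absChi]
    | 1 => simp [absChi, map_ofNat]
    | n + 2 =>
      rw [absChi, absChi]
      simp only [map_sub, map_neg, map_sum, map_smul, map_prod, h]
      rw [ih (n + 1) (by omega)]
      congr 2
      refine Finset.sum_congr rfl fun j _ => ?_
      congr 1
      refine Finset.sum_congr rfl fun m _ => ?_
      refine Finset.prod_congr rfl fun i _ => ?_
      rw [ih _ (m i).isLt]

/-- The coefficientwise extension of a linear map to power series. -/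
def hat (T : R →ₗ[ℂ] S) : R⟦X⟧ →ₗ[ℂ] S⟦X⟧ where
  toFun F := PowerSeries.mk fun n => T (PowerSeries.coeff n F)
  map_add' F G := by ext n; simp
  map_smul' c F := by ext n; simp

@[simp] theorem coeff_hat (T : R →ₗ[ℂ] S) (F : R⟦X⟧) (n : ℕ) :
    PowerSeries.coeff n (hat T F) = T (PowerSeries.coeff n F) := by simp [hat]

theorem hat_X_mul (T : R →ₗ[ℂ] S) (F : R⟦X⟧) :
    hat T (PowerSeries.X * F) = PowerSeries.X * hat T F := by
  ext n
  cases n with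
  | zero => simp
  | succ n => simp [PowerSeries.coeff_succ_X_mul]

theorem hat_C (T : R →ₗ[ℂ] S) (r : R) :
    hat T (PowerSeries.C r) = PowerSeries.C (T r) := by
  ext n
  simp only [coeff_hat, PowerSeries.coeff_C]
  split_ifs <;> simp

/-- The generating function `∑ₙ χₙ εⁿ`. -/
def genU (L : R → R) (u : R) : R⟦X⟧ := PowerSeries.mk (absChi L u)

@[simp] theorem coeff_genU (L : R → R) (u : R) (n : ℕ) :
    PowerSeries.coeff n (genU L u) = absChi L u n := by simp [genU]

/-- The exponential of a power series without constant term: as `Fʲ` is divisible by `Xʲ`,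
only the terms with `j ≤ n` of the exponential series contribute to the coefficient of `Xⁿ`. -/
def expS (F : R⟦X⟧) : R⟦X⟧ := PowerSeries.mk fun n =>
  ∑ j ∈ Finset.range (n + 1), (1 / (Nat.factorial j : ℂ)) • PowerSeries.coeff n (F ^ j)

theorem coeff_pow_eq_zero {R : Type*} [CommRing R] {F : R⟦X⟧}
    (hF : PowerSeries.coeff 0 F = 0) {n j : ℕ} (h : n < j) : PowerSeries.coeff n (F ^ j) = 0 := by
  rw [PowerSeries.coeff_zero_eq_constantCoeff_apply] at hF
  obtain ⟨G, hG⟩ := pow_dvd_pow_of_dvd (PowerSeries.X_dvd_iff.2 hF) j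
  rw [hG, PowerSeries.coeff_X_pow_mul', if_neg (by omega)]

theorem coeff_genU_pow (L : R → R) (u : R) {j n : ℕ} (hj : 2 ≤ j) :
    PowerSeries.coeff (n + 2) (genU L u ^ j) =
      ∑ m ∈ (Finset.univ : Finset (Fin j → Fin (n + 2))).filter
              (fun m => (∀ i, 1 ≤ (m i : ℕ)) ∧ ∑ i, (m i : ℕ) = n + 2),
            ∏ i, absChi L u (m i : ℕ) := by
  have h : genU L u ^ j = ∏ _i : Fin j, genU L u := by simp
  rw [h, PowerSeries.coeff_prod]
  symm
  refine Finset.sum_of_injOn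
    (fun m : Fin j → Fin (n + 2) => Finsupp.equivFunOnFinite.symm fun i => (m i : ℕ)) ?_ ?_ ?_ ?_
  · intro a _ b _ hab
    funext i
    have := DFunLike.congr_fun hab i
    exact Fin.ext (by simpa using this)
  · intro m hm
    simp only [Finset.coe_filter, Set.mem_ofPred_eq] at hm
    simpa using hm.2.2
  · intro l hl hl'
    by_contra h0
    apply hl'
    have hl2 : ∑ i, l i = n + 2 := by simpa using (Finset.mem_finsuppAntidiag.1 hl).1
    have hpos : ∀ i, 1 ≤ l i := by
      intro i
      rw [Nat.one_le_iff_ne_zero]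
      intro hi
      exact h0 (Finset.prod_eq_zero (Finset.mem_univ i) (by simp [hi, absChi]))
    have hlt : ∀ i, l i < n + 2 := by
      intro i
      have : Nontrivial (Fin j) := Fin.nontrivial_iff_two_le.2 hj
      obtain ⟨i', hi'⟩ := exists_ne i
      have h1 : l i + l i' ≤ ∑ i, l i := by
        rw [← Finset.sum_pair hi'.symm]
        exact Finset.sum_le_sum_of_subset (Finset.subset_univ _)
      have := hpos i'
      omega
    refine ⟨fun i => ⟨l i, hlt i⟩, ?_, ?_⟩
    · simp only [Finset.coe_filter, Set.mem_ofPred_eq]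
      exact ⟨Finset.mem_univ _, hpos, hl2⟩
    · ext i
      simp
  · intro m _
    simp

/-- The Bäcklund relation `e^U - 1 + ε L U = 2 ε u`, which is the recursion for the `χₙ` written
for their generating function `U`. -/
theorem expS_genU (L : R →ₗ[ℂ] R) (u : R) :
    expS (genU L u) - 1 + PowerSeries.X * hat L (genU L u) =
      PowerSeries.X * PowerSeries.C (2 * u) := by
  ext n
  match n with
  | 0 => simp [expS]
  | 1 =>
    simp [expS, Finset.sum_range_succ, PowerSeries.coeff_succ_X_mul, PowerSeries.coeff_one,
      absChi, PowerSeries.coeff_zero_eq_constantCoeff_apply, genU]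
  | n + 2 =>
    simp only [map_add, map_sub, PowerSeries.coeff_succ_X_mul, coeff_hat, coeff_genU,
      PowerSeries.coeff_one, PowerSeries.coeff_C, expS, PowerSeries.coeff_mk]
    have hs : Finset.range (n + 2 + 1) = insert 0 (insert 1 (Finset.Icc 2 (n + 2))) := by
      ext i
      simp only [Finset.mem_range, Finset.mem_insert, Finset.mem_Icc]
      omega
    rw [hs, Finset.sum_insert (by simp), Finset.sum_insert (by simp),
      Finset.sum_congr rfl fun j hj => by rw [coeff_genU_pow L u (Finset.mem_Icc.1 hj).1]]
    simp only [pow_zero, pow_one, coeff_genU]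
    rw [absChi]
    simp only [Nat.succ_ne_zero, PowerSeries.coeff_one, if_false, smul_zero, Nat.factorial_one,
      Nat.cast_one, div_one, one_smul, zero_add, sub_zero]
    abel

/-- The power rule for a derivation `D` along a homomorphism `φ`, proved by induction together
with the multiplicativity of `φ` on powers. -/
theorem hat_pow (φ : R →ₐ[ℂ] S) (D : R →ₗ[ℂ] S)
    (hD : ∀ a b, D (a * b) = D a * φ b + φ a * D b) (F : R⟦X⟧) (j : ℕ) :
    hat D (F ^ (j + 1)) = ((j + 1 : ℕ) : ℂ) • (hat φ.toLinearMap F ^ j * hat D F) ∧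
      hat φ.toLinearMap (F ^ j) = hat φ.toLinearMap F ^ j := by
  have hmul : ∀ F G : R⟦X⟧, hat D (F * G) =
      hat D F * hat φ.toLinearMap G + hat φ.toLinearMap F * hat D G := by
    intro F G
    ext n
    simp only [coeff_hat, map_add, PowerSeries.coeff_mul, map_sum, hD, Finset.sum_add_distrib,
      AlgHom.toLinearMap_apply]
  have hmul' : ∀ F G : R⟦X⟧, hat φ.toLinearMap (F * G) =
      hat φ.toLinearMap F * hat φ.toLinearMap G := by
    intro F G
    ext n
    simp [PowerSeries.coeff_mul]
  have hone : hat φ.toLinearMap (1 : R⟦X⟧) = 1 := by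
    rw [← map_one (PowerSeries.C (R := R)), hat_C]
    simp
  have hp : ∀ j, hat φ.toLinearMap (F ^ j) = hat φ.toLinearMap F ^ j := by
    intro j
    induction j with
    | zero => simpa using hone
    | succ j ih => rw [pow_succ, hmul', ih, pow_succ]
  refine ⟨?_, hp j⟩
  induction j with
  | zero => simp
  | succ j ih =>
    rw [pow_succ, hmul, ih, hp, Nat.cast_succ (j + 1), add_smul, one_smul, smul_mul_assoc]
    congr 2
    rw [pow_succ, mul_right_comm]

/-- The chain rule for the exponential, for a derivation `D` along an algebra homomorphism. -/
theorem hat_expS (φ : R →ₐ[ℂ] S) (D : R →ₗ[ℂ] S)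
    (hD : ∀ a b, D (a * b) = D a * φ b + φ a * D b) {F : R⟦X⟧}
    (hF : PowerSeries.coeff 0 F = 0) :
    hat D (expS F) = expS (hat φ.toLinearMap F) * hat D F := by
  have hφF : PowerSeries.coeff 0 (hat φ.toLinearMap F) = 0 := by
    rw [coeff_hat, hF, map_zero]
  have hone : hat D (1 : R⟦X⟧) = 0 := by
    have h1 := hD 1 1
    simp only [map_one, mul_one, one_mul] at h1
    rw [← map_one (PowerSeries.C (R := R)), hat_C, left_eq_add.1 h1, map_zero]
  ext n
  rw [coeff_hat, expS, PowerSeries.coeff_mk, map_sum, Finset.sum_range_succ']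
  simp only [map_smul, ← coeff_hat, (hat_pow φ D hD F _).1, pow_zero, hone, map_zero, smul_zero,
    add_zero]
  simp only [PowerSeries.coeff_mul, PowerSeries.coeff_smul]
  have hfac : ∀ j : ℕ, (1 / ((j + 1).factorial : ℂ)) * ((j + 1 : ℕ) : ℂ) =
      1 / (j.factorial : ℂ) := by
    intro j
    have h1 : (j.factorial : ℂ) ≠ 0 := by exact_mod_cast j.factorial_ne_zero
    have h2 : ((j : ℂ) + 1) ≠ 0 := by exact_mod_cast j.succ_ne_zero
    rw [Nat.factorial_succ]
    push_cast
    field_simp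
  simp only [smul_smul, hfac, Finset.smul_sum]
  rw [Finset.sum_comm]
  refine Finset.sum_congr rfl fun p hp => ?_
  rw [Finset.HasAntidiagonal.mem_antidiagonal] at hp
  rw [expS, PowerSeries.coeff_mk, Finset.sum_mul]
  rcases Nat.eq_zero_or_pos p.2 with h0 | h0
  · simp [h0, hF]
  · rw [← Finset.sum_subset (Finset.range_subset_range.2 (by omega : p.1 + 1 ≤ n))]
    · exact Finset.sum_congr rfl fun j _ => (smul_mul_assoc _ _ _).symm
    · intro j _ hj
      rw [coeff_pow_eq_zero hφF (by simpa using hj)]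
      simp

/-- The linearized Bäcklund relation determines its solution: as `W` has constant term `1`, the
coefficient of `Xⁿ` of `Y` is a function of the lower ones. -/
theorem eq_zero_of_linearized {W Y : R⟦X⟧} (L : R →ₗ[ℂ] R) (hW : PowerSeries.coeff 0 W = 1)
    (h : W * Y + PowerSeries.X * hat L Y = 0) : Y = 0 := by
  ext n
  induction n using Nat.strong_induction_on with
  | _ n ih =>
    have h1 := congrArg (PowerSeries.coeff n) h
    rw [map_add, PowerSeries.coeff_mul, map_zero] at h1
    have h2 : ∑ p ∈ Finset.HasAntidiagonal.antidiagonal n,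
        PowerSeries.coeff p.1 W * PowerSeries.coeff p.2 Y = PowerSeries.coeff n Y := by
      rw [Finset.sum_eq_single (0, n)]
      · simp only [hW, one_mul]
      · intro p hp hp'
        rw [Finset.HasAntidiagonal.mem_antidiagonal] at hp
        have : p.2 < n := by
          rcases Nat.lt_or_ge p.2 n with h3 | h3
          · exact h3
          · exact absurd (Prod.ext (by simp; omega) (by simp; omega)) hp'
        rw [ih _ this]
        simp
      · simp
    have h3 : PowerSeries.coeff n (PowerSeries.X * hat L Y) = 0 := by
      cases n with
      | zero => simp
      | succ n =>
        rw [PowerSeries.coeff_succ_X_mul, coeff_hat, ih n (by omega)]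
        simp
    rw [h2, h3, add_zero] at h1
    simpa using h1

end Algebraic

/-! ### Conservation laws from the Bäcklund relation -/

section Algebraic

variable {R S : Type*} [CommRing R] [Algebra ℂ R] [CommRing S] [Algebra ℂ S]

/-- The properties of `L = (𝒢 - i) ∂ₓ + s`, of `∂ₓ` and of `J = ∫` from which the conservation
laws follow: `∂ₓ` is a derivation commuting with `L`, its values integrate to `0`, and `L` obeys a
bilinear identity, in integrated form as well. -/
structure IsDispersive (L dx : R →ₗ[ℂ] R) (J : R →ₗ[ℂ] ℂ) : Prop where
  leibniz : ∀ f g, dx (f * g) = dx f * g + f * dx g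
  comm : ∀ f, L (dx f) = dx (L f)
  bilin : ∀ f g, L (dx f * L g + L f * dx g + (2 * Complex.I) • (dx f * dx g)) =
    L f * L (dx g) + L (dx f) * L g
  int_dx : ∀ f, J (dx f) = 0
  int_bilin : ∀ f g, J (dx f * L g + L f * dx g + (2 * Complex.I) • (dx f * dx g)) = 0

/-- The linearization of the Bäcklund relation along a derivation `D`. -/
theorem genU_linearized (φ : S →ₐ[ℂ] R) (D : S →ₗ[ℂ] R)
    (hD : ∀ a b, D (a * b) = D a * φ b + φ a * D b) {L' : S →ₗ[ℂ] S} {L : R →ₗ[ℂ] R}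
    (hφ : ∀ f, φ (L' f) = L (φ f)) (hDL : ∀ f, D (L' f) = L (D f)) (w : S) :
    expS (genU L (φ w)) * hat D (genU L' w) + PowerSeries.X * hat L (hat D (genU L' w)) =
      PowerSeries.X * PowerSeries.C (2 * D w) := by
  have h := congrArg (hat D) (expS_genU L' w)
  have h0 : PowerSeries.coeff 0 (genU L' w) = 0 := by
    rw [coeff_genU, absChi]
  have h1 : hat D (1 : S⟦X⟧) = 0 := by
    have h1 := hD 1 1
    simp only [map_one, mul_one, one_mul] at h1
    rw [← map_one (PowerSeries.C (R := S)), hat_C, left_eq_add.1 h1, map_zero]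
  have h2 : hat D (hat L' (genU L' w)) = hat L (hat D (genU L' w)) := by
    ext n
    simp only [coeff_hat, hDL]
  have h3 : hat φ.toLinearMap (genU L' w) = genU L (φ w) := by
    ext n
    simp only [coeff_hat, coeff_genU, AlgHom.toLinearMap_apply]
    exact map_absChi φ hφ w n
  have h4 : D (2 * w) = 2 * D w := by
    rw [two_mul, map_add, two_mul]
  rw [map_add, map_sub, hat_expS φ D hD h0, h1, sub_zero, hat_X_mul, hat_X_mul, hat_C, h2, h3,
    h4] at h
  exact h

theorem hat_mul (dx : R →ₗ[ℂ] R) (h : ∀ f g, dx (f * g) = dx f * g + f * dx g) (F G : R⟦X⟧) :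
    hat dx (F * G) = hat dx F * G + F * hat dx G := by
  ext n
  simp only [coeff_hat, map_add, PowerSeries.coeff_mul, map_sum, h, Finset.sum_add_distrib]

/-- The bilinear identity for the coefficients of a power series, on the diagonal. -/
theorem IsDispersive.hat_bilin {L dx : R →ₗ[ℂ] R} {J : R →ₗ[ℂ] ℂ} (h : IsDispersive L dx J)
    (F : R⟦X⟧) :
    hat L (hat L F * hat dx F) + Complex.I • hat L (hat dx F * hat dx F) =
      hat L F * hat L (hat dx F) := by
  have h2 : hat L (hat dx F * hat L F + hat L F * hat dx F +
      (2 * Complex.I) • (hat dx F * hat dx F)) =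
      hat L F * hat L (hat dx F) + hat L (hat dx F) * hat L F := by
    ext n
    simp only [coeff_hat, map_add, map_smul, PowerSeries.coeff_mul, PowerSeries.coeff_smul,
      map_sum, ← Finset.sum_add_distrib, Finset.smul_sum]
    refine Finset.sum_congr rfl fun p _ => ?_
    rw [← h.bilin]
    simp only [map_add, map_smul]
  have h3 : (2 : ℂ) • (hat L (hat L F * hat dx F) + Complex.I • hat L (hat dx F * hat dx F)) =
      (2 : ℂ) • (hat L F * hat L (hat dx F)) := by
    rw [two_smul ℂ (hat L F * _), mul_comm (hat L F) (hat L (hat dx F))]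
    rw [mul_comm (hat L F) (hat L (hat dx F)), mul_comm (hat dx F) (hat L F)] at h2
    rw [← h2]
    simp only [map_add, map_smul, smul_add, smul_smul, two_smul]
  exact (smul_right_injective _ (two_ne_zero (α := ℂ))) h3

theorem IsDispersive.hat_int_bilin {L dx : R →ₗ[ℂ] R} {J : R →ₗ[ℂ] ℂ} (h : IsDispersive L dx J)
    (F : R⟦X⟧) :
    hat J (hat L F * hat dx F + Complex.I • (hat dx F * hat dx F)) = 0 := by
  have h2 : hat J (hat dx F * hat L F + hat L F * hat dx F +
      (2 * Complex.I) • (hat dx F * hat dx F)) = 0 := by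
    ext n
    simp only [coeff_hat, map_add, map_smul, PowerSeries.coeff_mul, map_sum,
      ← Finset.sum_add_distrib, Finset.smul_sum, map_zero]
    refine Finset.sum_eq_zero fun p _ => ?_
    rw [← h.int_bilin (PowerSeries.coeff p.1 F) (PowerSeries.coeff p.2 F)]
    simp only [map_add, map_smul]
  have h3 : (2 : ℂ) • hat J (hat L F * hat dx F + Complex.I • (hat dx F * hat dx F)) = 0 := by
    rw [mul_comm (hat dx F) (hat L F)] at h2
    rw [← h2]
    simp only [map_add, map_smul, smul_add, smul_smul, two_smul]
  exact (smul_eq_zero.1 h3).resolve_left two_ne_zero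

/-- The evolution of the generating function `U` when `u` solves
`∂ₜ u = L ∂ₓ u + i ∂ₓ² u - s ∂ₓ u + 2 u ∂ₓ u`. -/
def evolution (L dx : R →ₗ[ℂ] R) (s : ℂ) (u : R) (U : R⟦X⟧) : R⟦X⟧ :=
  hat L (hat dx U) + Complex.I • hat dx (hat dx U) - s • hat dx U +
    PowerSeries.C (2 * u) * hat dx U + Complex.I • (hat dx U * hat dx U)

/-- If `D` is a time derivative and `u` solves the equation, then the generating function
evolves by `evolution`: both sides solve the same linearized Bäcklund relation. Here `φ` is the
evaluation along which `D` is a derivation, as for `D` the derivative of a curve at time `0`. -/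
theorem IsDispersive.hat_genU_eq {L dx : R →ₗ[ℂ] R} {J : R →ₗ[ℂ] ℂ} (h : IsDispersive L dx J)
    (φ : S →ₐ[ℂ] R) (D : S →ₗ[ℂ] R)
    (hD : ∀ a b, D (a * b) = D a * φ b + φ a * D b) {L' : S →ₗ[ℂ] S}
    (hφ : ∀ f, φ (L' f) = L (φ f)) (hDL : ∀ f, D (L' f) = L (D f)) (s : ℂ) {w : S} {u : R}
    (hu : φ w = u)
    (hv : D w = L (dx u) + Complex.I • dx (dx u) - s • dx u + 2 * u * dx u) :
    hat D (genU L' w) = evolution L dx s u (genU L u) := by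
  subst hu
  set u := φ w
  have h1 := genU_linearized φ D hD hφ hDL w
  change expS (genU L u) * _ + _ = _ at h1
  set U := genU L u with hU
  set W := expS U with hW
  have h0 : PowerSeries.coeff 0 U = 0 := by
    rw [hU, coeff_genU, absChi]
  have hW0 : PowerSeries.coeff 0 W = 1 := by
    simp [hW, expS]
  have hdW : hat dx W = W * hat dx U := by
    have := hat_expS (AlgHom.id ℂ R) dx (fun a b => h.leibniz a b) h0
    rw [this]
    congr 2
    ext n
    simp
  have hcomm : ∀ F, hat dx (hat L F) = hat L (hat dx F) := by
    intro F
    ext n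
    simp only [coeff_hat, h.comm]
  have e0 := expS_genU L u
  rw [← hU, ← hW] at e0
  have hd2 : ∀ f, dx (2 * f) = 2 * dx f := fun f => by rw [two_mul, map_add, two_mul]
  have hL2 : ∀ f, L (2 * f) = 2 * L f := fun f => by rw [two_mul, map_add, two_mul]
  have e1 : W * hat dx U + PowerSeries.X * hat L (hat dx U) =
      PowerSeries.X * PowerSeries.C (2 * dx u) := by
    have := congrArg (hat dx) e0
    have hone : hat dx (1 : R⟦X⟧) = 0 := by
      have h1 := h.leibniz 1 1
      simp only [mul_one, one_mul] at h1
      rw [← map_one (PowerSeries.C (R := R)), hat_C, left_eq_add.1 h1, map_zero]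
    rwa [map_add, map_sub, hone, sub_zero, hat_X_mul, hat_X_mul, hat_C, hcomm, hdW,
      hd2] at this
  have e2 : (W * hat dx U * hat dx U + W * hat dx (hat dx U)) +
      PowerSeries.X * hat L (hat dx (hat dx U)) =
      PowerSeries.X * PowerSeries.C (2 * dx (dx u)) := by
    have := congrArg (hat dx) e1
    rwa [map_add, hat_mul dx h.leibniz, hdW, hat_X_mul, hat_X_mul, hat_C, hcomm, hd2] at this
  have e3 : hat L (W * hat dx U) + PowerSeries.X * hat L (hat L (hat dx U)) =
      PowerSeries.X * PowerSeries.C (2 * L (dx u)) := by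
    have := congrArg (hat L) e1
    rwa [map_add, hat_X_mul, hat_X_mul, hat_C, hL2] at this
  have e4 : PowerSeries.X * hat L (PowerSeries.C (2 * u) * hat dx U) =
      hat L (W * hat dx U) - hat L (hat dx U) +
        PowerSeries.X * hat L (hat L U * hat dx U) := by
    rw [← hat_X_mul, ← hat_X_mul, ← mul_assoc, ← e0, ← map_sub, ← map_add]
    congr 1
    ring
  have e5 := h.hat_bilin U
  have e6 : W * evolution L dx s u U + PowerSeries.X * hat L (evolution L dx s u U) =
      PowerSeries.X * PowerSeries.C (2 * D w) := by
    rw [hv]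
    simp only [evolution, map_add, map_sub, map_smul, mul_add, mul_sub]
    have hC : ∀ (c : ℂ) (r : R), PowerSeries.C (2 * c • r) =
        algebraMap ℂ R⟦X⟧ c * PowerSeries.C (2 * r) := by
      intro c r
      rw [mul_smul_comm, ← Algebra.smul_def]
      ext n
      simp only [PowerSeries.coeff_C, PowerSeries.coeff_smul]
      split_ifs <;> simp
    rw [hC, hC, show (2 : R) * (2 * u * dx u) = 2 * u * (2 * dx u) by ring,
      map_mul PowerSeries.C (2 * u)]
    simp only [Algebra.smul_def] at e5 ⊢
    -- `e0` is the Bäcklund relation, `e1` and `e2` its first two derivatives in `x`, `e3` the image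
    -- of `e1` under `L`; `e4` removes the product with `u` and `e5` the remaining bilinear terms
    linear_combination e3 + algebraMap ℂ R⟦X⟧ Complex.I * e2 - algebraMap ℂ R⟦X⟧ s * e1 + e4 +
      PowerSeries.X * e5 + PowerSeries.C (2 * u) * e1 + hat L (hat dx U) * e0
  rw [← sub_eq_zero]
  refine eq_zero_of_linearized L hW0 ?_
  rw [map_sub]
  linear_combination h1 - e6

/-- The evolution of the generating function has integral zero: by the Bäcklund relation the
term `2 u ∂ₓ U` is `ε⁻¹ ∂ₓ (e^U - U)` plus `L U ∂ₓ U`, which pairs with `i (∂ₓ U)²` in the bilinear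
identity; all other terms are derivatives. -/
theorem IsDispersive.hat_evolution {L dx : R →ₗ[ℂ] R} {J : R →ₗ[ℂ] ℂ} (h : IsDispersive L dx J)
    (s : ℂ) (u : R) : hat J (evolution L dx s u (genU L u)) = 0 := by
  set U := genU L u with hU
  set W := expS U with hW
  have h0 : PowerSeries.coeff 0 U = 0 := by
    rw [hU, coeff_genU, absChi]
  have hdW : hat dx W = W * hat dx U := by
    have := hat_expS (AlgHom.id ℂ R) dx (fun a b => h.leibniz a b) h0
    rw [this]
    congr 2
    ext n
    simp
  have hcomm : ∀ F, hat dx (hat L F) = hat L (hat dx F) := by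
    intro F
    ext n
    simp only [coeff_hat, h.comm]
  have hJ : ∀ F, hat J (hat dx F) = 0 := by
    intro F
    ext n
    simp only [coeff_hat, h.int_dx, map_zero]
  have e0 := expS_genU L u
  rw [← hU, ← hW] at e0
  have e1 : PowerSeries.X * evolution L dx s u U =
      PowerSeries.X * hat dx (hat L U) + Complex.I • (PowerSeries.X * hat dx (hat dx U)) -
        s • (PowerSeries.X * hat dx U) + (hat dx W - hat dx U) +
        PowerSeries.X * (hat L U * hat dx U + Complex.I • (hat dx U * hat dx U)) := by
    rw [evolution, hdW, hcomm]
    simp only [Algebra.smul_def]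
    linear_combination - hat dx U * e0
  have e2 := congrArg (hat J) e1
  simp only [map_add, map_sub, map_smul, hat_X_mul, hJ, h.hat_int_bilin] at e2
  have e3 : PowerSeries.X * hat J (evolution L dx s u U) = 0 := by
    rw [e2]
    simp
  ext n
  have := congrArg (PowerSeries.coeff (n + 1)) e3
  rwa [PowerSeries.coeff_succ_X_mul, map_zero] at this

/-- The integrals of the `χₙ` are conserved to first order along the flow. -/
theorem IsDispersive.int_absChi_eq_zero {L dx : R →ₗ[ℂ] R} {J : R →ₗ[ℂ] ℂ}
    (h : IsDispersive L dx J) (φ : S →ₐ[ℂ] R) (D : S →ₗ[ℂ] R)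
    (hD : ∀ a b, D (a * b) = D a * φ b + φ a * D b) {L' : S →ₗ[ℂ] S}
    (hφ : ∀ f, φ (L' f) = L (φ f)) (hDL : ∀ f, D (L' f) = L (D f)) (s : ℂ) {w : S} {u : R}
    (hu : φ w = u)
    (hv : D w = L (dx u) + Complex.I • dx (dx u) - s • dx u + 2 * u * dx u) (n : ℕ) :
    J (D (absChi L' w n)) = 0 := by
  have h1 := congrArg (fun F => PowerSeries.coeff n (hat J F))
    (h.hat_genU_eq φ D hD hφ hDL s hu hv)
  simp only [h.hat_evolution, map_zero, coeff_hat, coeff_genU] at h1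
  exact h1

end Algebraic

/-! ### Polynomial functionals with symbols -/

/-- The weight `1 + |ν₁| + ⋯ + |ν_d|`. -/
def sz {d : ℕ} (ν : Fin d → ℤ) : ℝ := 1 + ∑ i, |(ν i : ℝ)|

theorem one_le_sz {d : ℕ} (ν : Fin d → ℤ) : 1 ≤ sz ν := by
  have : 0 ≤ ∑ i, |(ν i : ℝ)| := Finset.sum_nonneg fun i _ => abs_nonneg _
  simp only [sz]
  linarith

theorem sz_pos {d : ℕ} (ν : Fin d → ℤ) : 0 < sz ν := zero_lt_one.trans_le (one_le_sz ν)

theorem sz_le_prod {d : ℕ} (ν : Fin d → ℤ) : sz ν ≤ ∏ i, wt (ν i) := by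
  have h : ∀ s : Finset (Fin d), 1 + ∑ i ∈ s, |(ν i : ℝ)| ≤ ∏ i ∈ s, wt (ν i) := by
    intro s
    induction s using Finset.induction_on with
    | empty => simp
    | insert a s ha ih =>
      rw [Finset.sum_insert ha, Finset.prod_insert ha]
      have h0 := abs_nonneg (ν a : ℝ)
      have h1 : 0 ≤ ∑ i ∈ s, |(ν i : ℝ)| := Finset.sum_nonneg fun i _ => abs_nonneg _
      simp only [wt] at ih ⊢
      nlinarith
  exact h Finset.univ

theorem wt_sum_le_sz {d : ℕ} (ν : Fin d → ℤ) : wt (∑ i, ν i) ≤ sz ν := by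
  simp only [wt, sz]
  push_cast
  linarith [Finset.abs_sum_le_sum_abs (fun i => (ν i : ℝ)) Finset.univ]

theorem sz_left_le {p q : ℕ} (ν : Fin (p + q) → ℤ) : sz (fun i => ν (Fin.castAdd q i)) ≤ sz ν := by
  simp only [sz, Fin.sum_univ_add]
  have : 0 ≤ ∑ i : Fin q, |(ν (Fin.natAdd p i) : ℝ)| := Finset.sum_nonneg fun i _ => abs_nonneg _
  linarith

theorem sz_right_le {p q : ℕ} (ν : Fin (p + q) → ℤ) : sz (fun i => ν (Fin.natAdd p i)) ≤ sz ν := by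
  simp only [sz, Fin.sum_univ_add]
  have : 0 ≤ ∑ i : Fin p, |(ν (Fin.castAdd q i) : ℝ)| := Finset.sum_nonneg fun i _ => abs_nonneg _
  linarith

theorem hasSum_pi_prod {d : ℕ} {b : Fin d → ℤ → ℝ} (h0 : ∀ i n, 0 ≤ b i n)
    (hb : ∀ i, Summable (b i)) :
    HasSum (fun ν : Fin d → ℤ => ∏ i, b i (ν i)) (∏ i, ∑' n, b i n) := by
  induction d with
  | zero => simp
  | succ d ih =>
    have h1 := ih (b := fun i => b i.succ) (fun i => h0 _) (fun i => hb _)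
    set B : (Fin d → ℤ) → ℝ := fun ν => ∏ i, b i.succ (ν i) with hB
    have hB0 : 0 ≤ B := by
      intro ν
      exact Finset.prod_nonneg fun i _ => h0 _ _
    have hb0 : 0 ≤ b 0 := by
      intro n
      exact h0 0 n
    have h3 : Summable fun z : ℤ × (Fin d → ℤ) => b 0 z.1 * B z.2 :=
      (hb 0).mul_of_nonneg h1.summable hb0 hB0
    have h2 := HasSum.mul (hb 0).hasSum h1 h3
    rw [← Fin.prod_univ_succ (fun i => ∑' n, b i n)] at h2
    rw [← (Fin.consEquiv fun _ : Fin (d + 1) => ℤ).hasSum_iff]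
    convert! h2 using 1
    funext z
    simp [Fin.consEquiv, Fin.prod_univ_succ, hB]

/-- The homogeneous polynomial map of degree `d` with symbol `m`,
`x ↦ ∑_ν m(ν) a(ν₁) ⋯ a(ν_d) e^{i(ν₁ + ⋯ + ν_d)x}`. -/
def monoFun {d : ℕ} (m : (Fin d → ℤ) → ℂ) (a : ℤ → ℂ) : ℝ → ℂ :=
  trigSum (fun ν : Fin d → ℤ => m ν * ∏ i, a (ν i)) fun ν => ∑ i, ν i

/-- Multilinear symbols of at most polynomial growth. -/
def PolyBd {d : ℕ} (m : (Fin d → ℤ) → ℂ) : Prop := ∃ (K : ℝ) (N : ℕ), ∀ ν, ‖m ν‖ ≤ K * sz ν ^ N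

/-- The coefficients of a homogeneous polynomial map decrease rapidly in the total frequency
`∑ νᵢ`; in particular they are absolutely summable. -/
theorem rapidOn_mono {d : ℕ} {m : (Fin d → ℤ) → ℂ} (hm : PolyBd m) {a : ℤ → ℂ} (ha : Rapid a) :
    RapidOn (fun ν : Fin d → ℤ => m ν * ∏ i, a (ν i)) fun ν => ∑ i, ν i := by
  obtain ⟨K, M, hK⟩ := hm
  intro N
  have h := (hasSum_pi_prod (d := d) (b := fun _ n => wt n ^ (N + M) * ‖a n‖)
    (fun i n => by have := wt_pos n; positivity) (fun i => ha (N + M))).summable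
  refine Summable.of_nonneg_of_le
    (fun ν => mul_nonneg (pow_nonneg (wt_pos _).le _) (norm_nonneg _)) (fun ν => ?_) (h.mul_left K)
  have h1 : wt (∑ i, ν i) ^ N ≤ sz ν ^ N := pow_le_pow_left₀ (wt_pos _).le (wt_sum_le_sz ν) N
  have h2 : sz ν ^ (N + M) ≤ ∏ i, wt (ν i) ^ (N + M) := by
    rw [Finset.prod_pow]
    exact pow_le_pow_left₀ (sz_pos ν).le (sz_le_prod ν) _
  have hK0 : 0 ≤ K := by
    have := (norm_nonneg _).trans (hK ν)
    exact nonneg_of_mul_nonneg_left this (pow_pos (sz_pos ν) M)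
  rw [norm_mul, norm_prod, Finset.prod_mul_distrib]
  have hp : 0 ≤ ∏ i, ‖a (ν i)‖ := Finset.prod_nonneg fun i _ => norm_nonneg _
  have hs := sz_pos ν
  calc wt (∑ i, ν i) ^ N * (‖m ν‖ * ∏ i, ‖a (ν i)‖)
      ≤ sz ν ^ N * ((K * sz ν ^ M) * ∏ i, ‖a (ν i)‖) := by
        gcongr
        exact hK ν
    _ = K * (sz ν ^ (N + M) * ∏ i, ‖a (ν i)‖) := by rw [pow_add]; ring
    _ ≤ _ := by gcongr

theorem monoFun_mem_Sm {d : ℕ} {m : (Fin d → ℤ) → ℂ} (hm : PolyBd m) {a : ℤ → ℂ}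
    (ha : Rapid a) : monoFun m a ∈ Sm := trigSum_mem_Sm (rapidOn_mono hm ha)

theorem monoFun_mul {p q : ℕ} {m : (Fin p → ℤ) → ℂ} {m' : (Fin q → ℤ) → ℂ} (hm : PolyBd m)
    (hm' : PolyBd m') {a : ℤ → ℂ} (ha : Rapid a) :
    monoFun m a * monoFun m' a = monoFun (fun ν : Fin (p + q) → ℤ =>
      m (fun i => ν (Fin.castAdd q i)) * m' (fun i => ν (Fin.natAdd p i))) a := by
  funext x
  simp only [Pi.mul_apply, monoFun, trigSum]
  have h1 := (rapidOn_mono hm ha).summable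
  have h2 := (rapidOn_mono hm' ha).summable
  rw [tsum_mul_tsum_of_summable_norm (by simpa using h1) (by simpa using h2),
    ← (Fin.appendEquiv p q).tsum_eq]
  refine tsum_congr fun z => ?_
  simp only [Fin.appendEquiv, Equiv.coe_fn_mk, Fin.append_left, Fin.append_right,
    Fin.prod_univ_add, Fin.sum_univ_add, chr_add]
  ring

theorem fourierMul_monoFun {d : ℕ} {m : (Fin d → ℤ) → ℂ} (hm : PolyBd m) {a : ℤ → ℂ}
    (ha : Rapid a) {σ : ℤ → ℂ} (hσ : PolyGrowth σ) :
    fourierMul σ (monoFun m a) = monoFun (fun ν => σ (∑ i, ν i) * m ν) a := by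
  rw [monoFun, fourierMul_trigSum (rapidOn_mono hm ha) hσ, monoFun]
  simp only [mul_assoc]

/-- Linear growth with constant `C`. -/
def LinBound (C : ℝ) (ℓ : ℤ → ℂ) : Prop := ∀ n, ‖ℓ n‖ ≤ C * wt n

/-- Families of symbols of degree `d`, depending on the symbol `ℓ` of the linear operator, that
grow like the power `n - d` of the frequencies, uniformly for `ℓ` of uniformly linear growth,
and depend continuously on `ℓ` for pointwise convergence. The number `n` counts factors of `u` and
applications of the operator together, as the index of `χₙ` does. -/
structure IsSymb (n d : ℕ) (m : (ℤ → ℂ) → (Fin d → ℤ) → ℂ) : Prop where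
  le : d ≤ n
  cont : ∀ ν, Continuous fun ℓ => m ℓ ν
  bound : ∀ C, ∃ K, 0 ≤ K ∧ ∀ ℓ, LinBound C ℓ → ∀ ν, ‖m ℓ ν‖ ≤ K * sz ν ^ (n - d)

theorem IsSymb.polyBd {n d : ℕ} {m : (ℤ → ℂ) → (Fin d → ℤ) → ℂ} (h : IsSymb n d m) {ℓ : ℤ → ℂ}
    {C : ℝ} (hℓ : LinBound C ℓ) : PolyBd (m ℓ) := by
  obtain ⟨K, _, hK⟩ := h.bound C
  exact ⟨K, n - d, hK ℓ hℓ⟩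

theorem LinBound.polyGrowth {C : ℝ} {ℓ : ℤ → ℂ} (h : LinBound C ℓ) : PolyGrowth ℓ :=
  ⟨C, 1, fun n => by simpa using h n⟩

theorem IsSymb.zero {n d : ℕ} (h : d ≤ n) : IsSymb n d fun _ _ => 0 :=
  ⟨h, fun _ => continuous_const, fun _ => ⟨0, le_rfl, by simp⟩⟩

theorem IsSymb.add {n d : ℕ} {m m' : (ℤ → ℂ) → (Fin d → ℤ) → ℂ} (h : IsSymb n d m)
    (h' : IsSymb n d m') : IsSymb n d fun ℓ ν => m ℓ ν + m' ℓ ν := by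
  refine ⟨h.le, fun ν => (h.cont ν).add (h'.cont ν), fun C => ?_⟩
  obtain ⟨K, hK0, hK⟩ := h.bound C
  obtain ⟨K', hK0', hK'⟩ := h'.bound C
  refine ⟨K + K', add_nonneg hK0 hK0', fun ℓ hℓ ν => (norm_add_le _ _).trans ?_⟩
  rw [add_mul]
  exact add_le_add (hK ℓ hℓ ν) (hK' ℓ hℓ ν)

theorem IsSymb.mul {n n' d d' : ℕ} {m : (ℤ → ℂ) → (Fin d → ℤ) → ℂ}
    {m' : (ℤ → ℂ) → (Fin d' → ℤ) → ℂ} (h : IsSymb n d m) (h' : IsSymb n' d' m') :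
    IsSymb (n + n') (d + d') fun ℓ ν =>
      m ℓ (fun i => ν (Fin.castAdd d' i)) * m' ℓ (fun i => ν (Fin.natAdd d i)) := by
  have hle := h.le
  have hle' := h'.le
  refine ⟨by omega, fun ν => (h.cont _).mul (h'.cont _), fun C => ?_⟩
  obtain ⟨K, hK0, hK⟩ := h.bound C
  obtain ⟨K', hK0', hK'⟩ := h'.bound C
  refine ⟨K * K', mul_nonneg hK0 hK0', fun ℓ hℓ ν => ?_⟩
  rw [norm_mul, show n + n' - (d + d') = (n - d) + (n' - d') by omega, pow_add]
  have h1 := pow_le_pow_left₀ (sz_pos _).le (sz_left_le ν) (n - d)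
  have h2 := pow_le_pow_left₀ (sz_pos _).le (sz_right_le ν) (n' - d')
  calc _ ≤ (K * sz (fun i => ν (Fin.castAdd d' i)) ^ (n - d)) *
        (K' * sz (fun i => ν (Fin.natAdd d i)) ^ (n' - d')) :=
        mul_le_mul (hK ℓ hℓ _) (hK' ℓ hℓ _) (norm_nonneg _)
          (mul_nonneg hK0 (pow_nonneg (sz_pos _).le _))
    _ ≤ (K * sz ν ^ (n - d)) * (K' * sz ν ^ (n' - d')) := by
        have := sz_pos (fun i => ν (Fin.natAdd d i))
        have := sz_pos ν
        gcongr
    _ = _ := by ring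

theorem IsSymb.smul {n d : ℕ} {m : (ℤ → ℂ) → (Fin d → ℤ) → ℂ} (h : IsSymb n d m)
    {c : (ℤ → ℂ) → ℂ} (hc : Continuous c) (hb : ∀ C, ∃ K, ∀ ℓ, LinBound C ℓ → ‖c ℓ‖ ≤ K) :
    IsSymb n d fun ℓ ν => c ℓ * m ℓ ν := by
  refine ⟨h.le, fun ν => hc.mul (h.cont ν), fun C => ?_⟩
  obtain ⟨K, hK0, hK⟩ := h.bound C
  obtain ⟨K', hK'⟩ := hb C
  refine ⟨|K'| * K, by positivity, fun ℓ hℓ ν => ?_⟩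
  rw [norm_mul, mul_assoc]
  exact mul_le_mul ((hK' ℓ hℓ).trans (le_abs_self _)) (hK ℓ hℓ ν) (norm_nonneg _) (abs_nonneg _)

theorem IsSymb.of_le {n n' d : ℕ} {m : (ℤ → ℂ) → (Fin d → ℤ) → ℂ} (h : IsSymb n d m)
    (hn : n ≤ n') : IsSymb n' d m := by
  refine ⟨h.le.trans hn, h.cont, fun C => ?_⟩
  obtain ⟨K, hK0, hK⟩ := h.bound C
  exact ⟨K, hK0, fun ℓ hℓ ν => (hK ℓ hℓ ν).trans
    (mul_le_mul_of_nonneg_left (pow_le_pow_right₀ (one_le_sz ν) (by omega)) hK0)⟩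

theorem IsSymb.op {n d : ℕ} {m : (ℤ → ℂ) → (Fin d → ℤ) → ℂ} (h : IsSymb n d m) :
    IsSymb (n + 1) d fun ℓ ν => ℓ (∑ i, ν i) * m ℓ ν := by
  have hle := h.le
  refine ⟨by omega, fun ν => (continuous_apply _).mul (h.cont ν), fun C => ?_⟩
  obtain ⟨K, hK0, hK⟩ := h.bound C
  refine ⟨|C| * K, by positivity, fun ℓ hℓ ν => ?_⟩
  have hs := sz_pos ν
  rw [norm_mul, show n + 1 - d = (n - d) + 1 by omega, pow_succ]
  calc ‖ℓ (∑ i, ν i)‖ * ‖m ℓ ν‖ ≤ (|C| * sz ν) * (K * sz ν ^ (n - d)) := by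
        refine mul_le_mul ((hℓ _).trans ?_) (hK ℓ hℓ ν) (norm_nonneg _) (by positivity)
        exact mul_le_mul (le_abs_self C) (wt_sum_le_sz ν) (wt_pos _).le (abs_nonneg _)
    _ = _ := by ring

/-- Finite sums of homogeneous polynomial maps with symbols as in `IsSymb`. The argument `ℓ` is
the symbol of the linear operator and `a` the sequence of Fourier coefficients; nothing is required
of arguments outside the ranges `LinBound` and `Rapid`, where the series may diverge. -/
inductive IsPoly : ℕ → ((ℤ → ℂ) → (ℤ → ℂ) → ℝ → ℂ) → Prop
  | of_symb {n d : ℕ} {m : (ℤ → ℂ) → (Fin d → ℤ) → ℂ} {F : (ℤ → ℂ) → (ℤ → ℂ) → ℝ → ℂ}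
      (hm : IsSymb n d m)
      (h : ∀ (C : ℝ) (ℓ a : ℤ → ℂ), LinBound C ℓ → Rapid a → F ℓ a = monoFun (m ℓ) a) :
      IsPoly n F
  | zero {n : ℕ} {F : (ℤ → ℂ) → (ℤ → ℂ) → ℝ → ℂ}
      (h : ∀ (C : ℝ) (ℓ a : ℤ → ℂ), LinBound C ℓ → Rapid a → F ℓ a = 0) : IsPoly n F
  | add {n : ℕ} {F G H : (ℤ → ℂ) → (ℤ → ℂ) → ℝ → ℂ} (hF : IsPoly n F) (hG : IsPoly n G)
      (h : ∀ (C : ℝ) (ℓ a : ℤ → ℂ), LinBound C ℓ → Rapid a → H ℓ a = F ℓ a + G ℓ a) :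
      IsPoly n H

theorem IsPoly.mem_Sm {n : ℕ} {F : (ℤ → ℂ) → (ℤ → ℂ) → ℝ → ℂ} (hF : IsPoly n F) {C : ℝ}
    {ℓ a : ℤ → ℂ} (hℓ : LinBound C ℓ) (ha : Rapid a) : F ℓ a ∈ Sm := by
  induction hF with
  | of_symb hm h =>
    rw [h C ℓ a hℓ ha]
    exact monoFun_mem_Sm (hm.polyBd hℓ) ha
  | zero h =>
    rw [h C ℓ a hℓ ha]
    exact Sm.zero_mem
  | add _ _ h ih ih' =>
    rw [h C ℓ a hℓ ha]
    exact Sm.add_mem ih ih'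

theorem IsPoly.congr {n : ℕ} {F G : (ℤ → ℂ) → (ℤ → ℂ) → ℝ → ℂ} (hF : IsPoly n F)
    (h : ∀ (C : ℝ) (ℓ a : ℤ → ℂ), LinBound C ℓ → Rapid a → G ℓ a = F ℓ a) : IsPoly n G :=
  hF.add (.zero (F := fun _ _ => 0) fun _ _ _ _ _ => rfl) fun C ℓ a hℓ ha => by
    rw [h C ℓ a hℓ ha, add_zero]

theorem IsPoly.of_le {n n' : ℕ} {F : (ℤ → ℂ) → (ℤ → ℂ) → ℝ → ℂ} (hF : IsPoly n F)
    (hn : n ≤ n') : IsPoly n' F := by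
  induction hF with
  | of_symb hm h => exact .of_symb (hm.of_le hn) h
  | zero h => exact .zero h
  | add _ _ h ih ih' => exact .add ih ih' h

theorem IsPoly.smul {n : ℕ} {F : (ℤ → ℂ) → (ℤ → ℂ) → ℝ → ℂ} (hF : IsPoly n F)
    {c : (ℤ → ℂ) → ℂ} (hc : Continuous c) (hb : ∀ C, ∃ K, ∀ ℓ, LinBound C ℓ → ‖c ℓ‖ ≤ K) :
    IsPoly n fun ℓ a => c ℓ • F ℓ a := by
  induction hF with
  | of_symb hm h =>
    refine .of_symb (hm.smul hc hb) fun C ℓ a hℓ ha => ?_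
    rw [h C ℓ a hℓ ha]
    funext x
    simp only [monoFun, trigSum, Pi.smul_apply, smul_eq_mul, ← tsum_mul_left, mul_assoc]
  | zero h =>
    refine .zero fun C ℓ a hℓ ha => ?_
    rw [h C ℓ a hℓ ha, smul_zero]
  | add _ _ h ih ih' =>
    refine .add ih ih' fun C ℓ a hℓ ha => ?_
    rw [h C ℓ a hℓ ha, smul_add]

theorem IsPoly.const_smul {n : ℕ} {F : (ℤ → ℂ) → (ℤ → ℂ) → ℝ → ℂ} (hF : IsPoly n F) (c : ℂ) :
    IsPoly n fun ℓ a => c • F ℓ a :=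
  hF.smul continuous_const fun _ => ⟨‖c‖, fun _ _ => le_rfl⟩

theorem IsPoly.sum {ι : Type*} (s : Finset ι) {n : ℕ} {F : ι → (ℤ → ℂ) → (ℤ → ℂ) → ℝ → ℂ}
    (hF : ∀ i ∈ s, IsPoly n (F i)) : IsPoly n fun ℓ a => ∑ i ∈ s, F i ℓ a := by
  classical
  induction s using Finset.induction_on with
  | empty => exact .zero fun _ _ _ _ _ => by simp
  | insert i s hi ih =>
    exact .add (hF i (by simp)) (ih fun j hj => hF j (by simp [hj]))
      fun _ _ _ _ _ => by rw [Finset.sum_insert hi]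

theorem IsPoly.mul {n n' : ℕ} {F G : (ℤ → ℂ) → (ℤ → ℂ) → ℝ → ℂ} (hF : IsPoly n F)
    (hG : IsPoly n' G) : IsPoly (n + n') fun ℓ a => F ℓ a * G ℓ a := by
  induction hF with
  | of_symb hm h =>
    induction hG with
    | of_symb hm' h' =>
      refine .of_symb (hm.mul hm') fun C ℓ a hℓ ha => ?_
      rw [h C ℓ a hℓ ha, h' C ℓ a hℓ ha, monoFun_mul (hm.polyBd hℓ) (hm'.polyBd hℓ) ha]
    | zero h' => exact .zero fun C ℓ a hℓ ha => by rw [h' C ℓ a hℓ ha, mul_zero]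
    | add _ _ h' ih ih' =>
      exact .add ih ih' fun C ℓ a hℓ ha => by rw [h' C ℓ a hℓ ha, mul_add]
  | zero h => exact .zero fun C ℓ a hℓ ha => by rw [h C ℓ a hℓ ha, zero_mul]
  | add _ _ h ih ih' =>
    exact .add ih ih' fun C ℓ a hℓ ha => by rw [h C ℓ a hℓ ha, add_mul]

theorem IsPoly.one : IsPoly 0 fun _ _ => 1 := by
  refine .of_symb (d := 0) (m := fun _ _ => 1) ⟨le_rfl, fun _ => continuous_const, fun _ =>
    ⟨1, zero_le_one, by simp⟩⟩ fun C ℓ a _ _ => ?_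
  funext x
  simp [monoFun, trigSum]

theorem IsPoly.prod {j : ℕ} {n : Fin j → ℕ} {F : Fin j → (ℤ → ℂ) → (ℤ → ℂ) → ℝ → ℂ}
    (hF : ∀ i, IsPoly (n i) (F i)) : IsPoly (∑ i, n i) fun ℓ a => ∏ i, F i ℓ a := by
  induction j with
  | zero => simpa using IsPoly.one
  | succ j ih =>
    rw [Fin.sum_univ_succ]
    simp only [Fin.prod_univ_succ]
    exact (hF 0).mul (ih fun i => hF i.succ)

theorem fourierMul_add {σ : ℤ → ℂ} (hσ : PolyGrowth σ) {f g : ℝ → ℂ} (hf : f ∈ Sm)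
    (hg : g ∈ Sm) : fourierMul σ (f + g) = fourierMul σ f + fourierMul σ g := by
  have h1 := fourierMul_mem_Sm hσ hf
  have h2 := fourierMul_mem_Sm hσ hg
  refine eq_of_coef_eq (fourierMul_mem_Sm hσ (Sm.add_mem hf hg)) (Sm.add_mem h1 h2) fun n => ?_
  rw [coef_add h1 h2, coef_fourierMul hσ hf, coef_fourierMul hσ hg,
    coef_fourierMul hσ (Sm.add_mem hf hg), coef_add hf hg, mul_add]

theorem IsPoly.op {n : ℕ} {F : (ℤ → ℂ) → (ℤ → ℂ) → ℝ → ℂ} (hF : IsPoly n F) :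
    IsPoly (n + 1) fun ℓ a => fourierMul ℓ (F ℓ a) := by
  induction hF with
  | of_symb hm h =>
    refine .of_symb hm.op fun C ℓ a hℓ ha => ?_
    rw [h C ℓ a hℓ ha, fourierMul_monoFun (hm.polyBd hℓ) ha hℓ.polyGrowth]
  | zero h =>
    refine .zero fun C ℓ a hℓ ha => ?_
    rw [h C ℓ a hℓ ha]
    funext x
    simp [fourierMul_eq, coef_eq]
  | add hF hG h ih ih' =>
    refine .add ih ih' fun C ℓ a hℓ ha => ?_
    rw [h C ℓ a hℓ ha, fourierMul_add hℓ.polyGrowth (hF.mem_Sm hℓ ha) (hG.mem_Sm hℓ ha)]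

/-- `χₙ` as a function of the symbol `ℓ` of the linear operator and of the Fourier
coefficients `a` of `u`. -/
def chiF (n : ℕ) (ℓ a : ℤ → ℂ) : ℝ → ℂ := absChi (fourierMul ℓ) (trigSum a id) n

/-- In the recursion the indices of the factors of a product add up to `n`, and one application
of the operator raises the index by one, so that the degree bound of `IsPoly` is preserved. -/
theorem isPoly_chiF (n : ℕ) : IsPoly n (chiF n) := by
  induction n using Nat.strong_induction_on with
  | _ n ih =>
    match n with
    | 0 => exact .zero fun _ _ _ _ _ => by rw [chiF, absChi]
    | 1 =>
      refine .of_symb (d := 1) (m := fun _ _ => 2) ⟨le_rfl, fun _ => continuous_const,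
        fun _ => ⟨2, by norm_num, by simp⟩⟩ fun C ℓ a _ _ => ?_
      rw [chiF, absChi]
      funext x
      simp only [monoFun, trigSum, Pi.mul_apply, Pi.ofNat_apply, ← tsum_mul_left]
      rw [← (Equiv.funUnique (Fin 1) ℤ).symm.tsum_eq]
      simp [mul_assoc]
    | n + 2 =>
      have h1 : IsPoly (n + 2) fun ℓ a =>
          ∑ j ∈ Finset.Icc 2 (n + 2), (1 / (Nat.factorial j : ℂ)) •
          ∑ m ∈ (Finset.univ : Finset (Fin j → Fin (n + 2))).filter
              (fun m => (∀ i, 1 ≤ (m i : ℕ)) ∧ ∑ i, (m i : ℕ) = n + 2),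
            ∏ i, chiF (m i : ℕ) ℓ a := by
        refine IsPoly.sum _ fun j _ => IsPoly.const_smul (IsPoly.sum _ fun m hm => ?_) _
        rw [Finset.mem_filter] at hm
        have := IsPoly.prod fun i => ih (m i) (m i).isLt
        rwa [hm.2.2] at this
      have h2 := (ih (n + 1) (by omega)).op
      refine (h1.const_smul (-1)).add (h2.const_smul (-1)) fun C ℓ a _ _ => ?_
      rw [chiF, absChi]
      simp only [neg_smul, one_smul, chiF, sub_eq_add_neg]

/-- Grouping the terms of a polynomial map by their degrees. -/
theorem IsPoly.exists_symb {n : ℕ} {F : (ℤ → ℂ) → (ℤ → ℂ) → ℝ → ℂ} (hF : IsPoly n F) :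
    ∃ m : (d : ℕ) → (ℤ → ℂ) → (Fin d → ℤ) → ℂ, (∀ d ≤ n, IsSymb n d (m d)) ∧
      ∀ (C : ℝ) (ℓ a : ℤ → ℂ), LinBound C ℓ → Rapid a →
        F ℓ a = ∑ d ∈ Finset.range (n + 1), monoFun (m d ℓ) a := by
  have hz : ∀ (d : ℕ) (a : ℤ → ℂ), monoFun (fun _ : Fin d → ℤ => (0 : ℂ)) a = 0 := by
    intro d a
    funext x
    simp [monoFun, trigSum]
  induction hF with
  | @of_symb d m F hm h =>
    refine ⟨fun d' => if hd : d = d' then hd ▸ m else fun _ _ => 0, fun d' hd' => ?_,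
      fun C ℓ a hℓ ha => ?_⟩
    · by_cases hd : d = d'
      · subst hd
        simpa using hm
      · simpa [hd] using IsSymb.zero hd'
    · rw [Finset.sum_eq_single d]
      · simpa using h C ℓ a hℓ ha
      · intro d' _ hd'
        simp [Ne.symm hd', hz]
      · intro hd
        exact absurd (Finset.mem_range.2 (Nat.lt_succ_of_le hm.le)) hd
  | zero h =>
    refine ⟨fun d _ _ => 0, fun d hd => IsSymb.zero hd, fun C ℓ a hℓ ha => ?_⟩
    rw [h C ℓ a hℓ ha]
    simp [hz]
  | add hF hG h ih ih' =>
    obtain ⟨m, hm, hmF⟩ := ih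
    obtain ⟨m', hm', hmG⟩ := ih'
    refine ⟨fun d ℓ ν => m d ℓ ν + m' d ℓ ν, fun d hd => (hm d hd).add (hm' d hd),
      fun C ℓ a hℓ ha => ?_⟩
    rw [h C ℓ a hℓ ha, hmF C ℓ a hℓ ha, hmG C ℓ a hℓ ha, ← Finset.sum_add_distrib]
    refine Finset.sum_congr rfl fun d hd => ?_
    have hd' : d ≤ _ := Nat.lt_succ_iff.1 (Finset.mem_range.1 hd)
    funext x
    have s1 := summable_trig (rapidOn_mono ((hm d hd').polyBd hℓ) ha).summable
      (fun ν => ∑ i, ν i) x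
    have s2 := summable_trig (rapidOn_mono ((hm' d hd').polyBd hℓ) ha).summable
      (fun ν => ∑ i, ν i) x
    simp only [monoFun, trigSum, Pi.add_apply]
    rw [← s1.tsum_add s2]
    exact tsum_congr fun ν => by ring

/-- The homogeneous form of degree `d` with symbol `m`, which is the mean value of
`monoFun m a`. -/
def formSum {d : ℕ} (m : (Fin d → ℤ) → ℂ) (a : ℤ → ℂ) : ℂ :=
  ∑' ν : Fin d → ℤ, if ∑ i, ν i = 0 then m ν * ∏ i, a (ν i) else 0

theorem integral_monoFun {d : ℕ} {m : (Fin d → ℤ) → ℂ} (hm : PolyBd m) {a : ℤ → ℂ}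
    (ha : Rapid a) : ∫ x in (0 : ℝ)..(2 * π), monoFun m a x = 2 * π * formSum m a := by
  rw [integral_eq_coef_zero, monoFun, coef_trigSum (rapidOn_mono hm ha).summable, formSum]

/-! ### Dependence on a polynomial parameter -/

section Algebraic

variable {R : Type*} [CommRing R] [Algebra ℂ R]

theorem coeff_sum_monomial (L : R →ₗ[ℂ] R) (p : Polynomial R) (n : ℕ) :
    (∑ i ∈ p.support, Polynomial.monomial i (L (p.coeff i))).coeff n = L (p.coeff n) := by
  rw [Polynomial.finsetSum_coeff]
  simp only [Polynomial.coeff_monomial, Finset.sum_ite_eq']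
  split_ifs with h
  · rfl
  · rw [Polynomial.notMem_support_iff.1 h, map_zero]

/-- The coefficientwise extension of a linear map to polynomials. -/
def polyMap (L : R →ₗ[ℂ] R) : Polynomial R →ₗ[ℂ] Polynomial R where
  toFun p := ∑ i ∈ p.support, Polynomial.monomial i (L (p.coeff i))
  map_add' p q := by
    ext n
    rw [Polynomial.coeff_add, coeff_sum_monomial, coeff_sum_monomial, coeff_sum_monomial,
      Polynomial.coeff_add, map_add]
  map_smul' c p := by
    ext n
    rw [Polynomial.coeff_smul, coeff_sum_monomial, coeff_sum_monomial, Polynomial.coeff_smul,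
      map_smul, RingHom.id_apply]

@[simp] theorem coeff_polyMap (L : R →ₗ[ℂ] R) (p : Polynomial R) (n : ℕ) :
    (polyMap L p).coeff n = L (p.coeff n) := coeff_sum_monomial L p n

/-- Evaluation of polynomials at a scalar. -/
def evalAt (c : ℂ) : Polynomial R →ₐ[ℂ] R :=
  (Polynomial.aeval (R := R) (algebraMap ℂ R c)).restrictScalars ℂ

theorem evalAt_apply (c : ℂ) (p : Polynomial R) :
    evalAt c p = ∑ i ∈ Finset.range (p.natDegree + 1), c ^ i • p.coeff i := by
  simp only [evalAt, AlgHom.restrictScalars_apply, Polynomial.coe_aeval_eq_eval,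
    Polynomial.eval_eq_sum_range]
  refine Finset.sum_congr rfl fun i _ => ?_
  rw [Algebra.smul_def, map_pow, mul_comm]

theorem evalAt_polyMap (L : R →ₗ[ℂ] R) (c : ℂ) (p : Polynomial R) :
    evalAt c (polyMap L p) = L (evalAt c p) := by
  induction p using Polynomial.induction_on' with
  | add p q hp hq => simp only [map_add, hp, hq]
  | monomial n a =>
    have h : polyMap L (Polynomial.monomial n a) = Polynomial.monomial n (L a) := by
      ext i
      simp only [coeff_polyMap, Polynomial.coeff_monomial]
      split_ifs <;> simp
    rw [h]
    simp only [evalAt, AlgHom.restrictScalars_apply, Polynomial.coe_aeval_eq_eval,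
      Polynomial.eval_monomial]
    rw [← map_pow, mul_comm, ← Algebra.smul_def, mul_comm, ← Algebra.smul_def, map_smul]

/-- The coefficient of `X^i`, as a linear map. -/
def coeffL (i : ℕ) : Polynomial R →ₗ[ℂ] R := (Polynomial.lcoeff R i).restrictScalars ℂ

@[simp] theorem coeffL_apply (i : ℕ) (p : Polynomial R) : coeffL i p = p.coeff i := rfl

theorem evalAt_zero (p : Polynomial R) : evalAt 0 p = p.coeff 0 := by
  simp only [evalAt, AlgHom.restrictScalars_apply, Polynomial.coe_aeval_eq_eval, map_zero,
    Polynomial.coeff_zero_eq_eval_zero]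

/-- Along the line `u + c v`, the function `χₙ` is a polynomial in `c`. -/
theorem absChi_line (L : R →ₗ[ℂ] R) (u v : R) (n : ℕ) (c : ℂ) :
    evalAt c (absChi (polyMap L) (Polynomial.C u + Polynomial.X * Polynomial.C v) n) =
      absChi L (u + c • v) n := by
  rw [map_absChi (evalAt c) (fun f => evalAt_polyMap L c f)]
  congr 1
  simp only [evalAt, AlgHom.restrictScalars_apply, map_add, map_mul, Polynomial.aeval_C,
    Polynomial.aeval_X, Algebra.algebraMap_self_apply, Algebra.smul_def]

/-- The first derivative of `J χₙ` at `u` in the direction `v` of the flow vanishes. -/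
theorem IsDispersive.coeff_one_eq_zero {L dx : R →ₗ[ℂ] R} {J : R →ₗ[ℂ] ℂ}
    (h : IsDispersive L dx J) (s : ℂ) {u v : R}
    (hv : v = L (dx u) + Complex.I • dx (dx u) - s • dx u + 2 * u * dx u) (n : ℕ) :
    J ((absChi (polyMap L) (Polynomial.C u + Polynomial.X * Polynomial.C v) n).coeff 1) = 0 := by
  refine h.int_absChi_eq_zero (evalAt 0) (coeffL 1) (fun a b => ?_)
    (fun f => evalAt_polyMap L 0 f) (fun f => by simp) s (u := u) ?_ ?_ n
  · rw [evalAt_zero, evalAt_zero, coeffL_apply, Polynomial.mul_coeff_one, coeffL_apply,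
      coeffL_apply]
    ring
  · simp [evalAt_zero]
  · simp [hv]

section Quadratic

variable (L : R →ₗ[ℂ] R) (u : R)

/-- The generating function for the data `X u`. -/
def scaledU : (Polynomial R)⟦X⟧ := genU (polyMap L) (Polynomial.X * Polynomial.C u)

/-- The linear part of the generating function. -/
def linU : R⟦X⟧ := hat (coeffL 1) (scaledU L u)

/-- The quadratic part of the generating function. -/
def quadU : R⟦X⟧ := hat (coeffL 2) (scaledU L u)

/-- The functionals `χₙ` vanish at `u = 0`. -/
theorem exists_scaledU_eq : ∃ V : (Polynomial R)⟦X⟧,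
    scaledU L u = PowerSeries.C Polynomial.X * V ∧ PowerSeries.coeff 0 V = 0 := by
  refine ⟨PowerSeries.mk fun n => (PowerSeries.coeff n (scaledU L u)).divX, ?_, ?_⟩
  · ext1 n
    have h0 : (PowerSeries.coeff n (scaledU L u)).coeff 0 = 0 := by
      rw [← evalAt_zero, scaledU, coeff_genU,
        map_absChi (evalAt 0) (fun f => evalAt_polyMap L 0 f)]
      have h1 : evalAt 0 (Polynomial.X * Polynomial.C u) = 0 := by simp [evalAt]
      rw [h1]
      induction n using Nat.strong_induction_on with
      | _ n ih =>
        match n with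
        | 0 => rw [absChi]
        | 1 => rw [absChi, mul_zero]
        | n + 2 =>
          rw [absChi, ih (n + 1) (by omega), map_zero, sub_zero, neg_eq_zero]
          refine Finset.sum_eq_zero fun j hj => ?_
          rw [Finset.sum_eq_zero, smul_zero]
          intro m _
          have hj' : 0 < j := by
            have := (Finset.mem_Icc.1 hj).1
            omega
          exact Finset.prod_eq_zero (Finset.mem_univ ⟨0, hj'⟩) (ih _ (m _).isLt)
    rw [PowerSeries.coeff_C_mul, PowerSeries.coeff_mk]
    conv_lhs => rw [← Polynomial.X_mul_divX_add (PowerSeries.coeff n (scaledU L u)), h0]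
    simp
  · rw [PowerSeries.coeff_mk, scaledU, coeff_genU, absChi]
    simp

theorem hat_coeffL_expS (i : ℕ) (hi : 1 ≤ i) (hi2 : i ≤ 2) :
    hat (coeffL i) (expS (scaledU L u)) =
      if i = 1 then linU L u else quadU L u + (1 / 2 : ℂ) • (linU L u * linU L u) := by
  obtain ⟨V, hV, hV0⟩ := exists_scaledU_eq L u
  have hpow : ∀ (j n : ℕ), PowerSeries.coeff n (scaledU L u ^ j) =
      Polynomial.X ^ j * PowerSeries.coeff n (V ^ j) := by
    intro j n
    rw [hV, mul_pow, ← map_pow, PowerSeries.coeff_C_mul]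
  have hlin : linU L u = hat (evalAt 0).toLinearMap V := by
    ext n
    have := hpow 1 n
    simp only [pow_one] at this
    rw [linU, coeff_hat, this, coeff_hat, AlgHom.toLinearMap_apply, evalAt_zero, coeffL_apply]
    exact Polynomial.coeff_X_mul _ 0
  have hlin2 : linU L u * linU L u = hat (evalAt 0).toLinearMap (V ^ 2) := by
    rw [hlin, (hat_pow (evalAt 0) (0 : Polynomial R →ₗ[ℂ] R) (by simp) V 2).2, pow_two]
  have h0 : PowerSeries.coeff 0 (scaledU L u) = 0 := by
    rw [scaledU, coeff_genU, absChi]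
  -- only the powers `U` and `U²` contribute
  have key : ∀ n, PowerSeries.coeff n (expS (scaledU L u)) =
      PowerSeries.coeff n (1 + scaledU L u + (1 / 2 : ℂ) • scaledU L u ^ 2) +
        ∑ j ∈ (Finset.range (n + 1)).filter (fun j => 3 ≤ j),
          (1 / (Nat.factorial j : ℂ)) • PowerSeries.coeff n (scaledU L u ^ j) := by
    intro n
    have h1 : PowerSeries.coeff n (expS (scaledU L u)) = ∑ j ∈ Finset.range (n + 3),
        (1 / (Nat.factorial j : ℂ)) • PowerSeries.coeff n (scaledU L u ^ j) := by
      rw [expS, PowerSeries.coeff_mk]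
      refine Finset.sum_subset (Finset.range_subset_range.2 (by omega)) fun j _ hj => ?_
      rw [coeff_pow_eq_zero h0 (by simpa using hj), smul_zero]
    have h2 : ∑ j ∈ (Finset.range (n + 1)).filter (fun j => 3 ≤ j),
          (1 / (Nat.factorial j : ℂ)) • PowerSeries.coeff n (scaledU L u ^ j) =
        ∑ j ∈ Finset.Ico 3 (n + 3),
          (1 / (Nat.factorial j : ℂ)) • PowerSeries.coeff n (scaledU L u ^ j) := by
      refine Finset.sum_subset (fun j hj => ?_) fun j hj hj' => ?_
      · simp only [Finset.mem_filter, Finset.mem_range, Finset.mem_Ico] at hj ⊢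
        omega
      · simp only [Finset.mem_filter, Finset.mem_range, Finset.mem_Ico] at hj hj'
        rw [coeff_pow_eq_zero h0 (by omega), smul_zero]
    rw [h1, h2, Finset.range_eq_Ico, ← Finset.sum_Ico_consecutive _ (Nat.zero_le 3) (by omega)]
    congr 1
    simp [Finset.sum_range_succ, PowerSeries.coeff_one]
  ext n
  have h3 : (∑ j ∈ (Finset.range (n + 1)).filter (fun j => 3 ≤ j),
      (1 / (Nat.factorial j : ℂ)) • PowerSeries.coeff n (scaledU L u ^ j)).coeff i = 0 := by
    rw [Polynomial.finsetSum_coeff]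
    refine Finset.sum_eq_zero fun j hj => ?_
    have := (Finset.mem_filter.1 hj).2
    rw [hpow, Polynomial.coeff_smul, Polynomial.coeff_X_pow_mul', if_neg (by omega), smul_zero]
  rw [coeff_hat, coeffL_apply, key, Polynomial.coeff_add, h3, add_zero, map_add, map_add,
    Polynomial.coeff_add, Polynomial.coeff_add, PowerSeries.coeff_smul, Polynomial.coeff_smul,
    hpow]
  have h4 : (PowerSeries.coeff n (1 : (Polynomial R)⟦X⟧)).coeff i = 0 := by
    rw [PowerSeries.coeff_one]
    split_ifs
    · rw [Polynomial.coeff_one, if_neg (by omega)]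
    · simp
  rw [h4, zero_add, Polynomial.coeff_X_pow_mul']
  obtain rfl | rfl : i = 1 ∨ i = 2 := by omega
  · simp [linU]
  · simp [quadU, hlin2, evalAt_zero]

/-- The linear part of the Bäcklund relation. -/
theorem linU_eq : linU L u + PowerSeries.X * hat L (linU L u) =
    PowerSeries.X * PowerSeries.C (2 * u) := by
  have h := congrArg (hat (coeffL 1)) (expS_genU (polyMap L) (Polynomial.X * Polynomial.C u))
  change hat (coeffL 1) (expS (scaledU L u) - 1 + PowerSeries.X * hat (polyMap L) (scaledU L u))
    = _ at h
  have h2 : hat (coeffL 1) (hat (polyMap L) (scaledU L u)) = hat L (linU L u) := by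
    ext n
    simp [linU]
  have h3 : hat (coeffL 1) (1 : (Polynomial R)⟦X⟧) = 0 := by
    rw [← map_one (PowerSeries.C (R := Polynomial R)), hat_C]
    simp [Polynomial.coeff_one]
  rw [map_add, map_sub, hat_coeffL_expS L u 1 le_rfl (by norm_num), if_pos rfl, hat_X_mul,
    hat_X_mul, hat_C, h2, h3, sub_zero] at h
  rw [h]
  congr 2
  rw [coeffL_apply, two_mul, Polynomial.coeff_add, Polynomial.coeff_X_mul, Polynomial.coeff_C_zero,
    two_mul]

/-- The quadratic part of the Bäcklund relation. -/
theorem quadU_eq : quadU L u + (1 / 2 : ℂ) • (linU L u * linU L u) +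
    PowerSeries.X * hat L (quadU L u) = 0 := by
  have h := congrArg (hat (coeffL 2)) (expS_genU (polyMap L) (Polynomial.X * Polynomial.C u))
  change hat (coeffL 2) (expS (scaledU L u) - 1 + PowerSeries.X * hat (polyMap L) (scaledU L u))
    = _ at h
  have h2 : hat (coeffL 2) (hat (polyMap L) (scaledU L u)) = hat L (quadU L u) := by
    ext n
    simp [quadU]
  have h3 : hat (coeffL 2) (1 : (Polynomial R)⟦X⟧) = 0 := by
    rw [← map_one (PowerSeries.C (R := Polynomial R)), hat_C]
    simp [Polynomial.coeff_one]
  rw [map_add, map_sub, hat_coeffL_expS L u 2 (by norm_num) le_rfl, if_neg (by norm_num),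
    hat_X_mul, hat_X_mul, hat_C, h2, h3, sub_zero] at h
  rw [h, coeffL_apply, two_mul, Polynomial.coeff_add, Polynomial.coeff_X_mul,
    Polynomial.coeff_C_of_ne_zero (by norm_num)]
  simp

end Quadratic

end Algebraic

/-! ### The linear operators on smooth periodic functions -/

/-- The derivative on `Sm`. -/
def dxS : Sm →ₗ[ℂ] Sm where
  toFun f := ⟨deriv f, deriv_mem_Sm f.2⟩
  map_add' f g := by
    ext x
    exact ((Sm_hasDerivAt f.2 x).add (Sm_hasDerivAt g.2 x)).deriv
  map_smul' c f := by
    ext x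
    exact ((Sm_hasDerivAt f.2 x).const_mul c).deriv

theorem fourierMul_smul (σ : ℤ → ℂ) (c : ℂ) (f : ℝ → ℂ) :
    fourierMul σ (c • f) = c • fourierMul σ f := by
  funext x
  simp only [fourierMul_eq, coef_smul, Pi.smul_apply, smul_eq_mul, ← tsum_mul_left]
  exact tsum_congr fun n => by ring

/-- A Fourier multiplier on `Sm`. -/
def mulS {σ : ℤ → ℂ} (hσ : PolyGrowth σ) : Sm →ₗ[ℂ] Sm where
  toFun f := ⟨fourierMul σ f, fourierMul_mem_Sm hσ f.2⟩
  map_add' f g := Subtype.ext (fourierMul_add hσ f.2 g.2)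
  map_smul' c f := Subtype.ext (fourierMul_smul σ c f)

/-- The integral over a period. -/
def intS : Sm →ₗ[ℂ] ℂ where
  toFun f := ∫ x in (0 : ℝ)..(2 * π), (f : ℝ → ℂ) x
  map_add' f g := intervalIntegral.integral_add (f.2.1.continuous.intervalIntegrable _ _)
    (g.2.1.continuous.intervalIntegrable _ _)
  map_smul' c _ := intervalIntegral.integral_const_mul c _

theorem Sm_ext {f g : Sm} (h : ∀ n, coef f n = coef g n) : f = g :=
  Subtype.ext (eq_of_coef_eq f.2 g.2 h)

theorem coef_dxS (f : Sm) (n : ℤ) : coef (dxS f) n = Complex.I * n * coef f n := coef_deriv f.2 n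

theorem coef_mulS {σ : ℤ → ℂ} (hσ : PolyGrowth σ) (f : Sm) (n : ℤ) :
    coef (mulS hσ f) n = σ n * coef f n := coef_fourierMul hσ f.2 n

theorem coef_addS (f g : Sm) (n : ℤ) :
    coef ((f + g : Sm) : ℝ → ℂ) n = coef f n + coef g n := coef_add f.2 g.2 n

theorem coef_smulS (c : ℂ) (f : Sm) (n : ℤ) :
    coef ((c • f : Sm) : ℝ → ℂ) n = c * coef f n := coef_smul c f n

theorem hasSum_coef_mulS (f g : Sm) (n : ℤ) :
    HasSum (fun m => coef f m * coef g (n - m)) (coef ((f * g : Sm) : ℝ → ℂ) n) := by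
  have := (summable_coef_mul f.2 g.2 n).hasSum
  rwa [← coef_mul f.2 g.2] at this

theorem intS_eq (f : Sm) : intS f = 2 * π * coef f 0 := integral_eq_coef_zero f

/-- The identities between the values of the symbol `ℓ` of `(𝒢 - i) ∂ₓ + s` that make the
operator dispersive; the first one is the addition theorem of the hyperbolic cotangent. -/
structure SymbolIdentities (ℓ : ℤ → ℂ) : Prop where
  add : ∀ a b : ℤ, ℓ (a + b) * (ℓ a * b + ℓ b * a - 2 * a * b) = (a + b) * (ℓ a * ℓ b)
  skew : ∀ a : ℤ, ℓ a - ℓ (-a) = 2 * a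

/-- On the Fourier side the bilinear identities compare convolutions, and hold term by term. -/
theorem SymbolIdentities.isDispersive {ℓ : ℤ → ℂ} (h : SymbolIdentities ℓ) (hℓ : PolyGrowth ℓ) :
    IsDispersive (mulS hℓ) dxS intS := by
  have bil : ∀ (f g : Sm) (n : ℤ), HasSum (fun m : ℤ =>
      Complex.I * (ℓ (n - m) * m + ℓ m * (n - m : ℤ) - 2 * m * (n - m : ℤ)) *
        (coef f m * coef g (n - m)))
      (coef ((dxS f * mulS hℓ g + mulS hℓ f * dxS g +
        (2 * Complex.I) • (dxS f * dxS g) : Sm) : ℝ → ℂ) n) := by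
    intro f g n
    have h1 := hasSum_coef_mulS (dxS f) (mulS hℓ g) n
    have h2 := hasSum_coef_mulS (mulS hℓ f) (dxS g) n
    have h3 := (hasSum_coef_mulS (dxS f) (dxS g) n).mul_left (2 * Complex.I)
    rw [coef_addS, coef_addS, coef_smulS]
    convert! (h1.add h2).add h3 using 1
    funext m
    simp only [coef_dxS, coef_mulS]
    linear_combination (-2 : ℂ) * Complex.I * m * (n - m : ℤ) * coef f m * coef g (n - m) *
      Complex.I_sq
  refine ⟨fun f g => ?_, fun f => ?_, fun f g => ?_, fun f => ?_, fun f g => ?_⟩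
  · ext x
    exact ((Sm_hasDerivAt f.2 x).mul (Sm_hasDerivAt g.2 x)).deriv
  · refine Sm_ext fun n => ?_
    rw [coef_mulS, coef_dxS, coef_dxS, coef_mulS]
    ring
  · refine Sm_ext fun n => ?_
    rw [coef_mulS]
    have h1 := (bil f g n).mul_left (ℓ n)
    have h2 := (hasSum_coef_mulS (mulS hℓ f) (mulS hℓ (dxS g)) n).add
      (hasSum_coef_mulS (mulS hℓ (dxS f)) (mulS hℓ g) n)
    rw [coef_addS (mulS hℓ f * mulS hℓ (dxS g))]
    refine h1.unique ?_
    convert! h2 using 1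
    funext m
    simp only [coef_dxS, coef_mulS]
    have := h.add m (n - m)
    rw [add_sub_cancel] at this
    linear_combination Complex.I * (coef f m * coef g (n - m)) * this
  · rw [intS_eq, coef_dxS]
    simp
  · rw [intS_eq]
    have h1 := bil f g 0
    have h2 : ∀ m : ℤ, Complex.I * (ℓ (0 - m) * m + ℓ m * (0 - m : ℤ) - 2 * m * (0 - m : ℤ)) *
        (coef f m * coef g (0 - m)) = 0 := by
      intro m
      have := h.skew m
      rw [zero_sub]
      push_cast
      linear_combination (-Complex.I) * m * (coef f m * coef g (-m)) * this
    simp only [h2] at h1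
    rw [h1.unique hasSum_zero, mul_zero]

/-! ### The quadratic part of the integrals of `χₙ` -/

theorem coeff_linU {ℓ : ℤ → ℂ} (hℓ : PolyGrowth ℓ) (u : Sm) (n : ℕ) (m : ℤ) :
    coef (PowerSeries.coeff (n + 1) (linU (mulS hℓ) u) : Sm) m = 2 * (-ℓ m) ^ n * coef u m := by
  induction n with
  | zero =>
    have h := congrArg (PowerSeries.coeff 1) (linU_eq (mulS hℓ) u)
    have h0 := congrArg (PowerSeries.coeff 0) (linU_eq (mulS hℓ) u)
    rw [map_add, PowerSeries.coeff_zero_X_mul, PowerSeries.coeff_zero_X_mul, add_zero] at h0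
    rw [map_add, PowerSeries.coeff_succ_X_mul, PowerSeries.coeff_succ_X_mul, coeff_hat, h0,
      map_zero, add_zero, PowerSeries.coeff_C, if_pos rfl] at h
    rw [zero_add, h, two_mul, coef_addS]
    ring
  | succ n ih =>
    have h := congrArg (PowerSeries.coeff (n + 2)) (linU_eq (mulS hℓ) u)
    rw [map_add, PowerSeries.coeff_succ_X_mul, PowerSeries.coeff_succ_X_mul, coeff_hat,
      PowerSeries.coeff_C, if_neg (by omega)] at h
    rw [eq_neg_of_add_eq_zero_left h, ← neg_one_smul ℂ, coef_smulS, coef_mulS, ih]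
    ring

theorem coeff_zero_linU {ℓ : ℤ → ℂ} (hℓ : PolyGrowth ℓ) (u : Sm) :
    PowerSeries.coeff 0 (linU (mulS hℓ) u) = 0 := by
  have h0 := congrArg (PowerSeries.coeff 0) (linU_eq (mulS hℓ) u)
  rwa [map_add, PowerSeries.coeff_zero_X_mul, PowerSeries.coeff_zero_X_mul, add_zero] at h0

/-- The complete homogeneous symmetric polynomial of degree `n` in `x` and `y`. -/
def hSym (x y : ℂ) (n : ℕ) : ℂ := ∑ p ∈ Finset.HasAntidiagonal.antidiagonal n, x ^ p.1 * y ^ p.2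

theorem hasSum_coeff_linU_sq {ℓ : ℤ → ℂ} (hℓ : PolyGrowth ℓ) (u : Sm) (n : ℕ) :
    HasSum (fun m : ℤ => 4 * hSym (-ℓ m) (-ℓ (-m)) n * (coef u m * coef u (-m)))
      (coef (PowerSeries.coeff (n + 2) (linU (mulS hℓ) u * linU (mulS hℓ) u) : Sm) 0) := by
  have h1 : PowerSeries.coeff (n + 2) (linU (mulS hℓ) u * linU (mulS hℓ) u) =
      ∑ p ∈ Finset.HasAntidiagonal.antidiagonal n,
        PowerSeries.coeff (p.1 + 1) (linU (mulS hℓ) u) *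
          PowerSeries.coeff (p.2 + 1) (linU (mulS hℓ) u) := by
    rw [PowerSeries.coeff_mul, Finset.Nat.antidiagonal_succ_succ', Finset.sum_cons,
      Finset.sum_cons, coeff_zero_linU, zero_mul, mul_zero, zero_add, zero_add, Finset.sum_map]
    rfl
  have h2 : ∀ (s : Finset (ℕ × ℕ)) (F : ℕ × ℕ → Sm),
      coef ((∑ p ∈ s, F p : Sm) : ℝ → ℂ) 0 = ∑ p ∈ s, coef (F p) 0 := by
    classical
    intro s F
    induction s using Finset.induction_on with
    | empty => simp [coef_eq]
    | insert i s hi ih => rw [Finset.sum_insert hi, Finset.sum_insert hi, coef_addS, ih]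
  rw [h1, h2]
  have h3 := hasSum_sum (s := Finset.HasAntidiagonal.antidiagonal n) fun p _ =>
    hasSum_coef_mulS (PowerSeries.coeff (p.1 + 1) (linU (mulS hℓ) u))
      (PowerSeries.coeff (p.2 + 1) (linU (mulS hℓ) u)) 0
  convert! h3 using 1
  funext m
  simp only [coeff_linU, hSym, zero_sub, Finset.mul_sum, Finset.sum_mul]
  exact Finset.sum_congr rfl fun p _ => by ring

/-- The symbol of the quadratic part of `∫ χ_{k+2}`, up to the factor `2 (-1)^{k+1}`. -/
def quadSym (s : ℂ) (x y : ℂ) : ℕ → ℂ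
  | 0 => 1
  | k + 1 => s * quadSym s x y k + (-1) ^ (k + 1) * hSym (-x) (-y) (k + 1)

/-- The quadratic part of the mean value of `χ_{k+2}`. At frequency `0` the operator acts as the
scalar `ℓ 0`, and the quadratic part of the Bäcklund relation becomes a recursion in `k`. -/
theorem hasSum_quadU {ℓ : ℤ → ℂ} (hℓ : PolyGrowth ℓ) (u : Sm) (k : ℕ) :
    HasSum (fun m : ℤ => 2 * (-1) ^ (k + 1) * quadSym (ℓ 0) (ℓ m) (ℓ (-m)) k *
      (coef u m * coef u (-m))) (coef (PowerSeries.coeff (k + 2) (quadU (mulS hℓ) u) : Sm) 0) := by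
  have step : ∀ n : ℕ, coef (PowerSeries.coeff (n + 1) (quadU (mulS hℓ) u) : Sm) 0 =
      -(ℓ 0 * coef (PowerSeries.coeff n (quadU (mulS hℓ) u) : Sm) 0) -
        1 / 2 * coef (PowerSeries.coeff (n + 1) (linU (mulS hℓ) u * linU (mulS hℓ) u) : Sm) 0 := by
    intro n
    have h := congrArg (fun F => coef (PowerSeries.coeff (n + 1) F : Sm) 0)
      (quadU_eq (mulS hℓ) u)
    simp only [map_add, PowerSeries.coeff_succ_X_mul, coeff_hat, coef_addS, coef_mulS,
      PowerSeries.coeff_smul, coef_smulS, map_zero] at h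
    have h0 : coef ((0 : Sm) : ℝ → ℂ) 0 = 0 := by simp [coef_eq]
    rw [h0] at h
    linear_combination h
  have h0 : PowerSeries.coeff 0 (quadU (mulS hℓ) u) = 0 := by
    have h := congrArg (PowerSeries.coeff 0) (quadU_eq (mulS hℓ) u)
    rw [map_add, map_add, PowerSeries.coeff_zero_X_mul, PowerSeries.coeff_smul,
      PowerSeries.coeff_mul] at h
    simpa [coeff_zero_linU hℓ u] using h
  have h1 : coef (PowerSeries.coeff 1 (quadU (mulS hℓ) u) : Sm) 0 = 0 := by
    have hl : PowerSeries.coeff 1 (linU (mulS hℓ) u * linU (mulS hℓ) u) = 0 := by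
      rw [PowerSeries.coeff_mul, Finset.Nat.antidiagonal_succ]
      simp [coeff_zero_linU hℓ u]
    have := step 0
    rw [zero_add, h0, hl] at this
    simpa [coef_eq] using this
  induction k with
  | zero =>
    rw [step, h1]
    convert! ((hasSum_coeff_linU_sq hℓ u 0).mul_left (-(1 / 2))) using 1
    · funext m
      simp only [quadSym, hSym, Finset.Nat.antidiagonal_zero, Finset.sum_singleton]
      ring
    · ring
  | succ k ih =>
    rw [step]
    convert! (ih.mul_left (-ℓ 0)).add
      ((hasSum_coeff_linU_sq hℓ u (k + 1)).mul_left (-(1 / 2))) using 1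
    · funext m
      simp only [quadSym]
      have h3 : ((-1 : ℂ) ^ (k + 1)) * (-1) ^ (k + 1) = 1 := by
        rw [← mul_pow]
        simp
      linear_combination (-2) * hSym (-ℓ m) (-ℓ (-m)) (k + 1) * (coef u m * coef u (-m)) * h3
    · ring

/-! ### Bounded multilinear forms on Sobolev spaces -/

/-- The Sobolev weight `(1 + n²)^{k/4}` of `H^{k/2}`. -/
def rho (k : ℕ) (n : ℤ) : ℝ := (1 + (n : ℝ) ^ 2) ^ ((k : ℝ) / 4)

theorem rho_pos (k : ℕ) (n : ℤ) : 0 < rho k n := Real.rpow_pos_of_pos (by positivity) _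

theorem rho_sq (k : ℕ) (n : ℤ) : rho k n ^ 2 = (1 + (n : ℝ) ^ 2) ^ ((k : ℝ) / 2) := by
  rw [rho, ← Real.rpow_natCast, ← Real.rpow_mul (by positivity)]
  congr 1
  push_cast
  ring

theorem sqrt_wt_pow_le (k : ℕ) (n : ℤ) : √(wt n) ^ k ≤ 2 ^ k * rho k n := by
  have h1 : √(wt n) ^ k = (wt n ^ 2) ^ ((k : ℝ) / 4) := by
    rw [Real.sqrt_eq_rpow, ← Real.rpow_natCast, ← Real.rpow_natCast,
      ← Real.rpow_mul (wt_pos n).le, ← Real.rpow_mul (wt_pos n).le]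
    congr 1
    push_cast
    ring
  have h2 : (2 : ℝ) ^ k = (16 : ℝ) ^ ((k : ℝ) / 4) := by
    rw [show (16 : ℝ) = 2 ^ (4 : ℝ) by norm_num, ← Real.rpow_mul (by norm_num),
      ← Real.rpow_natCast]
    congr 1
    ring
  rw [h1, h2, rho, ← Real.mul_rpow (by norm_num) (by positivity)]
  refine Real.rpow_le_rpow (by positivity) ?_ (by positivity)
  have := sq_abs (n : ℝ)
  simp only [wt]
  nlinarith [abs_nonneg (n : ℝ), sq_nonneg (|(n : ℝ)| - 1)]

/-- On the hyperplane `∑ νᵢ = 0` the two largest frequencies are comparable. -/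
theorem exists_two_largest {d : ℕ} (hd : 3 ≤ d) (ν : Fin d → ℤ) (hν : ∑ i, ν i = 0) :
    ∃ p q, p ≠ q ∧ (∀ i, wt (ν i) ≤ wt (ν p)) ∧ wt (ν p) ≤ d * wt (ν q) ∧
      sz ν ≤ d * wt (ν p) := by
  have hd0 : (1 : ℝ) ≤ d := by
    have : 1 ≤ d := by omega
    exact_mod_cast this
  have : Nonempty (Fin d) := ⟨⟨0, by omega⟩⟩
  obtain ⟨p, hp⟩ := Finite.exists_max fun i => wt (ν i)
  have hne : (Finset.univ.erase p).Nonempty := by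
    rw [← Finset.card_pos, Finset.card_erase_of_mem (Finset.mem_univ _), Finset.card_univ,
      Fintype.card_fin]
    omega
  obtain ⟨q, hq, hqm⟩ := Finset.exists_max_image (Finset.univ.erase p) (fun i => wt (ν i)) hne
  refine ⟨p, q, (Finset.ne_of_mem_erase hq).symm, hp, ?_, ?_⟩
  · have h1 : (ν p : ℝ) = -∑ i ∈ Finset.univ.erase p, (ν i : ℝ) := by
      have h2 := Finset.add_sum_erase Finset.univ (fun i => (ν i : ℝ)) (Finset.mem_univ p)
      have h3 : ∑ i, (ν i : ℝ) = 0 := by exact_mod_cast hν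
      rw [h3] at h2
      linarith
    have h2 : |(ν p : ℝ)| ≤ ∑ i ∈ Finset.univ.erase p, |(ν i : ℝ)| := by
      rw [h1, abs_neg]
      exact Finset.abs_sum_le_sum_abs _ _
    have h3 : ∑ i ∈ Finset.univ.erase p, |(ν i : ℝ)| ≤
        (Finset.univ.erase p).card • |(ν q : ℝ)| := by
      refine Finset.sum_le_card_nsmul _ _ _ fun i hi => ?_
      have := hqm i hi
      simp only [wt] at this
      linarith
    rw [Finset.card_erase_of_mem (Finset.mem_univ _), Finset.card_univ, Fintype.card_fin,
      nsmul_eq_mul, Nat.cast_sub (by omega)] at h3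
    push_cast at h3
    simp only [wt]
    nlinarith [abs_nonneg (ν q : ℝ)]
  · have h3 : ∑ i, |(ν i : ℝ)| ≤ (Finset.univ : Finset (Fin d)).card • |(ν p : ℝ)| := by
      refine Finset.sum_le_card_nsmul _ _ _ fun i _ => ?_
      have := hp i
      simp only [wt] at this
      linarith
    rw [Finset.card_univ, Fintype.card_fin, nsmul_eq_mul] at h3
    simp only [sz, wt]
    nlinarith

/-- Up to constants, the powers of the frequencies on the left amount to at most `k` powers of
the largest frequency, of which the Sobolev weights of the two largest frequencies each absorb
`k / 2`. The factors `wt (ν i)` leave room for summing over all but the two largest frequencies. -/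
theorem weight_bound (k : ℕ) {d : ℕ} (hd : 3 ≤ d) (hdk : d ≤ k + 2) :
    ∃ C : ℝ, 0 ≤ C ∧ ∀ ν : Fin d → ℤ, ∑ i, ν i = 0 → ∃ p q, p ≠ q ∧
      sz ν ^ (k + 2 - d) * ∏ i ∈ (Finset.univ.erase p).erase q, wt (ν i) ≤
        C * ∏ i, rho k (ν i) := by
  refine ⟨(d : ℝ) ^ (k + 2 - d) * √d ^ k * ∏ _i : Fin d, 2 ^ k, by positivity, fun ν hν => ?_⟩
  obtain ⟨p, q, hpq, hp, hq, hs⟩ := exists_two_largest hd ν hν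
  refine ⟨p, q, hpq, ?_⟩
  have hw := wt_pos (ν p)
  have hqm : q ∈ Finset.univ.erase p := Finset.mem_erase.2 ⟨hpq.symm, Finset.mem_univ _⟩
  have h1 : ∏ i ∈ (Finset.univ.erase p).erase q, wt (ν i) ≤ wt (ν p) ^ (d - 2) := by
    have hcard : ((Finset.univ.erase p).erase q).card = d - 2 := by
      rw [Finset.card_erase_of_mem hqm, Finset.card_erase_of_mem (Finset.mem_univ _),
        Finset.card_univ, Fintype.card_fin]
      omega
    rw [← hcard, ← Finset.prod_const]
    exact Finset.prod_le_prod (fun i _ => (wt_pos _).le) fun i _ => hp i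
  have h2 : sz ν ^ (k + 2 - d) ≤ (d : ℝ) ^ (k + 2 - d) * wt (ν p) ^ (k + 2 - d) := by
    rw [← mul_pow]
    exact pow_le_pow_left₀ (sz_pos ν).le hs _
  have h3 : wt (ν p) ^ (k + 2 - d) * wt (ν p) ^ (d - 2) = wt (ν p) ^ k := by
    rw [← pow_add]
    congr 1
    omega
  have h4 : wt (ν p) ^ k ≤ √d ^ k * (√(wt (ν p)) ^ k * √(wt (ν q)) ^ k) := by
    have h5 : √(wt (ν p)) ≤ √d * √(wt (ν q)) := by
      rw [← Real.sqrt_mul (by positivity)]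
      exact Real.sqrt_le_sqrt hq
    calc wt (ν p) ^ k = √(wt (ν p)) ^ k * √(wt (ν p)) ^ k := by
          rw [← mul_pow, Real.mul_self_sqrt hw.le]
      _ ≤ √(wt (ν p)) ^ k * (√d * √(wt (ν q))) ^ k := by gcongr
      _ = _ := by rw [mul_pow]; ring
  have h6 : √(wt (ν p)) ^ k * √(wt (ν q)) ^ k ≤ ∏ i, √(wt (ν i)) ^ k := by
    rw [← Finset.mul_prod_erase Finset.univ _ (Finset.mem_univ p),
      ← Finset.mul_prod_erase _ _ hqm, ← mul_assoc]
    refine le_mul_of_one_le_right (by positivity) ?_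
    calc (1 : ℝ) = ∏ i ∈ (Finset.univ.erase p).erase q, 1 := by simp
      _ ≤ _ := Finset.prod_le_prod (fun _ _ => zero_le_one) fun i _ =>
        one_le_pow₀ (Real.one_le_sqrt.2 (one_le_wt _))
  have h7 : ∏ i, √(wt (ν i)) ^ k ≤ (∏ _i : Fin d, (2 : ℝ) ^ k) * ∏ i, rho k (ν i) := by
    rw [← Finset.prod_mul_distrib]
    exact Finset.prod_le_prod (fun i _ => by positivity) fun i _ => sqrt_wt_pow_le k _
  have h8 : 0 ≤ ∏ i ∈ (Finset.univ.erase p).erase q, wt (ν i) :=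
    Finset.prod_nonneg fun i _ => (wt_pos _).le
  calc sz ν ^ (k + 2 - d) * ∏ i ∈ (Finset.univ.erase p).erase q, wt (ν i)
      ≤ ((d : ℝ) ^ (k + 2 - d) * wt (ν p) ^ (k + 2 - d)) * wt (ν p) ^ (d - 2) :=
        mul_le_mul h2 h1 h8 (by positivity)
    _ = (d : ℝ) ^ (k + 2 - d) * wt (ν p) ^ k := by rw [mul_assoc, h3]
    _ ≤ (d : ℝ) ^ (k + 2 - d) * (√d ^ k * ((∏ _i : Fin d, (2 : ℝ) ^ k) * ∏ i, rho k (ν i))) := by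
        gcongr
        exact h4.trans (mul_le_mul_of_nonneg_left (h6.trans h7) (by positivity))
    _ = _ := by ring

/-- Pointwise domination of the terms of a form of degree `d` on `H^{k/2}` by functions that are
summable over the hyperplane `∑ νᵢ = 0`. -/
theorem term_bound (k : ℕ) {d : ℕ} (hd : 3 ≤ d) (hdk : d ≤ k + 2) :
    ∃ C : ℝ, 0 ≤ C ∧ ∀ ν : Fin d → ℤ, ∑ i, ν i = 0 → ∀ y : Fin d → ℝ, (∀ i, 0 ≤ y i) →
      sz ν ^ (k + 2 - d) * ∏ i, ((rho k (ν i))⁻¹ * y i) ≤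
        C * ∑ q, ∏ i ∈ Finset.univ.erase q, ((wt (ν i) ^ 2)⁻¹ + y i ^ 2) := by
  obtain ⟨C, hC0, hC⟩ := weight_bound k hd hdk
  refine ⟨2 * C, by positivity, fun ν hν y hy => ?_⟩
  obtain ⟨p, q, hpq, hb⟩ := hC ν hν
  set E := (Finset.univ.erase p).erase q with hE
  set r : Fin d → ℝ := fun i => (wt (ν i) ^ 2)⁻¹ + y i ^ 2 with hr
  have hr0 : ∀ i, 0 ≤ r i := fun i => by have := wt_pos (ν i); positivity
  have hqm : q ∈ Finset.univ.erase p := Finset.mem_erase.2 ⟨hpq.symm, Finset.mem_univ _⟩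
  have hpm : p ∈ Finset.univ.erase q := Finset.mem_erase.2 ⟨hpq, Finset.mem_univ _⟩
  have hE' : (Finset.univ.erase q).erase p = E := Finset.erase_right_comm
  have hρ : 0 < ∏ i, rho k (ν i) := Finset.prod_pos fun i _ => rho_pos k _
  have hW : 0 < ∏ i ∈ E, wt (ν i) := Finset.prod_pos fun i _ => wt_pos _
  have hY : 0 ≤ ∏ i, y i := Finset.prod_nonneg fun i _ => hy i
  have h1 : sz ν ^ (k + 2 - d) * ∏ i, ((rho k (ν i))⁻¹ * y i) ≤
      C * ((∏ i ∈ E, wt (ν i))⁻¹ * ∏ i, y i) := by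
    rw [Finset.prod_mul_distrib, Finset.prod_inv_distrib, ← mul_assoc, ← mul_assoc]
    refine mul_le_mul_of_nonneg_right ?_ hY
    rw [← div_eq_mul_inv, ← div_eq_mul_inv, div_le_div_iff₀ hρ hW]
    exact hb
  have h2 : (∏ i ∈ E, wt (ν i))⁻¹ * ∏ i, y i = (y p * y q) * ∏ i ∈ E, ((wt (ν i))⁻¹ * y i) := by
    rw [← Finset.mul_prod_erase Finset.univ _ (Finset.mem_univ p),
      ← Finset.mul_prod_erase _ _ hqm, Finset.prod_mul_distrib, Finset.prod_inv_distrib]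
    ring
  -- all products are estimated by `2 a b ≤ a² + b²`: the `r i` are summable for `y` in `ℓ²`
  have h3 : ∏ i ∈ E, ((wt (ν i))⁻¹ * y i) ≤ ∏ i ∈ E, r i := by
    refine Finset.prod_le_prod (fun i _ => mul_nonneg (inv_nonneg.2 (wt_pos _).le) (hy i))
      fun i _ => ?_
    simp only [hr]
    rw [← inv_pow]
    nlinarith [sq_nonneg ((wt (ν i))⁻¹ - y i), sq_nonneg ((wt (ν i))⁻¹), sq_nonneg (y i)]
  have h4 : y p * y q ≤ r p + r q := by
    have hp := wt_pos (ν p)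
    have hq := wt_pos (ν q)
    have a1 : 0 ≤ (wt (ν p) ^ 2)⁻¹ := by positivity
    have a2 : 0 ≤ (wt (ν q) ^ 2)⁻¹ := by positivity
    simp only [hr]
    nlinarith [sq_nonneg (y p - y q), sq_nonneg (y p), sq_nonneg (y q)]
  have hR : 0 ≤ ∏ i ∈ E, r i := Finset.prod_nonneg fun i _ => hr0 i
  have h5 : ∀ j, ∏ i ∈ Finset.univ.erase j, r i ≤ ∑ q, ∏ i ∈ Finset.univ.erase q, r i :=
    fun j => Finset.single_le_sum (f := fun q => ∏ i ∈ Finset.univ.erase q, r i)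
      (fun q _ => Finset.prod_nonneg fun i _ => hr0 i) (Finset.mem_univ j)
  have h6 : (r p + r q) * ∏ i ∈ E, r i =
      ∏ i ∈ Finset.univ.erase q, r i + ∏ i ∈ Finset.univ.erase p, r i := by
    rw [← Finset.mul_prod_erase (Finset.univ.erase q) _ hpm,
      ← Finset.mul_prod_erase (Finset.univ.erase p) _ hqm, hE']
    ring
  calc _ ≤ C * ((∏ i ∈ E, wt (ν i))⁻¹ * ∏ i, y i) := h1
    _ = C * ((y p * y q) * ∏ i ∈ E, ((wt (ν i))⁻¹ * y i)) := by rw [h2]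
    _ ≤ C * ((r p + r q) * ∏ i ∈ E, r i) := by
        refine mul_le_mul_of_nonneg_left ?_ hC0
        exact mul_le_mul h4 h3 (Finset.prod_nonneg fun i _ =>
          mul_nonneg (inv_nonneg.2 (wt_pos _).le) (hy i)) (add_nonneg (hr0 p) (hr0 q))
    _ ≤ C * (2 * ∑ q, ∏ i ∈ Finset.univ.erase q, r i) := by
        refine mul_le_mul_of_nonneg_left ?_ hC0
        rw [h6]
        linarith [h5 p, h5 q]
    _ = _ := by ring

/-- Parametrization of the hyperplane `∑ νᵢ = 0` by all coordinates but the one with index `q`. -/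
theorem hasSum_hyperplane {d : ℕ} (q : Fin (d + 1)) {r : Fin (d + 1) → ℤ → ℝ}
    (h0 : ∀ i n, 0 ≤ r i n) (hr : ∀ i, Summable (r i)) :
    HasSum (fun ν : Fin (d + 1) → ℤ =>
      if ∑ i, ν i = 0 then ∏ i ∈ Finset.univ.erase q, r i (ν i) else 0)
      (∏ j, ∑' n, r (q.succAbove j) n) := by
  have h1 := hasSum_pi_prod (b := fun j => r (q.succAbove j)) (fun j => h0 _) (fun j => hr _)
  let g : (Fin d → ℤ) → (Fin (d + 1) → ℤ) := fun μ => q.insertNth (-∑ j, μ j) μ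
  have hg : Function.Injective g := by
    intro μ μ' h
    funext j
    have := congrFun h (q.succAbove j)
    simpa [g] using this
  have hprod : ∀ F : Fin (d + 1) → ℝ, ∏ i ∈ Finset.univ.erase q, F i =
      ∏ j, F (q.succAbove j) := by
    intro F
    have : (Finset.univ.erase q : Finset (Fin (d + 1))) =
        Finset.univ.map q.succAboveEmb := by
      ext i
      simp only [Finset.mem_erase, Finset.mem_univ, and_true, Finset.mem_map, true_and]
      constructor
      · intro hi
        obtain ⟨j, hj⟩ := Fin.exists_succAbove_eq hi
        exact ⟨j, hj⟩
      · rintro ⟨j, rfl⟩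
        exact Fin.succAbove_ne q j
    rw [this, Finset.prod_map]
    rfl
  rw [← hg.hasSum_iff]
  · convert! h1 using 1
    funext μ
    have : ∑ i, g μ i = 0 := by
      rw [Fin.sum_univ_succAbove _ q]
      simp [g]
    simp only [Function.comp_apply, this, if_true, hprod]
    simp [g]
  · intro ν hν
    rw [if_neg]
    intro hs
    apply hν
    refine ⟨fun j => ν (q.succAbove j), ?_⟩
    rw [Fin.sum_univ_succAbove _ q] at hs
    have : -∑ j, ν (q.succAbove j) = ν q := by omega
    simp only [g, this]
    exact Fin.insertNth_self_removeNth q ν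

/-- The Hilbert space `ℓ²(ℤ)`, into which `H^{k/2}` is embedded by weighted Fourier
coefficients. -/
abbrev L2 := lp (fun _ : ℤ => ℂ) 2

theorem L2_hasSum (x : L2) : HasSum (fun n => ‖x n‖ ^ 2) (‖x‖ ^ 2) := by
  have h := lp.hasSum_norm (p := 2) (by norm_num) x
  simpa using h

/-- The coordinate `n`, divided by the Sobolev weight. -/
def coordL (k : ℕ) (n : ℤ) : L2 →ₗ[ℝ] ℂ where
  toFun x := (((rho k n)⁻¹ : ℝ) : ℂ) * x n
  map_add' x y := by simp [mul_add]
  map_smul' c x := by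
    simp only [lp.coeFn_smul, Pi.smul_apply, Complex.real_smul, RingHom.id_apply]
    ring

theorem norm_coordL (k : ℕ) (n : ℤ) (x : L2) : ‖coordL k n x‖ = (rho k n)⁻¹ * ‖x n‖ := by
  simp only [coordL, LinearMap.coe_mk, AddHom.coe_mk, norm_mul, Complex.norm_real, norm_inv,
    Real.norm_eq_abs, abs_of_pos (rho_pos k n)]

/-- The frequency `ν` part of the form with symbol `m`. -/
def termL (k : ℕ) {d : ℕ} (m : (Fin d → ℤ) → ℂ) (ν : Fin d → ℤ) :
    MultilinearMap ℝ (fun _ : Fin d => L2) ℂ :=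
  (if ∑ i, ν i = 0 then m ν else 0) •
    (MultilinearMap.mkPiAlgebra ℝ (Fin d) ℂ).compLinearMap fun i => coordL k (ν i)

theorem termL_apply (k : ℕ) {d : ℕ} (m : (Fin d → ℤ) → ℂ) (ν : Fin d → ℤ) (x : Fin d → L2) :
    termL k m ν x = if ∑ i, ν i = 0 then m ν * ∏ i, coordL k (ν i) (x i) else 0 := by
  simp only [termL, smul_apply, MultilinearMap.compLinearMap_apply,
    MultilinearMap.mkPiAlgebra_apply, smul_eq_mul, ite_mul, zero_mul]

/-- The weights dominating the terms of a form evaluated at `x`. -/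
def majR {d : ℕ} (x : Fin d → L2) (i : Fin d) (n : ℤ) : ℝ := (wt n ^ 2)⁻¹ + ‖x i n‖ ^ 2

theorem majR_nonneg {d : ℕ} (x : Fin d → L2) (i : Fin d) (n : ℤ) : 0 ≤ majR x i n := by
  have := wt_pos n
  rw [majR]
  positivity

theorem hasSum_majR {d : ℕ} (x : Fin d → L2) (i : Fin d) :
    HasSum (majR x i) (∑' n, (wt n ^ 2)⁻¹ + ‖x i‖ ^ 2) :=
  summable_wt_inv_sq.hasSum.add (L2_hasSum (x i))

/-- The dominating function of a form evaluated at `x`. -/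
def maj {d : ℕ} (x : Fin d → L2) (ν : Fin d → ℤ) : ℝ :=
  ∑ q, if ∑ i, ν i = 0 then ∏ i ∈ Finset.univ.erase q, majR x i (ν i) else 0

theorem summable_maj {d : ℕ} (x : Fin d → L2) : Summable (maj x) := by
  cases d with
  | zero => exact Summable.of_finite
  | succ d =>
    exact summable_sum fun q _ =>
      (hasSum_hyperplane q (majR_nonneg x) fun i => (hasSum_majR x i).summable).summable

theorem tsum_maj_le {d : ℕ} (x : Fin d → L2) (hx : ∀ i, ‖x i‖ ≤ 1) :
    ∑' ν, maj x ν ≤ d * (∑' n, (wt n ^ 2)⁻¹ + 1) ^ (d - 1) := by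
  cases d with
  | zero => simp [maj]
  | succ d =>
    have h := hasSum_sum (s := Finset.univ) fun q _ =>
      hasSum_hyperplane q (majR_nonneg x) fun i => (hasSum_majR x i).summable
    change HasSum (maj x) _ at h
    rw [h.tsum_eq]
    have hb : ∀ q ∈ (Finset.univ : Finset (Fin (d + 1))),
        ∏ j, ∑' n, majR x (q.succAbove j) n ≤ (∑' n, (wt n ^ 2)⁻¹ + 1) ^ d := by
      intro q _
      have h1 : ∀ j : Fin d, ∑' n, majR x (q.succAbove j) n ≤ ∑' n, (wt n ^ 2)⁻¹ + 1 := by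
        intro j
        rw [(hasSum_majR x _).tsum_eq]
        have := pow_le_one₀ (n := 2) (norm_nonneg _) (hx (q.succAbove j))
        linarith
      have h2 := Finset.prod_le_prod (s := Finset.univ)
        (fun j _ => tsum_nonneg fun n => majR_nonneg x (q.succAbove j) n) fun j _ => h1 j
      simpa using h2
    have := Finset.sum_le_card_nsmul _ _ _ hb
    simpa using this

/-- The constant does not depend on the symbol `m`, which gives bounds uniform in the depth. -/
theorem norm_termL_le (k : ℕ) {d : ℕ} (hd : 3 ≤ d) (hdk : d ≤ k + 2) :
    ∃ C : ℝ, 0 ≤ C ∧ ∀ (K : ℝ) (m : (Fin d → ℤ) → ℂ), (∀ ν, ‖m ν‖ ≤ K * sz ν ^ (k + 2 - d)) →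
      ∀ (x : Fin d → L2) (ν : Fin d → ℤ), ‖termL k m ν x‖ ≤ K * (C * maj x ν) := by
  obtain ⟨C, hC0, hC⟩ := term_bound k hd hdk
  refine ⟨C, hC0, fun K m hm x ν => ?_⟩
  have hK : 0 ≤ K := nonneg_of_mul_nonneg_left ((norm_nonneg _).trans (hm ν))
    (pow_pos (sz_pos ν) _)
  rw [termL_apply]
  by_cases hν : ∑ i, ν i = 0
  · simp only [maj, hν, if_true, norm_mul, norm_prod, norm_coordL]
    have h := hC ν hν (fun i => ‖x i (ν i)‖) fun i => norm_nonneg _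
    calc ‖m ν‖ * ∏ i, ((rho k (ν i))⁻¹ * ‖x i (ν i)‖)
        ≤ (K * sz ν ^ (k + 2 - d)) * ∏ i, ((rho k (ν i))⁻¹ * ‖x i (ν i)‖) :=
          mul_le_mul_of_nonneg_right (hm ν) (Finset.prod_nonneg fun i _ =>
            mul_nonneg (inv_nonneg.2 (rho_pos k _).le) (norm_nonneg _))
      _ ≤ _ := by
          rw [mul_assoc]
          exact mul_le_mul_of_nonneg_left h hK
  · simp [maj, hν]

theorem summable_termL (k : ℕ) {d : ℕ} (hd : 3 ≤ d) (hdk : d ≤ k + 2) {m : (Fin d → ℤ) → ℂ}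
    {K : ℝ} (hm : ∀ ν, ‖m ν‖ ≤ K * sz ν ^ (k + 2 - d)) (x : Fin d → L2) :
    Summable fun ν => termL k m ν x := by
  obtain ⟨C, _, hC⟩ := norm_termL_le k hd hdk
  exact Summable.of_norm_bounded (((summable_maj x).mul_left C).mul_left K) (hC K m hm x)

/-- The multilinear form of degree `d` with symbol `m`. -/
def formL (k : ℕ) {d : ℕ} (hd : 3 ≤ d) (hdk : d ≤ k + 2) {m : (Fin d → ℤ) → ℂ}
    (hm : ∃ K : ℝ, ∀ ν, ‖m ν‖ ≤ K * sz ν ^ (k + 2 - d)) :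
    MultilinearMap ℝ (fun _ : Fin d => L2) ℂ where
  toFun x := ∑' ν, termL k m ν x
  map_update_add' x i a b := by
    obtain ⟨K, hm⟩ := hm
    rw [← (summable_termL k hd hdk hm _).tsum_add (summable_termL k hd hdk hm _)]
    refine tsum_congr fun ν => ?_
    convert! (termL k m ν).map_update_add x i a b
  map_update_smul' x i c a := by
    rw [← tsum_const_smul'']
    refine tsum_congr fun ν => ?_
    convert! (termL k m ν).map_update_smul x i c a

theorem formL_apply (k : ℕ) {d : ℕ} (hd : 3 ≤ d) (hdk : d ≤ k + 2) {m : (Fin d → ℤ) → ℂ}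
    (hm : ∃ K : ℝ, ∀ ν, ‖m ν‖ ≤ K * sz ν ^ (k + 2 - d)) (x : Fin d → L2) :
    formL k hd hdk hm x = ∑' ν, termL k m ν x := rfl

/-- The dominating function is not homogeneous in `x`, so the bound is proved on unit vectors
and extended by scaling. -/
theorem norm_formL_le (k : ℕ) {d : ℕ} (hd : 3 ≤ d) (hdk : d ≤ k + 2) {m : (Fin d → ℤ) → ℂ}
    (hm : ∃ K : ℝ, ∀ ν, ‖m ν‖ ≤ K * sz ν ^ (k + 2 - d)) :
    ∃ B : ℝ, ∀ x : Fin d → L2, ‖formL k hd hdk hm x‖ ≤ B * ∏ i, ‖x i‖ := by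
  obtain ⟨K, hK⟩ := id hm
  obtain ⟨C, hC0, hC⟩ := norm_termL_le k hd hdk
  have hK0 : 0 ≤ K := nonneg_of_mul_nonneg_left ((norm_nonneg _).trans (hK 0))
    (pow_pos (sz_pos _) _)
  set B := K * (C * (d * (∑' n, (wt n ^ 2)⁻¹ + 1) ^ (d - 1))) with hB
  have hunit : ∀ x : Fin d → L2, (∀ i, ‖x i‖ ≤ 1) → ‖formL k hd hdk hm x‖ ≤ B := by
    intro x hx
    rw [formL_apply]
    refine (tsum_of_norm_bounded
      (((summable_maj x).hasSum.mul_left C).mul_left K) (hC K m hK x)).trans ?_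
    exact mul_le_mul_of_nonneg_left (mul_le_mul_of_nonneg_left (tsum_maj_le x hx) hC0) hK0
  refine ⟨B, fun x => ?_⟩
  by_cases h0 : ∃ i, x i = 0
  · obtain ⟨i, hi⟩ := h0
    rw [(formL k hd hdk hm).map_coord_zero i hi, norm_zero,
      Finset.prod_eq_zero (Finset.mem_univ i) (by rw [hi, norm_zero]), mul_zero]
  · push Not at h0
    have hx : x = fun i => ‖x i‖ • (‖x i‖⁻¹ • x i) := by
      funext i
      rw [smul_smul, mul_inv_cancel₀ (norm_ne_zero_iff.2 (h0 i)), one_smul]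
    have h1 := hunit (fun i => ‖x i‖⁻¹ • x i) fun i => by
      rw [norm_smul, norm_inv, norm_norm, inv_mul_cancel₀ (norm_ne_zero_iff.2 (h0 i))]
    have hp : 0 ≤ ∏ i, ‖x i‖ := Finset.prod_nonneg fun i _ => norm_nonneg _
    conv_lhs => rw [hx]
    rw [MultilinearMap.map_smul_univ, norm_smul, Real.norm_of_nonneg hp, mul_comm]
    exact mul_le_mul_of_nonneg_right h1 hp

theorem continuous_formL (k : ℕ) {d : ℕ} (hd : 3 ≤ d) (hdk : d ≤ k + 2) {m : (Fin d → ℤ) → ℂ}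
    (hm : ∃ K : ℝ, ∀ ν, ‖m ν‖ ≤ K * sz ν ^ (k + 2 - d)) :
    Continuous (formL k hd hdk hm) := by
  obtain ⟨B, hB⟩ := norm_formL_le k hd hdk hm
  exact (formL k hd hdk hm).continuous_of_bound B hB

/-- Pointwise convergence of uniformly bounded symbols implies convergence of the forms. -/
theorem tendsto_formL (k : ℕ) {d : ℕ} (hd : 3 ≤ d) (hdk : d ≤ k + 2) {α : Type*} {l : Filter α}
    {m : α → (Fin d → ℤ) → ℂ} {m₀ : (Fin d → ℤ) → ℂ} {K : ℝ}
    (hm : ∀ᶠ p in l, ∀ ν, ‖m p ν‖ ≤ K * sz ν ^ (k + 2 - d))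
    (hlim : ∀ ν, Tendsto (fun p => m p ν) l (𝓝 (m₀ ν))) (x : Fin d → L2) :
    Tendsto (fun p => ∑' ν, termL k (m p) ν x) l (𝓝 (∑' ν, termL k m₀ ν x)) := by
  obtain ⟨C, _, hC⟩ := norm_termL_le k hd hdk
  refine tendsto_tsum_of_dominated_convergence
    (((summable_maj x).mul_left C).mul_left K) (fun ν => ?_) ?_
  · simp only [termL_apply]
    split_ifs
    · exact (hlim ν).mul_const _
    · exact tendsto_const_nhds
  · filter_upwards [hm] with p hp ν
    exact hC K (m p) hp x ν

/-! ### The embedding of the Sobolev space -/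

theorem memLp_rho {k : ℕ} {u : ℝ → ℝ} (hu : u ∈ sobolevZero ((k : ℝ) / 2)) :
    Memℓp (fun n : ℤ => (rho k n : ℂ) * fourierCoef (cplx u) n) 2 := by
  refine memℓp_gen ?_
  refine hu.2.2.2.congr fun n => ?_
  have h2 : (ENNReal.toReal 2) = ((2 : ℕ) : ℝ) := by simp
  rw [h2, Real.rpow_natCast, norm_mul, mul_pow, Complex.norm_real, Real.norm_eq_abs,
    sq_abs, rho_sq]

/-- The embedding of `H^{k/2}` into `ℓ²`. -/
def embL (k : ℕ) : sobolevZero ((k : ℝ) / 2) →ₗ[ℝ] L2 where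
  toFun u := ⟨fun n => (rho k n : ℂ) * fourierCoef (cplx u) n, memLp_rho u.2⟩
  map_add' u v := by
    ext n
    change _ * fourierCoef (cplx ((u : ℝ → ℝ) + v)) n = _
    rw [fourierCoef_add (intervalIntegrable_of_memLp u.2.2.1)
      (intervalIntegrable_of_memLp v.2.2.1), mul_add]
    rfl
  map_smul' c u := by
    ext n
    change _ * fourierCoef (cplx (c • (u : ℝ → ℝ))) n = _
    rw [fourierCoef_smul, mul_left_comm]
    rfl

theorem embL_apply (k : ℕ) (u : sobolevZero ((k : ℝ) / 2)) (n : ℤ) :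
    embL k u n = (rho k n : ℂ) * fourierCoef (cplx u) n := rfl

theorem coordL_embL (k : ℕ) (u : sobolevZero ((k : ℝ) / 2)) (n : ℤ) :
    coordL k n (embL k u) = fourierCoef (cplx u) n := by
  have := (rho_pos k n).ne'
  simp only [coordL, LinearMap.coe_mk, AddHom.coe_mk, embL_apply]
  rw [← mul_assoc, ← Complex.ofReal_mul, inv_mul_cancel₀ this, Complex.ofReal_one, one_mul]

theorem norm_embL (k : ℕ) (u : sobolevZero ((k : ℝ) / 2)) :
    ‖embL k u‖ = sobolevNorm ((k : ℝ) / 2) u := by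
  rw [sobolevNorm, eq_comm, Real.sqrt_eq_iff_eq_sq
    (tsum_nonneg fun n => by positivity) (norm_nonneg _), ← (L2_hasSum _).tsum_eq]
  refine tsum_congr fun n => ?_
  rw [embL_apply, norm_mul, mul_pow, Complex.norm_real, Real.norm_eq_abs, sq_abs, rho_sq]

/-! ### The symbols of the two equations -/

/-- The function `coth x - 1 / x`. -/
def lang (x : ℝ) : ℝ := Real.cosh x / Real.sinh x - 1 / x

theorem lang_neg (x : ℝ) : lang (-x) = -lang x := by
  simp only [lang, Real.cosh_neg, Real.sinh_neg, div_neg]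
  ring

theorem lang_le_one {x : ℝ} (hx : 0 < x) : lang x ≤ 1 := by
  have hs := Real.sinh_pos_iff.2 hx
  rw [lang, sub_le_iff_le_add, div_le_iff₀ hs, ← sub_nonneg]
  have h1 : Real.cosh x = Real.sinh x + Real.exp (-x) := by
    rw [← Real.cosh_sub_sinh]
    ring
  have h2 : Real.exp (-x) ≤ 1 := by
    rw [Real.exp_le_one_iff]
    linarith
  have h3 : x ≤ Real.sinh x := Real.self_le_sinh_iff.2 hx.le
  have h4 : 1 ≤ 1 / x * Real.sinh x := by
    rw [one_div, inv_mul_eq_div, le_div_iff₀ hx]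
    linarith
  rw [h1]
  nlinarith

theorem cube_le_mul_cosh_sub_sinh {x : ℝ} (hx : 0 ≤ x) :
    x ^ 3 / 3 ≤ x * Real.cosh x - Real.sinh x := by
  have hd : ∀ y, HasDerivAt (fun y => y * Real.cosh y - Real.sinh y - y ^ 3 / 3)
      (y * Real.sinh y - y ^ 2) y := by
    intro y
    have h := (((hasDerivAt_id y).mul (Real.hasDerivAt_cosh y)).sub (Real.hasDerivAt_sinh y)).sub
      ((hasDerivAt_pow 3 y).div_const 3)
    convert! h using 1
    simp
  have hm : MonotoneOn (fun y => y * Real.cosh y - Real.sinh y - y ^ 3 / 3) (Set.Ici 0) := by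
    refine monotoneOn_of_deriv_nonneg (convex_Ici 0)
      (fun y _ => (hd y).continuousAt.continuousWithinAt)
      (fun y _ => (hd y).differentiableAt.differentiableWithinAt) fun y hy => ?_
    rw [interior_Ici, Set.mem_Ioi] at hy
    rw [(hd y).deriv]
    have := Real.self_le_sinh_iff.2 hy.le
    nlinarith
  have := hm Set.self_mem_Ici (Set.mem_Ici.2 hx) hx
  simp only [zero_mul, Real.sinh_zero] at this
  linarith

/-- This follows from `x³ / 3 ≤ x cosh x - sinh x`, and keeps the quadratic part definite for
small `x`, where `one_sub_inv_le_lang` is void. -/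
theorem lang_ge {x : ℝ} (hx : 0 < x) : x ^ 2 / (3 * Real.sinh x) ≤ lang x := by
  have hs := Real.sinh_pos_iff.2 hx
  rw [lang, div_sub_div _ _ hs.ne' hx.ne', div_le_div_iff₀ (by positivity) (by positivity)]
  have h := cube_le_mul_cosh_sub_sinh hx.le
  have h2 : 0 ≤ 3 * Real.sinh x * (x * Real.cosh x - Real.sinh x - x ^ 3 / 3) := by
    have : 0 ≤ x * Real.cosh x - Real.sinh x - x ^ 3 / 3 := by linarith
    positivity
  nlinarith

theorem one_sub_inv_le_lang {x : ℝ} (hx : 0 < x) : 1 - 1 / x ≤ lang x := by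
  have hs := Real.sinh_pos_iff.2 hx
  rw [lang]
  have : 1 ≤ Real.cosh x / Real.sinh x := by
    rw [le_div_iff₀ hs, one_mul]
    exact (Real.sinh_lt_cosh x).le
  linarith

theorem lang_pos {x : ℝ} (hx : 0 < x) : 0 < lang x := by
  have hs := Real.sinh_pos_iff.2 hx
  exact (by positivity : 0 < x ^ 2 / (3 * Real.sinh x)).trans_le (lang_ge hx)

/-- Away from the origin `coth x - 1 / x` is bounded from below. -/
theorem exists_le_lang {x₀ : ℝ} (hx₀ : 0 < x₀) : ∃ c, 0 < c ∧ c ≤ 1 ∧ ∀ x, x₀ ≤ x → c ≤ lang x := by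
  have hs := Real.sinh_pos_iff.2 (zero_lt_two (α := ℝ))
  refine ⟨min (1 / 2) (x₀ ^ 2 / (3 * Real.sinh 2)), by positivity,
    (min_le_left _ _).trans (by norm_num), fun x hx => ?_⟩
  have hx0 := hx₀.trans_le hx
  rcases le_total 2 x with h | h
  · refine (min_le_left _ _).trans (le_trans ?_ (one_sub_inv_le_lang hx0))
    have : 1 / x ≤ 1 / 2 := one_div_le_one_div_of_le two_pos h
    linarith
  · refine (min_le_right _ _).trans (le_trans ?_ (lang_ge hx0))
    have h1 := Real.sinh_le_sinh.2 h
    have h2 := Real.sinh_pos_iff.2 hx0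
    gcongr

theorem tendsto_lang : Tendsto lang atTop (𝓝 1) := by
  have h : Tendsto (fun x : ℝ => 1 - 1 / x) atTop (𝓝 (1 - 0)) := by
    simp only [one_div]
    exact tendsto_const_nhds.sub tendsto_inv_atTop_zero
  rw [sub_zero] at h
  refine tendsto_of_tendsto_of_tendsto_of_le_of_le' h tendsto_const_nhds ?_ ?_
  · filter_upwards [eventually_gt_atTop 0] with x hx using one_sub_inv_le_lang hx
  · filter_upwards [eventually_gt_atTop 0] with x hx using lang_le_one hx

/-- The real symbol of `𝒢 ∂ₓ + s`, where `𝒢` has the symbol `-i sgn(n) g(n)`. -/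
def symK (g : ℤ → ℝ) (s : ℝ) (n : ℤ) : ℝ := |(n : ℝ)| * g n + s

/-- The symbol of `(𝒢 - i) ∂ₓ + s`. -/
def symL (g : ℤ → ℝ) (s : ℝ) (n : ℤ) : ℂ := ((symK g s n + n : ℝ) : ℂ)

/-- The symbol `-i sgn(n) g(n)`. -/
def symS (g : ℤ → ℝ) (n : ℤ) : ℂ := -Complex.I * (n.sign : ℂ) * (g n : ℂ)

/-- A common setting for the two equations: `g(n) = |coth(δn) - 1/(δn)|` and `s = 1/δ` for the
intermediate long wave equation, `g = 1` and `s = 0` for the Benjamin-Ono equation. The property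
`add` is the addition theorem of `coth`, as `symK g s n = n coth(δn)` in the first case. -/
structure GoodSymbol (g : ℤ → ℝ) (s : ℝ) : Prop where
  s_nonneg : 0 ≤ s
  even : ∀ n, g (-n) = g n
  nonneg : ∀ n, 0 ≤ g n
  le_one : ∀ n, g n ≤ 1
  add : ∀ a b : ℤ, ((a : ℝ) + b) * (symK g s a * symK g s b + a * b) =
    symK g s (a + b) * (b * symK g s a + a * symK g s b)

theorem symL_zero (g : ℤ → ℝ) (s : ℝ) : symL g s 0 = s := by simp [symL, symK]

theorem GoodSymbol.symK_neg {g : ℤ → ℝ} {s : ℝ} (h : GoodSymbol g s) (n : ℤ) :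
    symK g s (-n) = symK g s n := by
  simp [symK, h.even]

theorem GoodSymbol.identities {g : ℤ → ℝ} {s : ℝ} (h : GoodSymbol g s) :
    SymbolIdentities (symL g s) := by
  refine ⟨fun a b => ?_, fun a => ?_⟩
  · have h1 : ((a : ℂ) + b) * (symK g s a * symK g s b + a * b) =
        symK g s (a + b) * (b * symK g s a + a * symK g s b) := by
      exact_mod_cast congrArg (fun x : ℝ => (x : ℂ)) (h.add a b)
    simp only [symL]
    push_cast
    linear_combination -h1
  · simp only [symL, h.symK_neg]
    push_cast
    ring

theorem GoodSymbol.linBound {g : ℤ → ℝ} {s : ℝ} (h : GoodSymbol g s) {S : ℝ} (hs : s ≤ S) :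
    LinBound (2 + S) (symL g s) := by
  intro n
  have h0 := h.s_nonneg
  have h1 := abs_nonneg (n : ℝ)
  have h2 : |symK g s n| ≤ |(n : ℝ)| + s := by
    rw [symK, abs_of_nonneg (add_nonneg (mul_nonneg h1 (h.nonneg n)) h0)]
    have := mul_le_mul_of_nonneg_left (h.le_one n) h1
    linarith
  rw [symL, Complex.norm_real, Real.norm_eq_abs, wt]
  have := abs_add_le (symK g s n) n
  nlinarith

theorem GoodSymbol.polyGrowth {g : ℤ → ℝ} {s : ℝ} (h : GoodSymbol g s) :
    PolyGrowth (symL g s) := (h.linBound le_rfl).polyGrowth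

theorem GoodSymbol.polyGrowth_symS {g : ℤ → ℝ} {s : ℝ} (h : GoodSymbol g s) :
    PolyGrowth (symS g) := by
  refine ⟨1, 0, fun n => ?_⟩
  have h1 : ‖((n.sign : ℤ) : ℂ)‖ ≤ 1 := by
    rcases lt_trichotomy n 0 with hn | hn | hn
    · simp [Int.sign_eq_neg_one_of_neg hn]
    · simp [hn]
    · simp [Int.sign_eq_one_of_pos hn]
  simp only [symS, norm_mul, norm_neg, Complex.norm_I, one_mul, pow_zero, mul_one,
    Complex.norm_real, Real.norm_of_nonneg (h.nonneg n)]
  exact mul_le_one₀ h1 (h.nonneg n) (h.le_one n)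

/-- The operator `(𝒢 - i) ∂ₓ + s`. -/
def opG (g : ℤ → ℝ) (s : ℝ) (f : ℝ → ℂ) : ℝ → ℂ := fun x =>
  fourierMul (symS g) (deriv f) x - Complex.I * deriv f x + (s : ℂ) * f x

theorem GoodSymbol.symL_eq {g : ℤ → ℝ} {s : ℝ} (n : ℤ) :
    symS g n * (Complex.I * n) - Complex.I * (Complex.I * n) + s = symL g s n := by
  have h1 : ((n.sign : ℤ) : ℂ) * n = ((|(n : ℝ)| : ℝ) : ℂ) := by
    have := Int.sign_mul_self_eq_abs n
    rw [← Int.cast_abs, ← this]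
    push_cast
    ring
  simp only [symS, symL, symK]
  push_cast
  rw [← h1]
  linear_combination (-(n.sign : ℂ) * g n * n - n) * Complex.I_sq

theorem GoodSymbol.opG_eq {g : ℤ → ℝ} {s : ℝ} (h : GoodSymbol g s) {f : ℝ → ℂ} (hf : f ∈ Sm) :
    opG g s f = fourierMul (symL g s) f := by
  have hd := deriv_mem_Sm hf
  have h1 := fourierMul_mem_Sm h.polyGrowth_symS hd
  have e : opG g s f = fourierMul (symS g) (deriv f) + (-Complex.I) • deriv f + (s : ℂ) • f := by
    funext x
    simp only [opG, Pi.add_apply, Pi.smul_apply, smul_eq_mul]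
    ring
  have m2 := Sm.smul_mem hd (-Complex.I)
  have m3 := Sm.smul_mem hf (s : ℂ)
  rw [e]
  refine eq_of_coef_eq (Sm.add_mem (Sm.add_mem h1 m2) m3) (fourierMul_mem_Sm h.polyGrowth hf)
    fun n => ?_
  rw [coef_add (Sm.add_mem h1 m2) m3, coef_add h1 m2, coef_smul, coef_smul,
    coef_fourierMul h.polyGrowth_symS hd, coef_fourierMul h.polyGrowth hf, coef_deriv hf,
    ← GoodSymbol.symL_eq]
  ring

/-- The function `g` for the intermediate long wave equation. Its value at `0` is `0`. -/
def gILW (δ : ℝ) (n : ℤ) : ℝ := lang (δ * |(n : ℝ)|)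

theorem gILW_zero (δ : ℝ) : gILW δ 0 = 0 := by simp [gILW, lang]

theorem symG_eq (δ : ℝ) : symG δ = symS (gILW δ) := by
  funext n
  rw [symG]
  split_ifs with hn
  · simp [symS, hn]
  · change -Complex.I * ((lang (δ * n) : ℝ) : ℂ) = _
    rcases lt_or_gt_of_ne hn with h | h
    · have h' : |(n : ℝ)| = -n := abs_of_neg (by exact_mod_cast h)
      rw [symS, gILW, h', mul_neg, lang_neg, Int.sign_eq_neg_one_of_neg h]
      push_cast
      ring
    · have h' : |(n : ℝ)| = n := abs_of_pos (by exact_mod_cast h)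
      rw [symS, gILW, h', Int.sign_eq_one_of_pos h]
      push_cast
      ring

theorem symH_eq : symH = symS 1 := by
  funext n
  simp [symH, symS]

theorem opILW_eq (δ : ℝ) : opILW δ = opG (gILW δ) δ⁻¹ := by
  funext f x
  rw [opILW, opG, symG_eq]

theorem opBO_eq : opBO = opG 1 0 := by
  funext f x
  rw [opBO, opG, symH_eq]
  simp

theorem gILW_bounds {δ : ℝ} (hδ : 0 < δ) (n : ℤ) : 0 ≤ gILW δ n ∧ gILW δ n ≤ 1 := by
  rcases eq_or_ne n 0 with rfl | hn
  · simp [gILW_zero]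
  · have : 0 < δ * |(n : ℝ)| := mul_pos hδ (abs_pos.2 (by exact_mod_cast hn))
    exact ⟨(lang_pos this).le, lang_le_one this⟩

theorem norm_symG {δ : ℝ} (hδ : 0 < δ) (n : ℤ) : ‖symG δ n‖ = gILW δ n := by
  rw [symG_eq, symS]
  rcases eq_or_ne n 0 with rfl | hn
  · simp [gILW_zero]
  · have h1 : ‖((n.sign : ℤ) : ℂ)‖ = 1 := by
      rw [Complex.norm_intCast, ← Int.cast_abs, Int.abs_sign_of_ne_zero hn, Int.cast_one]
    rw [norm_mul, norm_mul, norm_neg, Complex.norm_I, h1, Complex.norm_real,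
      Real.norm_of_nonneg (gILW_bounds hδ n).1]
    ring

theorem symK_gILW {δ : ℝ} (hδ : 0 < δ) {n : ℤ} (hn : n ≠ 0) :
    symK (gILW δ) δ⁻¹ n = n * (Real.cosh (δ * n) / Real.sinh (δ * n)) := by
  have h0 : (n : ℝ) ≠ 0 := by exact_mod_cast hn
  have key : symK (gILW δ) δ⁻¹ n = |(n : ℝ)| *
      (Real.cosh (δ * |(n : ℝ)|) / Real.sinh (δ * |(n : ℝ)|)) := by
    have h1 : |(n : ℝ)| ≠ 0 := abs_ne_zero.2 h0
    rw [symK, gILW, lang, mul_sub]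
    have : |(n : ℝ)| * (1 / (δ * |(n : ℝ)|)) = δ⁻¹ := by field_simp
    rw [this]
    ring
  rw [key]
  rcases abs_choice (n : ℝ) with h | h
  · rw [h]
  · rw [h, mul_neg, Real.cosh_neg, Real.sinh_neg, div_neg, neg_mul_neg]

theorem goodSymbol_ILW {δ : ℝ} (hδ : 0 < δ) : GoodSymbol (gILW δ) δ⁻¹ := by
  refine ⟨(inv_pos.2 hδ).le, fun n => by simp [gILW], fun n => (gILW_bounds hδ n).1,
    fun n => (gILW_bounds hδ n).2, fun a b => ?_⟩
  rcases eq_or_ne a 0 with rfl | ha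
  · simp
    ring
  rcases eq_or_ne b 0 with rfl | hb
  · simp
    ring
  rcases eq_or_ne (a + b) 0 with hab | hab
  · obtain rfl : b = -a := by omega
    have : symK (gILW δ) δ⁻¹ (-a) = symK (gILW δ) δ⁻¹ a := by simp [symK, gILW]
    rw [this]
    push_cast
    ring
  have hne : ∀ n : ℤ, n ≠ 0 → Real.sinh (δ * n) ≠ 0 := by
    intro n hn
    rw [Ne, Real.sinh_eq_zero]
    exact mul_ne_zero hδ.ne' (by exact_mod_cast hn)
  have sa := hne a ha
  have sb := hne b hb
  have sab := hne _ hab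
  rw [symK_gILW hδ ha, symK_gILW hδ hb, symK_gILW hδ hab]
  push_cast at sab ⊢
  rw [mul_add, Real.sinh_add] at sab
  rw [mul_add δ, Real.sinh_add, Real.cosh_add]
  generalize Real.sinh (δ * a) = x at *
  generalize Real.sinh (δ * b) = y at *
  generalize Real.cosh (δ * a) = z at *
  generalize Real.cosh (δ * b) = w at *
  field_simp
  ring

theorem goodSymbol_BO : GoodSymbol 1 0 := by
  refine ⟨le_rfl, fun n => rfl, fun n => zero_le_one, fun n => le_rfl, fun a b => ?_⟩
  simp only [symK, Pi.one_apply, mul_one, add_zero, Int.cast_add]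
  rcases abs_cases (a : ℝ) with h | h <;> rcases abs_cases (b : ℝ) with h' | h' <;>
    rcases abs_cases ((a : ℝ) + b) with h'' | h'' <;> rw [h.1, h'.1, h''.1] <;>
    first
    | (exfalso; linarith)
    | ring

theorem tendsto_gILW {n : ℤ} (hn : n ≠ 0) : Tendsto (fun δ => gILW δ n) atTop (𝓝 1) := by
  have : 0 < |(n : ℝ)| := abs_pos.2 (by exact_mod_cast hn)
  exact tendsto_lang.comp (tendsto_id.atTop_mul_const this)

theorem tendsto_symL : Tendsto (fun δ => symL (gILW δ) δ⁻¹) atTop (𝓝 (symL 1 0)) := by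
  rw [tendsto_pi_nhds]
  intro n
  simp only [symL]
  refine (Complex.continuous_ofReal.tendsto _).comp ?_
  refine Tendsto.add_const _ ?_
  simp only [symK]
  refine Tendsto.add ?_ tendsto_inv_atTop_zero
  rcases eq_or_ne n 0 with rfl | hn
  · simp
  · exact (tendsto_gILW hn).const_mul _

/-! ### Evaluation of the quadratic part -/

theorem bCoef_pos (k : ℕ) : 0 < bCoef k := by
  refine Finset.sum_pos (fun l hl => ?_) ⟨0, by simp⟩
  have : l < k + 1 := Finset.mem_range.1 (Finset.mem_filter.1 hl).1
  exact_mod_cast Nat.choose_pos (by omega)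

theorem bCoef_mul_aCoef (k l : ℕ) : bCoef k * aCoef k l = ((k + 1).choose (l + 1) : ℝ) := by
  rw [aCoef, mul_div_cancel₀ _ (bCoef_pos k).ne']

theorem aCoef_pos {k l : ℕ} (h : l ≤ k) : 0 < aCoef k l :=
  div_pos (by exact_mod_cast Nat.choose_pos (by omega)) (bCoef_pos k)

theorem sum_aCoef (k : ℕ) :
    ∑ l ∈ (Finset.range (k + 1)).filter (fun l => Even l), aCoef k l = 1 := by
  simp only [aCoef, ← Finset.sum_div]
  exact div_self (bCoef_pos k).ne'

/-- The odd part of a binomial expansion. -/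
theorem add_pow_sub_sub_pow (x y : ℂ) (j : ℕ) :
    (x + y) ^ (j + 1) - (x - y) ^ (j + 1) =
      2 * y * ∑ l ∈ (Finset.range (j + 1)).filter (fun l => Even l),
        ((j + 1).choose (l + 1) : ℂ) * (y ^ l * x ^ (j - l)) := by
  have h1 : (x + y) ^ (j + 1) - (x - y) ^ (j + 1) =
      ∑ i ∈ Finset.range (j + 1 + 1), (y ^ i - (-y) ^ i) * x ^ (j + 1 - i) * (j + 1).choose i := by
    rw [add_comm x y, show x - y = -y + x by ring, add_pow, add_pow, ← Finset.sum_sub_distrib]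
    exact Finset.sum_congr rfl fun i _ => by ring
  rw [h1, Finset.sum_range_succ', Finset.sum_filter, Finset.mul_sum]
  simp only [pow_zero, sub_self, zero_mul, add_zero, mul_ite, mul_zero]
  refine Finset.sum_congr rfl fun l _ => ?_
  rw [Nat.succ_sub_succ]
  split_ifs with he
  · rw [Odd.neg_pow (Even.add_one he)]
    ring
  · rw [Even.neg_pow (Nat.not_even_iff_odd.1 he).add_one]
    ring

/-- The auxiliary sums `∑_{i ≤ k} s^{k-i} (P + s)^{i+1}`. -/
def powSum (s P : ℂ) : ℕ → ℂ
  | 0 => P + s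
  | k + 1 => s * powSum s P k + (P + s) ^ (k + 2)

/-- By Pascal's rule the binomials `binom (k + 2) (j + 2)` in the definition of the energies arise
from expanding the powers of `P + s`. -/
theorem powSum_eq (s P : ℂ) (k : ℕ) :
    powSum s P k = ∑ j ∈ Finset.range (k + 1),
      ((k + 2).choose (j + 2) : ℂ) * s ^ (k - j) * P ^ (j + 1) + (k + 1) * s ^ (k + 1) := by
  induction k with
  | zero => simp [powSum]
  | succ k ih =>
    have h1 : (P + s) ^ (k + 2) = ∑ j ∈ Finset.range (k + 2),
        ((k + 2).choose (j + 1) : ℂ) * s ^ (k + 1 - j) * P ^ (j + 1) + s ^ (k + 2) := by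
      rw [add_pow, Finset.sum_range_succ']
      congr 1
      · refine Finset.sum_congr rfl fun j _ => ?_
        rw [show k + 2 - (j + 1) = k + 1 - j by omega]
        ring
      · simp
    have h2 : s * ∑ j ∈ Finset.range (k + 1),
        ((k + 2).choose (j + 2) : ℂ) * s ^ (k - j) * P ^ (j + 1) =
        ∑ j ∈ Finset.range (k + 2),
          ((k + 2).choose (j + 2) : ℂ) * s ^ (k + 1 - j) * P ^ (j + 1) := by
      rw [Finset.sum_range_succ _ (k + 1), Nat.choose_eq_zero_of_lt (by omega : k + 2 < k + 1 + 2),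
        Finset.mul_sum]
      simp only [Nat.cast_zero, zero_mul, add_zero]
      refine Finset.sum_congr rfl fun j hj => ?_
      rw [show k + 1 - j = (k - j) + 1 by have := Finset.mem_range.1 hj; omega, pow_succ]
      ring
    have h3 : ∑ j ∈ Finset.range (k + 2),
        ((k + 3).choose (j + 2) : ℂ) * s ^ (k + 1 - j) * P ^ (j + 1) =
        ∑ j ∈ Finset.range (k + 2),
          ((k + 2).choose (j + 2) : ℂ) * s ^ (k + 1 - j) * P ^ (j + 1) +
        ∑ j ∈ Finset.range (k + 2),
          ((k + 2).choose (j + 1) : ℂ) * s ^ (k + 1 - j) * P ^ (j + 1) := by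
      rw [← Finset.sum_add_distrib]
      refine Finset.sum_congr rfl fun j _ => ?_
      rw [show k + 3 = (k + 2) + 1 by ring, Nat.choose_succ_succ' (k + 2) (j + 1)]
      push_cast
      ring
    rw [powSum, ih, mul_add, h2, h1]
    rw [show k + 1 + 2 = k + 3 by ring, show k + 1 + 1 = k + 2 by ring, h3]
    push_cast
    ring

theorem hSym_mul_sub (x y : ℂ) (n : ℕ) : hSym x y n * (x - y) = x ^ (n + 1) - y ^ (n + 1) := by
  rw [hSym, Finset.Nat.sum_antidiagonal_eq_sum_range_succ (fun i j => x ^ i * y ^ j)]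
  have := (Commute.all x y).geom_sum₂_mul (n + 1)
  simpa using this

/-- Multiplication by `x - y` telescopes the symmetric polynomials in `quadSym`. -/
theorem quadSym_mul (s x y : ℂ) (k : ℕ) :
    quadSym s x y k * (x - y) = powSum s (x - s) k - powSum s (y - s) k := by
  induction k with
  | zero => simp [quadSym, powSum]
  | succ k ih =>
    have h := hSym_mul_sub (-x) (-y) (k + 1)
    have h2 : ((-1 : ℂ) ^ (k + 1)) * (-1) ^ (k + 1) = 1 := by
      rw [← mul_pow]
      simp
    rw [neg_pow x, neg_pow y] at h
    simp only [quadSym, powSum, sub_add_cancel]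
    rw [pow_succ (-1 : ℂ) (k + 1)] at h
    linear_combination s * ih - (-1) ^ (k + 1) * h + (x ^ (k + 2) - y ^ (k + 2)) * h2

/-- The homogeneous quadratic form with symbol `|n|^k g(n)^m`. -/
def homG (g : ℤ → ℝ) (m k : ℕ) (u : ℝ → ℝ) : ℝ :=
  ∑' n : ℤ, |(n : ℝ)| ^ k * g n ^ m * ‖fourierCoef (cplx u) n‖ ^ 2

/-- The quadratic part of twice the energy. -/
def quadG (g : ℤ → ℝ) (k : ℕ) (u : ℝ → ℝ) : ℝ :=
  ∑ l ∈ (Finset.range (k + 1)).filter (fun l => Even l), aCoef k l * homG g (k - l) k u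

/-- The symbol of the quadratic part is exactly the combination of the quadratic parts of the
energies of order at most `k` that the recursion for the energies inverts. -/
theorem GoodSymbol.quadSym_eq {g : ℤ → ℝ} {s : ℝ} (h : GoodSymbol g s) {n : ℤ} (hn : n ≠ 0)
    (k : ℕ) : quadSym (symL g s 0) (symL g s n) (symL g s (-n)) k =
      ((∑ j ∈ Finset.range (k + 1), ((k + 2).choose (j + 2) : ℝ) * s ^ (k - j) *
        ∑ l ∈ (Finset.range (j + 1)).filter (fun l => Even l),
          ((j + 1).choose (l + 1) : ℝ) * (|(n : ℝ)| ^ j * g n ^ (j - l)) : ℝ) : ℂ) := by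
  have hn' : (n : ℂ) ≠ 0 := by exact_mod_cast hn
  set A : ℂ := ((|(n : ℝ)| * g n : ℝ) : ℂ) with hA
  have e1 : symL g s n = A + n + s := by
    simp only [symL, symK, hA]
    push_cast
    ring
  have e2 : symL g s (-n) = A - n + s := by
    rw [symL, h.symK_neg]
    simp only [symK, hA]
    push_cast
    ring
  have h1 := quadSym_mul (symL g s 0) (symL g s n) (symL g s (-n)) k
  rw [symL_zero] at h1 ⊢
  rw [e1, e2] at h1 ⊢
  rw [add_sub_cancel_right, add_sub_cancel_right, powSum_eq, powSum_eq, add_sub_add_right_eq_sub,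
    add_sub_add_right_eq_sub, ← Finset.sum_sub_distrib,
    show A + n - (A - n) = 2 * n by ring] at h1
  refine mul_right_cancel₀ (mul_ne_zero two_ne_zero hn') (h1.trans ?_)
  push_cast
  rw [Finset.sum_mul]
  refine Finset.sum_congr rfl fun j _ => ?_
  rw [← mul_sub, add_pow_sub_sub_pow, mul_assoc _ _ (2 * (n : ℂ)), mul_comm (Finset.sum _ _)]
  congr 2
  refine Finset.sum_congr rfl fun l hl => ?_
  obtain ⟨hl1, hl2⟩ := Finset.mem_filter.1 hl
  have hl3 : l ≤ j := Nat.lt_succ_iff.1 (Finset.mem_range.1 hl1)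
  have h3 : (n : ℂ) ^ l = ((|(n : ℝ)| : ℝ) : ℂ) ^ l := by
    rw [← Complex.ofReal_pow, hl2.pow_abs]
    push_cast
    rfl
  have h4 : ((|(n : ℝ)| : ℝ) : ℂ) ^ j =
      ((|(n : ℝ)| : ℝ) : ℂ) ^ l * ((|(n : ℝ)| : ℝ) : ℂ) ^ (j - l) := by
    rw [← pow_add]
    congr 1
    omega
  rw [h3, hA, h4]
  push_cast
  ring

theorem cplx_mem_Sm {u : ℝ → ℝ} (hu : IsSmoothMeanZero u) : cplx u ∈ Sm := by
  refine ⟨Complex.ofRealCLM.contDiff.comp hu.1, fun x => ?_⟩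
  simp only [cplx, hu.2.1 x]

theorem coef_cplx_zero {u : ℝ → ℝ} (hu : ∫ x in (0 : ℝ)..(2 * π), u x = 0) :
    coef (cplx u) 0 = 0 := by
  have h := integral_eq_coef_zero (cplx u)
  simp only [cplx] at h
  rw [intervalIntegral.integral_ofReal, hu, Complex.ofReal_zero] at h
  exact (mul_eq_zero.1 h.symm).resolve_left two_pi_ne_zero

theorem coef_cplx_neg (u : ℝ → ℝ) (n : ℤ) :
    coef (cplx u) (-n) = (starRingEnd ℂ) (coef (cplx u) n) := by
  rw [coef_eq, coef_eq, map_mul, ← intervalIntegral.intervalIntegral_conj]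
  have h1 : (starRingEnd ℂ) (2 * π : ℂ)⁻¹ = (2 * π : ℂ)⁻¹ := by
    rw [map_inv₀, map_mul, Complex.conj_ofReal, map_ofNat]
  rw [h1]
  congr 2
  funext x
  simp only [cplx, map_mul, Complex.conj_ofReal, conj_chr]

theorem norm_fourierCoef_sq (f : ℝ → ℂ) (n : ℤ) :
    ‖fourierCoef f n‖ ^ 2 = 2 * π * ‖coef f n‖ ^ 2 := by
  rw [fourierCoef_eq, norm_mul, mul_pow, Complex.norm_real, Real.norm_eq_abs, sq_abs,
    Real.sq_sqrt Real.two_pi_pos.le]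

theorem coef_mul_coef_neg (u : ℝ → ℝ) (n : ℤ) :
    2 * π * (coef (cplx u) n * coef (cplx u) (-n)) =
      ((‖fourierCoef (cplx u) n‖ ^ 2 : ℝ) : ℂ) := by
  rw [coef_cplx_neg, Complex.mul_conj, norm_fourierCoef_sq, Complex.normSq_eq_norm_sq]
  push_cast
  ring

theorem summable_homG_smooth {g : ℤ → ℝ} {s : ℝ} (h : GoodSymbol g s) {u : ℝ → ℝ}
    (hu : IsSmoothMeanZero u) (m k : ℕ) :
    Summable fun n : ℤ => |(n : ℝ)| ^ k * g n ^ m * ‖fourierCoef (cplx u) n‖ ^ 2 := by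
  have hr := rapid_coef (cplx_mem_Sm hu)
  obtain ⟨B, hB⟩ := abs_pow_mul_norm_coef (cplx_mem_Sm hu) 0
  refine Summable.of_nonneg_of_le (fun n => by have := h.nonneg n; positivity) (fun n => ?_)
    ((hr k).mul_left (2 * π * B))
  have hB' := hB n
  simp only [pow_zero, one_mul] at hB'
  have h1 : |(n : ℝ)| ^ k ≤ wt n ^ k :=
    pow_le_pow_left₀ (abs_nonneg _) (by simp [wt]) k
  have h2 : g n ^ m ≤ 1 := pow_le_one₀ (h.nonneg n) (h.le_one n)
  have h3 : |(n : ℝ)| ^ k * g n ^ m ≤ wt n ^ k := by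
    have := pow_nonneg (h.nonneg n) m
    have := pow_nonneg (abs_nonneg (n : ℝ)) k
    nlinarith
  have hpi := Real.pi_pos
  rw [norm_fourierCoef_sq, id]
  calc |(n : ℝ)| ^ k * g n ^ m * (2 * π * ‖coef (cplx u) n‖ ^ 2)
      ≤ wt n ^ k * (2 * π * (B * ‖coef (cplx u) n‖)) := by
        refine mul_le_mul h3 ?_ (by positivity) (pow_nonneg (wt_pos n).le k)
        rw [pow_two]
        gcongr
    _ = _ := by ring

/-- The quadratic part of `∫ χ_{k+2}` for smooth real functions of mean zero. -/
theorem GoodSymbol.intS_quadU {g : ℤ → ℝ} {s : ℝ} (h : GoodSymbol g s) {u : ℝ → ℝ}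
    (hu : IsSmoothMeanZero u) (k : ℕ) :
    intS (PowerSeries.coeff (k + 2) (quadU (mulS h.polyGrowth) ⟨cplx u, cplx_mem_Sm hu⟩)) =
      ((4 * (-1) ^ (k + 1) * ∑ j ∈ Finset.range (k + 1),
        s ^ (k - j) * ((k + 2).choose (j + 2) : ℝ) * bCoef j * (1 / 2 * quadG g j u) : ℝ) : ℂ) := by
  rw [intS_eq]
  have h1 := (hasSum_quadU h.polyGrowth ⟨cplx u, cplx_mem_Sm hu⟩ k).mul_left (2 * π : ℂ)
  have h2 : HasSum (fun n : ℤ => 2 * (-1) ^ (k + 1) *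
      ∑ j ∈ Finset.range (k + 1), ((k + 2).choose (j + 2) : ℝ) * s ^ (k - j) *
        ∑ l ∈ (Finset.range (j + 1)).filter (fun l => Even l),
          ((j + 1).choose (l + 1) : ℝ) * (|(n : ℝ)| ^ j * g n ^ (j - l) *
            ‖fourierCoef (cplx u) n‖ ^ 2))
      (2 * (-1) ^ (k + 1) *
      ∑ j ∈ Finset.range (k + 1), ((k + 2).choose (j + 2) : ℝ) * s ^ (k - j) *
        ∑ l ∈ (Finset.range (j + 1)).filter (fun l => Even l),
          ((j + 1).choose (l + 1) : ℝ) * homG g (j - l) j u) := by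
    refine HasSum.mul_left _ (hasSum_sum fun j _ => HasSum.mul_left _ (hasSum_sum fun l _ =>
      HasSum.mul_left _ ?_))
    exact (summable_homG_smooth h hu (j - l) j).hasSum
  have h3 := Complex.hasSum_ofReal.2 h2
  refine (h1.unique (a₂ := ((2 * (-1) ^ (k + 1) *
      ∑ j ∈ Finset.range (k + 1), ((k + 2).choose (j + 2) : ℝ) * s ^ (k - j) *
        ∑ l ∈ (Finset.range (j + 1)).filter (fun l => Even l),
          ((j + 1).choose (l + 1) : ℝ) * homG g (j - l) j u : ℝ) : ℂ)) ?_).trans ?_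
  · convert! h3 using 1
    funext n
    rcases eq_or_ne n 0 with rfl | hn
    · have h0 : fourierCoef (cplx u) 0 = 0 := by
        rw [fourierCoef_eq, coef_cplx_zero hu.2.2, mul_zero]
      simp [h0, coef_cplx_zero hu.2.2]
    · have e1 := coef_mul_coef_neg u n
      rw [h.quadSym_eq hn]
      calc _ = 2 * (-1) ^ (k + 1) * ((∑ j ∈ Finset.range (k + 1),
            ((k + 2).choose (j + 2) : ℝ) * s ^ (k - j) *
            ∑ l ∈ (Finset.range (j + 1)).filter (fun l => Even l),
              ((j + 1).choose (l + 1) : ℝ) * (|(n : ℝ)| ^ j * g n ^ (j - l)) : ℝ) : ℂ) *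
            (2 * π * (coef (cplx u) n * coef (cplx u) (-n))) := by ring
        _ = _ := by
          rw [e1]
          push_cast
          rw [mul_assoc, Finset.sum_mul]
          congr 1
          refine Finset.sum_congr rfl fun j _ => ?_
          rw [mul_assoc, Finset.sum_mul]
          congr 1
          exact Finset.sum_congr rfl fun l _ => by ring
  · congr 1
    rw [show (4 : ℝ) * (-1) ^ (k + 1) = 2 * (-1) ^ (k + 1) * 2 by ring, mul_assoc _ (2 : ℝ),
      Finset.mul_sum (a := (2 : ℝ))]
    congr 1
    refine Finset.sum_congr rfl fun j _ => ?_
    simp only [quadG, ← bCoef_mul_aCoef j, mul_assoc, ← Finset.mul_sum]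
    ring

/-! ### The energies as polynomial functionals -/

section Algebraic
variable {E F : Type*} [AddCommGroup E] [Module ℂ E] [AddCommGroup F] [Module ℂ F]

/-- The recursive combination of the quantities `J n` that defines the energies; `s` stands for
`δ⁻¹`, or for `0` in the case of infinite depth. -/
def engC (s : ℂ) (J : ℕ → E) (k : ℕ) : E :=
  ((-1) ^ (k + 1) / (4 * bCoef k) : ℂ) • (J (k + 2) - (4 * (-1) ^ (k + 1) : ℂ) •
    ∑ j : Fin k, (s ^ (k - (j : ℕ)) * ((k + 2).choose ((j : ℕ) + 2) : ℂ) * bCoef j) •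
      engC s J j)
  termination_by k
  decreasing_by exact j.isLt

theorem map_engC (T : E →ₗ[ℂ] F) (s : ℂ) (J : ℕ → E) (k : ℕ) :
    T (engC s J k) = engC s (fun n => T (J n)) k := by
  induction k using Nat.strong_induction_on with
  | _ k ih =>
    rw [engC, engC]
    simp only [map_smul, map_sub, map_sum]
    congr 4
    funext j
    rw [ih j j.isLt]

theorem engC_zero (s : ℂ) (k : ℕ) : engC s (fun _ => (0 : E)) k = 0 := by
  simpa using (map_engC (0 : E →ₗ[ℂ] E) s (fun _ => 0) k).symm

/-- The recursion defining the energies inverts a triangular relation. -/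
theorem engC_eq (s : ℂ) {J X : ℕ → E} (h : ∀ k, J (k + 2) = (4 * (-1) ^ (k + 1) : ℂ) •
    ∑ j ∈ Finset.range (k + 1),
      (s ^ (k - j) * ((k + 2).choose (j + 2) : ℂ) * bCoef j) • X j) (k : ℕ) :
    engC s J k = X k := by
  induction k using Nat.strong_induction_on with
  | _ k ih =>
    have hb : (bCoef k : ℂ) ≠ 0 := Complex.ofReal_ne_zero.2 (bCoef_pos k).ne'
    have h1 : ∑ j : Fin k, (s ^ (k - (j : ℕ)) * ((k + 2).choose ((j : ℕ) + 2) : ℂ) * bCoef j) •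
        engC s J j = ∑ j ∈ Finset.range k,
          (s ^ (k - j) * ((k + 2).choose (j + 2) : ℂ) * bCoef j) • X j := by
      rw [Finset.sum_range]
      exact Finset.sum_congr rfl fun j _ => by rw [ih j j.isLt]
    rw [engC, h1, h k, ← smul_sub, Finset.sum_range_succ, add_sub_cancel_left, smul_smul,
      smul_smul]
    have h2 : ((-1 : ℂ) ^ (k + 1)) * (-1) ^ (k + 1) = 1 := by
      rw [← mul_pow]
      simp
    rw [Nat.sub_self, Nat.choose_self]
    convert! one_smul ℂ (X k) using 2
    field_simp
    simp only [Nat.cast_one, ← pow_two] at *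
    linear_combination h2

end Algebraic

/-- The energies of smooth functions, for a general symbol. -/
def smE (g : ℤ → ℝ) (s : ℝ) (k : ℕ) (u : ℝ → ℝ) : ℝ :=
  (engC (s : ℂ) (fun n => ∫ x in (0 : ℝ)..(2 * π), chi (opG g s) u n x) k).re

theorem re_engC (s : ℝ) (J : ℕ → ℂ) (k : ℕ) :
    (engC (s : ℂ) J k).re = (-1) ^ (k + 1) / (4 * bCoef k) * ((J (k + 2)).re -
      4 * (-1) ^ (k + 1) * ∑ j : Fin k, s ^ (k - (j : ℕ)) *
        ((k + 2).choose ((j : ℕ) + 2) : ℝ) * bCoef j * (engC (s : ℂ) J j).re) := by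
  have h1 : ((-1) ^ (k + 1) / (4 * bCoef k) : ℂ) = (((-1) ^ (k + 1) / (4 * bCoef k) : ℝ) : ℂ) := by
    push_cast
    rfl
  have h2 : (4 * (-1) ^ (k + 1) : ℂ) = ((4 * (-1) ^ (k + 1) : ℝ) : ℂ) := by
    push_cast
    rfl
  have h3 : ∀ j : Fin k, (s : ℂ) ^ (k - (j : ℕ)) * ((k + 2).choose ((j : ℕ) + 2) : ℂ) * bCoef j =
      ((s ^ (k - (j : ℕ)) * ((k + 2).choose ((j : ℕ) + 2) : ℝ) * bCoef j : ℝ) : ℂ) := by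
    intro j
    push_cast
    rfl
  rw [engC, h1, h2]
  simp only [h3, smul_eq_mul, Complex.re_ofReal_mul, Complex.sub_re, Complex.re_sum]

theorem smoothEnergyILW_eq (δ : ℝ) (k : ℕ) (u : ℝ → ℝ) :
    smoothEnergyILW δ k u = smE (gILW δ) δ⁻¹ k u := by
  induction k using Nat.strong_induction_on with
  | _ k ih =>
    rw [smoothEnergyILW, smE, re_engC, opILW_eq]
    congr 3
    refine Finset.sum_congr rfl fun j _ => ?_
    rw [ih j j.isLt, smE, inv_pow, one_div]

theorem smoothEnergyBO_eq (k : ℕ) (u : ℝ → ℝ) : smoothEnergyBO k u = smE 1 0 k u := by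
  rw [smoothEnergyBO, smE, re_engC, opBO_eq, Finset.sum_eq_zero, mul_zero, sub_zero]
  intro j _
  have : k - (j : ℕ) ≠ 0 := by have := j.isLt; omega
  rw [zero_pow this]
  ring

theorem val_absChi {ℓ : ℤ → ℂ} (hℓ : PolyGrowth ℓ) (U : Sm) (n : ℕ) :
    ((absChi (mulS hℓ) U n : Sm) : ℝ → ℂ) = chiF n ℓ (coef U) := by
  have h := map_absChi Sm.val (L := mulS hℓ) (L' := fourierMul ℓ) (fun f => rfl) U n
  have h2 : trigSum (coef U) id = U := trigSum_coef U.2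
  rw [chiF, h2]
  exact h

theorem GoodSymbol.val_absChi_eq_chi {g : ℤ → ℝ} {s : ℝ} (h : GoodSymbol g s) {u : ℝ → ℝ}
    (hu : IsSmoothMeanZero u) (n : ℕ) :
    ((absChi (mulS h.polyGrowth) ⟨cplx u, cplx_mem_Sm hu⟩ n : Sm) : ℝ → ℂ) =
      chi (opG g s) u n := by
  rw [chi_eq_absChi]
  exact map_absChi Sm.val (L := mulS h.polyGrowth) (L' := opG g s)
    (fun f => (h.opG_eq f.2).symm) ⟨cplx u, cplx_mem_Sm hu⟩ n

/-- The density of the energy as a function of the symbol and of the Fourier coefficients. -/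
def engF (k : ℕ) (ℓ a : ℤ → ℂ) : ℝ → ℂ := engC (ℓ 0) (fun n => chiF n ℓ a) k

theorem isPoly_engF (k : ℕ) : IsPoly (k + 2) (engF k) := by
  induction k using Nat.strong_induction_on with
  | _ k ih =>
    have h1 : IsPoly (k + 2) fun ℓ a => ∑ j : Fin k,
        (ℓ 0 ^ (k - (j : ℕ)) * ((k + 2).choose ((j : ℕ) + 2) : ℂ) * bCoef j) • engF j ℓ a := by
      refine IsPoly.sum _ fun j _ => ((ih j j.isLt).of_le (by omega)).smul
        (c := fun ℓ => ℓ 0 ^ (k - (j : ℕ)) * ((k + 2).choose ((j : ℕ) + 2) : ℂ) * bCoef j)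
        (by fun_prop) fun C =>
        ⟨(C * wt 0) ^ (k - (j : ℕ)) * ‖((k + 2).choose ((j : ℕ) + 2) : ℂ)‖ * ‖(bCoef j : ℂ)‖,
          fun ℓ hℓ => ?_⟩
      rw [norm_mul, norm_mul, norm_pow]
      have h2 : ‖ℓ 0‖ ^ (k - (j : ℕ)) ≤ (C * wt 0) ^ (k - (j : ℕ)) :=
        pow_le_pow_left₀ (norm_nonneg _) (hℓ 0) _
      exact mul_le_mul_of_nonneg_right (mul_le_mul_of_nonneg_right h2 (norm_nonneg _))
        (norm_nonneg _)
    refine (((isPoly_chiF (k + 2)).add (h1.const_smul (-(4 * (-1) ^ (k + 1)))) fun _ _ _ _ _ =>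
      rfl).const_smul ((-1) ^ (k + 1) / (4 * bCoef k) : ℂ)).congr fun C ℓ a _ _ => ?_
    rw [engF, engC, sub_eq_add_neg, ← neg_smul]
    rfl

/-- The symbols of the homogeneous parts of the energy density. -/
def symE (k : ℕ) : (d : ℕ) → (ℤ → ℂ) → (Fin d → ℤ) → ℂ := (isPoly_engF k).exists_symb.choose

theorem isSymb_symE {k d : ℕ} (h : d ≤ k + 2) : IsSymb (k + 2) d (symE k d) :=
  (isPoly_engF k).exists_symb.choose_spec.1 d h

theorem engF_eq (k : ℕ) {C : ℝ} {ℓ a : ℤ → ℂ} (hℓ : LinBound C ℓ) (ha : Rapid a) :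
    engF k ℓ a = ∑ d ∈ Finset.range (k + 2 + 1), monoFun (symE k d ℓ) a :=
  (isPoly_engF k).exists_symb.choose_spec.2 C ℓ a hℓ ha

/-- The integral of the energy density, computed in the algebra `Sm`. -/
def engS {ℓ : ℤ → ℂ} (hℓ : PolyGrowth ℓ) (k : ℕ) (U : Sm) : ℂ :=
  intS (engC (ℓ 0) (absChi (mulS hℓ) U) k)

theorem engS_eq_formSum {ℓ : ℤ → ℂ} {C : ℝ} (hℓ : LinBound C ℓ) (k : ℕ) (U : Sm) :
    engS hℓ.polyGrowth k U =
      ∑ d ∈ Finset.range (k + 2 + 1), 2 * π * formSum (symE k d ℓ) (coef U) := by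
  have hr := rapid_coef U.2
  have h1 : ((engC (ℓ 0) (absChi (mulS hℓ.polyGrowth) U) k : Sm) : ℝ → ℂ) =
      ∑ d ∈ Finset.range (k + 2 + 1), monoFun (symE k d ℓ) (coef U) := by
    rw [← engF_eq k hℓ hr, engF]
    have := map_engC Sm.val.toLinearMap (ℓ 0) (absChi (mulS hℓ.polyGrowth) U) k
    refine this.trans ?_
    congr 1
    funext n
    exact val_absChi hℓ.polyGrowth U n
  have h2 : engS hℓ.polyGrowth k U =
      ∫ x in (0 : ℝ)..(2 * π), ∑ d ∈ Finset.range (k + 2 + 1), monoFun (symE k d ℓ) (coef U) x := by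
    change ∫ x in (0 : ℝ)..(2 * π),
      ((engC (ℓ 0) (absChi (mulS hℓ.polyGrowth) U) k : Sm) : ℝ → ℂ) x = _
    rw [h1]
    simp only [Finset.sum_apply]
  have hb : ∀ d ∈ Finset.range (k + 2 + 1), PolyBd (symE k d ℓ) := fun d hd =>
    (isSymb_symE (Nat.lt_succ_iff.1 (Finset.mem_range.1 hd))).polyBd hℓ
  rw [h2, intervalIntegral.integral_finsetSum fun d hd =>
    (monoFun_mem_Sm (hb d hd) hr).1.continuous.intervalIntegrable _ _]
  exact Finset.sum_congr rfl fun d hd => integral_monoFun (hb d hd) hr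

theorem formSum_smul {d : ℕ} (m : (Fin d → ℤ) → ℂ) (c : ℂ) (a : ℤ → ℂ) :
    formSum m (fun n => c * a n) = c ^ d * formSum m a := by
  rw [formSum, formSum, ← tsum_mul_left]
  refine tsum_congr fun ν => ?_
  split_ifs
  · rw [Finset.prod_mul_distrib, Finset.prod_const, Finset.card_univ, Fintype.card_fin]
    ring
  · rw [mul_zero]

/-- Each homogeneous part of the energy can be read off from the expansion along the line
through the origin. -/
theorem two_pi_mul_formSum_symE {ℓ : ℤ → ℂ} {C : ℝ} (hℓ : LinBound C ℓ) (k : ℕ) (U : Sm) {d : ℕ}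
    (hd : d ≤ k + 2) : 2 * π * formSum (symE k d ℓ) (coef U) =
      engC (ℓ 0) (fun n => intS (PowerSeries.coeff n
        (hat (coeffL d) (scaledU (mulS hℓ.polyGrowth) U)))) k := by
  set L := mulS hℓ.polyGrowth
  set p : Polynomial Sm :=
    engC (ℓ 0) (absChi (polyMap L) (Polynomial.X * Polynomial.C U)) k with hp
  have h1 : ∀ c : ℂ, intS (evalAt c p) = engS hℓ.polyGrowth k (c • U) := by
    intro c
    have := map_engC (evalAt c).toLinearMap (ℓ 0)
      (absChi (polyMap L) (Polynomial.X * Polynomial.C U)) k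
    rw [engS]
    congr 1
    refine this.trans ?_
    congr 1
    funext n
    have h2 := absChi_line L 0 U n c
    rwa [Polynomial.C_0, zero_add, zero_add] at h2
  have h2 : ∑ i ∈ Finset.range (p.natDegree + 1), Polynomial.monomial i (intS (p.coeff i)) =
      ∑ i ∈ Finset.range (k + 2 + 1),
        Polynomial.monomial i (2 * π * formSum (symE k i ℓ) (coef U)) := by
    refine Polynomial.funext fun c => ?_
    have h3 := h1 c
    have hc : coef ((c • U : Sm) : ℝ → ℂ) = fun n => c * coef U n := by
      funext n
      exact coef_smulS c U n
    rw [evalAt_apply, map_sum, engS_eq_formSum hℓ, hc] at h3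
    simp only [Polynomial.eval_finsetSum, Polynomial.eval_monomial]
    simp only [map_smul, smul_eq_mul, formSum_smul] at h3
    rw [Finset.sum_congr rfl fun i _ => mul_comm (intS (p.coeff i)) (c ^ i), h3]
    exact Finset.sum_congr rfl fun i _ => by ring
  have h4 := congrArg (fun q => Polynomial.coeff q d) h2
  simp only [Polynomial.finsetSum_coeff, Polynomial.coeff_monomial, Finset.sum_ite_eq',
    Finset.mem_range] at h4
  rw [if_pos (Nat.lt_succ_of_le hd)] at h4
  have h5 : intS (p.coeff d) = 2 * π * formSum (symE k d ℓ) (coef U) := by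
    rw [← h4]
    split_ifs with h
    · rfl
    · rw [Polynomial.coeff_eq_zero_of_natDegree_lt (by omega), map_zero]
  rw [← h5, hp]
  have h6 := map_engC (intS ∘ₗ coeffL d) (ℓ 0)
    (absChi (polyMap L) (Polynomial.X * Polynomial.C U)) k
  refine h6.trans ?_
  congr 1
  funext n
  rw [coeff_hat, scaledU, coeff_genU]
  rfl

/-- On the hyperplane `ν = 0` a linear form only sees the mean value of `u`. -/
theorem formSum_degree_one {m : (Fin 1 → ℤ) → ℂ} {a : ℤ → ℂ} (ha : a 0 = 0) :
    formSum m a = 0 := by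
  rw [formSum]
  convert! tsum_zero with ν
  split_ifs with h
  · simp only [Fin.sum_univ_one, Fin.prod_univ_one] at h ⊢
    rw [h, ha, mul_zero]
  · rfl

theorem GoodSymbol.smE_eq_engS {g : ℤ → ℝ} {s : ℝ} (h : GoodSymbol g s) (k : ℕ) {u : ℝ → ℝ}
    (hu : IsSmoothMeanZero u) :
    smE g s k u = (engS h.polyGrowth k ⟨cplx u, cplx_mem_Sm hu⟩).re := by
  rw [smE, engS, map_engC, symL_zero]
  congr 2
  funext n
  rw [← h.val_absChi_eq_chi hu n]
  rfl

/-- The energy of a smooth function is the sum of its quadratic part and of multilinear forms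
of degrees `3, …, k + 2`. -/
theorem GoodSymbol.smE_eq {g : ℤ → ℝ} {s : ℝ} (h : GoodSymbol g s) (k : ℕ) {u : ℝ → ℝ}
    (hu : IsSmoothMeanZero u) : smE g s k u = 1 / 2 * quadG g k u +
      ∑ d ∈ Finset.Icc 3 (k + 2), (2 * π * formSum (symE k d (symL g s)) (coef (cplx u))).re := by
  set U : Sm := ⟨cplx u, cplx_mem_Sm hu⟩ with hU
  have hℓ := h.linBound (le_refl s)
  have hq : engC ((symL g s) 0) (fun n => intS (PowerSeries.coeff n
      (hat (coeffL 2) (scaledU (mulS hℓ.polyGrowth) U)))) k = ((1 / 2 * quadG g k u : ℝ) : ℂ) := by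
    rw [symL_zero]
    refine engC_eq (s : ℂ) (X := fun k => ((1 / 2 * quadG g k u : ℝ) : ℂ)) (fun k => ?_) k
    refine (h.intS_quadU hu k).trans ?_
    simp only [smul_eq_mul]
    push_cast
    ring
  have hz : engC ((symL g s) 0) (fun n => intS (PowerSeries.coeff n
      (hat (coeffL 0) (scaledU (mulS hℓ.polyGrowth) U)))) k = 0 := by
    obtain ⟨V, hV, _⟩ := exists_scaledU_eq (mulS hℓ.polyGrowth) U
    convert! engC_zero (E := ℂ) ((symL g s) 0) k using 2
    funext n
    rw [coeff_hat, hV, PowerSeries.coeff_C_mul, coeffL_apply, Polynomial.coeff_X_mul_zero,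
      map_zero]
  have hr : Finset.range (k + 2 + 1) = insert 0 (insert 1 (insert 2 (Finset.Icc 3 (k + 2)))) := by
    ext i
    simp only [Finset.mem_range, Finset.mem_insert, Finset.mem_Icc]
    omega
  rw [h.smE_eq_engS k hu, engS_eq_formSum hℓ, hr, Finset.sum_insert (by simp),
    Finset.sum_insert (by simp), Finset.sum_insert (by simp),
    formSum_degree_one (coef_cplx_zero hu.2.2),
    two_pi_mul_formSum_symE hℓ k U (Nat.zero_le _), hz,
    two_pi_mul_formSum_symE hℓ k U (by omega : 2 ≤ k + 2), hq]
  simp only [mul_zero, zero_add, Complex.add_re, Complex.ofReal_re, Complex.re_sum]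

/-! ### Diagonal quadratic forms on `ℓ²` -/

/-- The diagonal quadratic form with coefficients `w`. -/
def wForm (w : ℤ → ℝ) (x : L2) : ℝ := ∑' n, w n * ‖x n‖ ^ 2

theorem summable_wForm {w : ℤ → ℝ} (h0 : ∀ n, 0 ≤ w n) (h1 : ∀ n, w n ≤ 1) (x : L2) :
    Summable fun n => w n * ‖x n‖ ^ 2 :=
  Summable.of_nonneg_of_le (fun n => mul_nonneg (h0 n) (sq_nonneg _))
    (fun n => mul_le_of_le_one_left (sq_nonneg _) (h1 n)) (L2_hasSum x).summable

theorem continuous_wForm {w : ℤ → ℝ} (h0 : ∀ n, 0 ≤ w n) (h1 : ∀ n, w n ≤ 1) :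
    Continuous (wForm w) := by
  have hsq : ∀ (x : L2) (n : ℤ), ‖((√(w n) : ℝ) : ℂ) * x n‖ ^ 2 = w n * ‖x n‖ ^ 2 := by
    intro x n
    rw [norm_mul, mul_pow, Complex.norm_real, Real.norm_eq_abs, sq_abs, Real.sq_sqrt (h0 n)]
  have hmem : ∀ x : L2, Memℓp (fun n => ((√(w n) : ℝ) : ℂ) * x n) 2 := by
    intro x
    refine memℓp_gen ((summable_wForm h0 h1 x).congr fun n => ?_)
    have h2 : (ENNReal.toReal 2) = ((2 : ℕ) : ℝ) := by simp
    rw [h2, Real.rpow_natCast, hsq]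
  let D : L2 →ₗ[ℝ] L2 :=
    { toFun := fun x => ⟨fun n => ((√(w n) : ℝ) : ℂ) * x n, hmem x⟩
      map_add' := fun x y => by
        ext n
        exact mul_add _ _ _
      map_smul' := fun c x => by
        ext n
        exact mul_left_comm _ _ _ }
  have hD : ∀ x, ‖D x‖ ^ 2 = wForm w x := by
    intro x
    rw [← (L2_hasSum (D x)).tsum_eq]
    exact tsum_congr fun n => hsq x n
  have hc : Continuous D := by
    refine AddMonoidHomClass.continuous_of_bound D 1 fun x => ?_
    rw [one_mul, ← abs_of_nonneg (norm_nonneg (D x)), ← abs_of_nonneg (norm_nonneg x),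
      ← sq_le_sq, hD, ← (L2_hasSum x).tsum_eq]
    exact (summable_wForm h0 h1 x).tsum_le_tsum
      (fun n => mul_le_of_le_one_left (sq_nonneg _) (h1 n)) (L2_hasSum x).summable
  exact (hc.norm.pow 2).congr hD

theorem tendsto_wForm {α : Type*} {l : Filter α} {w : α → ℤ → ℝ} {w₀ : ℤ → ℝ}
    (h : ∀ᶠ p in l, ∀ n, 0 ≤ w p n ∧ w p n ≤ 1) {x : L2}
    (hlim : ∀ n, x n ≠ 0 → Tendsto (fun p => w p n) l (𝓝 (w₀ n))) :
    Tendsto (fun p => wForm (w p) x) l (𝓝 (wForm w₀ x)) := by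
  refine tendsto_tsum_of_dominated_convergence (L2_hasSum x).summable (fun n => ?_) ?_
  · by_cases hn : x n = 0
    · simpa [hn] using tendsto_const_nhds
    · exact (hlim n hn).mul_const _
  · filter_upwards [h] with p hp n
    rw [Real.norm_of_nonneg (mul_nonneg (hp n).1 (sq_nonneg _))]
    exact mul_le_of_le_one_left (sq_nonneg _) (hp n).2

/-- The coefficients of the quadratic form `homG`, relative to the Sobolev weight. -/
def homW (g : ℤ → ℝ) (m k : ℕ) (n : ℤ) : ℝ := |(n : ℝ)| ^ k * g n ^ m / rho k n ^ 2

theorem abs_pow_le_rho_sq (k : ℕ) (n : ℤ) : |(n : ℝ)| ^ k ≤ rho k n ^ 2 := by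
  rw [rho_sq]
  have h1 : |(n : ℝ)| ^ k = (|(n : ℝ)| ^ (2 : ℕ)) ^ ((k : ℝ) / 2) := by
    rw [← Real.rpow_natCast, ← Real.rpow_natCast, ← Real.rpow_mul (abs_nonneg _)]
    congr 1
    push_cast
    ring
  rw [h1, sq_abs]
  exact Real.rpow_le_rpow (sq_nonneg _) (by linarith) (by positivity)

theorem homW_bounds {g : ℤ → ℝ} (hg : ∀ n, 0 ≤ g n ∧ g n ≤ 1) (m k : ℕ) (n : ℤ) :
    0 ≤ homW g m k n ∧ homW g m k n ≤ 1 := by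
  have h0 := pow_nonneg (hg n).1 m
  have h1 := pow_le_one₀ (n := m) (hg n).1 (hg n).2
  have h2 : 0 < rho k n ^ 2 := pow_pos (rho_pos k n) 2
  have h3 : 0 ≤ |(n : ℝ)| ^ k := by positivity
  refine ⟨div_nonneg (mul_nonneg h3 h0) h2.le, (div_le_one h2).2 ?_⟩
  exact (mul_le_of_le_one_right h3 h1).trans (abs_pow_le_rho_sq k n)

theorem homG_eq_wForm (g : ℤ → ℝ) (m k : ℕ) (u : sobolevZero ((k : ℝ) / 2)) :
    homG g m k u = wForm (homW g m k) (embL k u) := by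
  refine tsum_congr fun n => ?_
  have := (rho_pos k n).ne'
  rw [homW, embL_apply, norm_mul, mul_pow, Complex.norm_real, Real.norm_eq_abs, sq_abs]
  field_simp

/-- The quadratic part of twice the energy on `ℓ²`. -/
def quadL (g : ℤ → ℝ) (k : ℕ) (x : L2) : ℝ :=
  ∑ l ∈ (Finset.range (k + 1)).filter (fun l => Even l),
    aCoef k l * wForm (homW g (k - l) k) x

theorem quadG_eq_quadL (g : ℤ → ℝ) (k : ℕ) (u : sobolevZero ((k : ℝ) / 2)) :
    quadG g k u = quadL g k (embL k u) := by
  simp only [quadG, quadL, homG_eq_wForm]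

theorem continuous_quadL {g : ℤ → ℝ} (hg : ∀ n, 0 ≤ g n ∧ g n ≤ 1) (k : ℕ) :
    Continuous (quadL g k) :=
  continuous_finsetSum _ fun _ _ => continuous_const.mul
    (continuous_wForm (fun n => (homW_bounds hg _ k n).1) fun n => (homW_bounds hg _ k n).2)

theorem homSq_eq (k : ℕ) (u : ℝ → ℝ) : homSq k u = quadG 1 k u := by
  have h : ∀ m, homG 1 m k u = homSq k u := by
    intro m
    simp [homG, homSq]
  simp only [quadG, h, ← Finset.sum_mul, sum_aCoef, one_mul]

theorem quadILW_eq {δ : ℝ} (hδ : 0 < δ) (k : ℕ) (u : ℝ → ℝ) :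
    quadILW δ k u = quadG (gILW δ) k u := by
  simp only [quadILW, quadG, homSqG, homG, norm_symG hδ]

theorem quadILW_le_homSq {δ : ℝ} (hδ : 0 < δ) (k : ℕ) (u : sobolevZero ((k : ℝ) / 2)) :
    quadILW δ k u ≤ homSq k u := by
  have h1 := fun m => homW_bounds (gILW_bounds hδ) m k
  have h2 := fun m => homW_bounds (g := 1) (fun n => ⟨zero_le_one, le_rfl⟩) m k
  rw [quadILW_eq hδ, homSq_eq]
  refine Finset.sum_le_sum fun l hl => mul_le_mul_of_nonneg_left ?_ (aCoef_pos
    (Nat.lt_succ_iff.1 (Finset.mem_range.1 (Finset.mem_filter.1 hl).1))).le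
  rw [homG_eq_wForm, homG_eq_wForm]
  refine (summable_wForm (fun n => (h1 _ n).1) (fun n => (h1 _ n).2) _).tsum_le_tsum (fun n => ?_)
    (summable_wForm (fun n => (h2 _ n).1) (fun n => (h2 _ n).2) _)
  refine mul_le_mul_of_nonneg_right ?_ (sq_nonneg _)
  have := rho_pos k n
  have h3 : gILW δ n ^ (k - l) ≤ (1 : ℤ → ℝ) n ^ (k - l) :=
    pow_le_pow_left₀ (gILW_bounds hδ n).1 (gILW_bounds hδ n).2 _
  rw [homW, homW]
  gcongr

theorem exists_le_quadILW (k : ℕ) {δ₀ : ℝ} (hδ₀ : 0 < δ₀) : ∃ c : ℝ, 0 < c ∧ ∀ δ : ℝ, δ₀ ≤ δ →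
    ∀ u : sobolevZero ((k : ℝ) / 2), c * homSq k u ≤ quadILW δ k u := by
  obtain ⟨c, hc0, hc1, hc⟩ := exists_le_lang hδ₀
  refine ⟨c ^ k, pow_pos hc0 k, fun δ hδ u => ?_⟩
  have hδ' := hδ₀.trans_le hδ
  have h1 := fun m => homW_bounds (gILW_bounds hδ') m k
  have h2 := fun m => homW_bounds (g := 1) (fun n => ⟨zero_le_one, le_rfl⟩) m k
  rw [quadILW_eq hδ', homSq_eq, quadG, quadG, Finset.mul_sum]
  refine Finset.sum_le_sum fun l hl => ?_
  rw [mul_left_comm]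
  refine mul_le_mul_of_nonneg_left ?_ (aCoef_pos
    (Nat.lt_succ_iff.1 (Finset.mem_range.1 (Finset.mem_filter.1 hl).1))).le
  rw [homG_eq_wForm, homG_eq_wForm, wForm, ← tsum_mul_left]
  refine ((summable_wForm (fun n => (h2 _ n).1) (fun n => (h2 _ n).2) _).mul_left
    (c ^ k)).tsum_le_tsum (fun n => ?_)
    (summable_wForm (fun n => (h1 _ n).1) (fun n => (h1 _ n).2) _)
  rw [← mul_assoc]
  refine mul_le_mul_of_nonneg_right ?_ (sq_nonneg _)
  rcases eq_or_ne n 0 with rfl | hn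
  · rcases Nat.eq_zero_or_pos k with rfl | hk
    · simp [homW]
    · simp [homW, hk.ne']
  have hn1 : (1 : ℝ) ≤ |(n : ℝ)| := by exact_mod_cast Int.one_le_abs hn
  have h3 : c ≤ gILW δ n := hc _ (by nlinarith)
  have h4 : c ^ k ≤ gILW δ n ^ (k - l) :=
    (pow_le_pow_of_le_one hc0.le hc1 (Nat.sub_le k l)).trans (pow_le_pow_left₀ hc0.le h3 _)
  have := rho_pos k n
  rw [homW, homW, Pi.one_apply, one_pow, mul_one, ← mul_div_assoc, mul_comm (c ^ k)]
  gcongr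

/-! ### The energies on `ℓ²` -/

/-- The symbols `symE`, normalized for the use with `fourierCoef`. -/
def symN (k d : ℕ) (ℓ : ℤ → ℂ) (ν : Fin d → ℤ) : ℂ :=
  (2 * π / ((√(2 * π) : ℝ) : ℂ) ^ d) * symE k d ℓ ν

theorem isSymb_symN {k d : ℕ} (h : d ≤ k + 2) : IsSymb (k + 2) d (symN k d) :=
  (isSymb_symE h).smul continuous_const fun _ => ⟨_, fun _ _ => le_rfl⟩

theorem symN_bound {k d : ℕ} (h : d ≤ k + 2) {C : ℝ} {ℓ : ℤ → ℂ} (hℓ : LinBound C ℓ) :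
    ∃ K : ℝ, ∀ ν, ‖symN k d ℓ ν‖ ≤ K * sz ν ^ (k + 2 - d) := by
  obtain ⟨K, _, hK⟩ := (isSymb_symN h).bound C
  exact ⟨K, hK ℓ hℓ⟩

/-- The energy as a functional on `ℓ²`. -/
def engL (g : ℤ → ℝ) (s : ℝ) (k : ℕ) (x : L2) : ℝ := 1 / 2 * quadL g k x +
  ∑ d ∈ Finset.Icc 3 (k + 2), (∑' ν, termL k (symN k d (symL g s)) ν fun _ => x).re

theorem GoodSymbol.continuous_engL {g : ℤ → ℝ} {s : ℝ} (h : GoodSymbol g s) (k : ℕ) :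
    Continuous (engL g s k) := by
  refine (continuous_const.mul (continuous_quadL (fun n => ⟨h.nonneg n, h.le_one n⟩) k)).add
    (continuous_finsetSum _ fun d hd => Complex.continuous_re.comp ?_)
  obtain ⟨h1, h2⟩ := Finset.mem_Icc.1 hd
  exact (continuous_formL k h1 h2 (symN_bound h2 (h.linBound le_rfl))).comp
    (continuous_pi fun _ => continuous_id)

theorem tsum_termL_embL (k d : ℕ) (ℓ : ℤ → ℂ) (u : sobolevZero ((k : ℝ) / 2)) :
    ∑' ν, termL k (symN k d ℓ) ν (fun _ => embL k u) =
      2 * π * formSum (symE k d ℓ) (coef (cplx u)) := by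
  rw [formSum, ← tsum_mul_left]
  refine tsum_congr fun ν => ?_
  rw [termL_apply]
  split_ifs
  · simp only [coordL_embL, fourierCoef_eq, Finset.prod_mul_distrib, Finset.prod_const,
      Finset.card_univ, Fintype.card_fin, symN]
    have := sqrt_two_pi_ne_zero
    field_simp
  · rw [mul_zero]

theorem GoodSymbol.smE_eq_engL {g : ℤ → ℝ} {s : ℝ} (h : GoodSymbol g s) (k : ℕ)
    {u : sobolevZero ((k : ℝ) / 2)} (hu : IsSmoothMeanZero u) :
    smE g s k u = engL g s k (embL k u) := by
  rw [h.smE_eq k hu, quadG_eq_quadL, engL]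
  simp only [tsum_termL_embL]

/-- Dominated convergence. The coordinate at frequency `0` has to vanish, since `gILW δ 0 = 0`
does not converge to `1`. -/
theorem tendsto_engL (k : ℕ) {x : L2} (hx : x 0 = 0) :
    Tendsto (fun δ => engL (gILW δ) δ⁻¹ k x) atTop (𝓝 (engL 1 0 k x)) := by
  refine Tendsto.add (Tendsto.const_mul _ ?_) ?_
  · refine tendsto_finsetSum _ fun l _ => Tendsto.const_mul _ (tendsto_wForm ?_ fun n hn => ?_)
    · filter_upwards [eventually_gt_atTop 0] with δ hδ
      exact homW_bounds (gILW_bounds hδ) _ k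
    · have hn0 : n ≠ 0 := by
        rintro rfl
        exact hn hx
      exact (((tendsto_gILW hn0).pow _).const_mul _).div_const _
  · refine tendsto_finsetSum _ fun d hd => (Complex.continuous_re.tendsto _).comp ?_
    obtain ⟨h1, h2⟩ := Finset.mem_Icc.1 hd
    obtain ⟨K, _, hK⟩ := (isSymb_symN h2).bound (2 + 1)
    refine tendsto_formL k h1 h2 (K := K) ?_ (fun ν => ?_) _
    · filter_upwards [eventually_ge_atTop 1] with δ hδ
      exact hK _ ((goodSymbol_ILW (zero_lt_one.trans_le hδ)).linBound (inv_le_one_of_one_le₀ hδ))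
    · exact (((isSymb_symN h2).cont ν).tendsto _).comp tendsto_symL

/-! ### Extension of the energies to Sobolev spaces -/

theorem mem_sobolevZero_of_smooth {u : ℝ → ℝ} (hu : IsSmoothMeanZero u) (k : ℕ) :
    u ∈ sobolevZero ((k : ℝ) / 2) := by
  refine ⟨hu.2.1, ?_, hu.2.2, ?_⟩
  · obtain ⟨B, hB⟩ := isCompact_Icc.exists_bound_of_continuousOn
      (s := Set.Icc 0 (2 * π)) hu.1.continuous.continuousOn
    refine MemLp.of_bound hu.1.continuous.aestronglyMeasurable B ?_
    filter_upwards [ae_restrict_mem measurableSet_Ioc] with x hx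
    exact hB x ⟨hx.1.le, hx.2⟩
  · obtain ⟨B, hB⟩ := abs_pow_mul_norm_coef (cplx_mem_Sm hu) 0
    refine Summable.of_nonneg_of_le (fun n => by positivity) (fun n => ?_)
      ((rapid_coef (cplx_mem_Sm hu) k).mul_left (2 * π * B))
    have hB' := hB n
    simp only [pow_zero, one_mul] at hB'
    have h1 : (1 + (n : ℝ) ^ 2) ^ ((k : ℝ) / 2) ≤ wt n ^ k := by
      have : wt n ^ k = (wt n ^ (2 : ℕ)) ^ ((k : ℝ) / 2) := by
        rw [← Real.rpow_natCast, ← Real.rpow_natCast, ← Real.rpow_mul (wt_pos n).le]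
        congr 1
        push_cast
        ring
      rw [this]
      refine Real.rpow_le_rpow (by positivity) ?_ (by positivity)
      have := sq_abs (n : ℝ)
      simp only [wt]
      nlinarith [abs_nonneg (n : ℝ)]
    have hpi := Real.pi_pos
    rw [norm_fourierCoef_sq, id]
    calc (1 + (n : ℝ) ^ 2) ^ ((k : ℝ) / 2) * (2 * π * ‖coef (cplx u) n‖ ^ 2)
        ≤ wt n ^ k * (2 * π * (B * ‖coef (cplx u) n‖)) := by
          refine mul_le_mul h1 ?_ (by positivity) (pow_nonneg (wt_pos n).le k)
          rw [pow_two]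
          gcongr
      _ = _ := by ring

theorem mem_smoothNear_iff {s : ℝ} {u : ℝ → ℝ} {A : Set (ℝ → ℝ)} :
    A ∈ smoothNear s u ↔
      ∃ ε > 0, ∀ v, IsSmoothMeanZero v → sobolevNorm s (v - u) < ε → v ∈ A := by
  rw [smoothNear, mem_inf_principal, mem_comap]
  have h0 : ∀ v : ℝ → ℝ, 0 ≤ sobolevNorm s v := fun v => Real.sqrt_nonneg _
  constructor
  · rintro ⟨t, ht, hA⟩
    obtain ⟨ε, hε, hεt⟩ := Metric.mem_nhds_iff.1 ht
    refine ⟨ε, hε, fun v hv hvu => hA (show v ∈ _ from hεt ?_) hv⟩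
    rwa [Metric.mem_ball, Real.dist_eq, sub_zero, abs_of_nonneg (h0 _)]
  · rintro ⟨ε, hε, h⟩
    refine ⟨Metric.ball 0 ε, Metric.ball_mem_nhds 0 hε, fun v hv hvs => h v hvs ?_⟩
    rwa [Set.mem_preimage, Metric.mem_ball, Real.dist_eq, sub_zero, abs_of_nonneg (h0 _)] at hv

/-- A functional on smooth functions that is given by a continuous functional on `ℓ²` extends
continuously. -/
theorem tendsto_smoothNear {k : ℕ} {E : (ℝ → ℝ) → ℝ} {G : L2 → ℝ} (hG : Continuous G)
    (hE : ∀ v : sobolevZero ((k : ℝ) / 2), IsSmoothMeanZero v → E v = G (embL k v))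
    (u : sobolevZero ((k : ℝ) / 2)) :
    Tendsto E (smoothNear ((k : ℝ) / 2) u) (𝓝 (G (embL k u))) := by
  rw [Metric.tendsto_nhds]
  intro ε hε
  obtain ⟨η, hη, h⟩ := Metric.continuous_iff.1 hG (embL k u) ε hε
  refine mem_smoothNear_iff.2 ⟨η, hη, fun v hv hvu => ?_⟩
  have hvm := mem_sobolevZero_of_smooth hv k
  rw [Set.mem_ofPred_eq, hE ⟨v, hvm⟩ hv]
  refine h _ ?_
  rw [dist_eq_norm, ← map_sub, norm_embL]
  exact hvu

/-- The real trigonometric polynomial obtained by truncating the Fourier series. -/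
def truncF (u : ℝ → ℝ) (N : ℕ) (x : ℝ) : ℝ :=
  (∑ n ∈ Finset.Icc (-N : ℤ) N, coef (cplx u) n * chr n x).re

theorem cplx_truncF (u : ℝ → ℝ) (N : ℕ) : cplx (truncF u N) =
    trigSum (fun n : ℤ => if n ∈ Finset.Icc (-N : ℤ) N then coef (cplx u) n else 0) id := by
  funext x
  have h1 : trigSum (fun n : ℤ => if n ∈ Finset.Icc (-N : ℤ) N then coef (cplx u) n else 0) id x =
      ∑ n ∈ Finset.Icc (-N : ℤ) N, coef (cplx u) n * chr n x := by
    rw [trigSum, tsum_eq_sum (s := Finset.Icc (-N : ℤ) N)]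
    · exact Finset.sum_congr rfl fun n hn => by rw [if_pos hn, id]
    · intro n hn
      rw [if_neg hn, zero_mul]
  rw [h1, cplx, truncF, ← Complex.conj_eq_iff_re, map_sum]
  refine Finset.sum_nbij' (fun n => -n) (fun n => -n) ?_ ?_ ?_ ?_ ?_
  · intro n hn
    simp only [Finset.mem_Icc] at hn ⊢
    omega
  · intro n hn
    simp only [Finset.mem_Icc] at hn ⊢
    omega
  · simp
  · simp
  · intro n _
    rw [map_mul, coef_cplx_neg, conj_chr]

theorem rapid_indicator (a : ℤ → ℂ) (s : Finset ℤ) : Rapid fun n => if n ∈ s then a n else 0 := by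
  intro N
  refine summable_of_ne_finset_zero (s := s) fun n hn => ?_
  simp [hn]

theorem coef_truncF (u : ℝ → ℝ) (N : ℕ) (n : ℤ) :
    coef (cplx (truncF u N)) n = if n ∈ Finset.Icc (-N : ℤ) N then coef (cplx u) n else 0 := by
  rw [cplx_truncF, coef_trigSum_id (rapid_indicator _ _)]

theorem isSmoothMeanZero_truncF {u : ℝ → ℝ} (hu : ∫ x in (0 : ℝ)..(2 * π), u x = 0) (N : ℕ) :
    IsSmoothMeanZero (truncF u N) := by
  have hm : cplx (truncF u N) ∈ Sm := by
    rw [cplx_truncF]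
    exact trigSum_mem_Sm (rapid_indicator _ _)
  refine ⟨?_, fun x => ?_, ?_⟩
  · have h : ContDiff ℝ ∞ (Complex.reCLM ∘ cplx (truncF u N)) := Complex.reCLM.contDiff.comp hm.1
    exact h
  · exact Complex.ofReal_injective (hm.2 x)
  · have h := integral_eq_coef_zero (cplx (truncF u N))
    rw [coef_truncF, coef_cplx_zero hu, ite_self, mul_zero] at h
    simp only [cplx] at h
    rw [intervalIntegral.integral_ofReal] at h
    exact_mod_cast h

/-- Smooth functions are dense, by truncation of Fourier series. -/
theorem smoothNear_neBot (k : ℕ) (u : sobolevZero ((k : ℝ) / 2)) :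
    (smoothNear ((k : ℝ) / 2) u).NeBot := by
  refine forall_mem_nonempty_iff_neBot.1 fun A hA => ?_
  obtain ⟨ε, hε, h⟩ := mem_smoothNear_iff.1 hA
  have hu := u.2.2.2.2
  have hs := hu.hasSum
  -- the truncation error is a tail of the convergent series for the norm
  have hlim : Tendsto (fun N : ℕ => sobolevNorm ((k : ℝ) / 2) (truncF u N - u)) atTop (𝓝 0) := by
    have hc : ∀ (N : ℕ) (n : ℤ), ‖fourierCoef (cplx (truncF u N - u)) n‖ ^ 2 =
        if n ∈ Finset.Icc (-N : ℤ) N then 0 else ‖fourierCoef (cplx u) n‖ ^ 2 := by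
      intro N n
      have hsm := mem_sobolevZero_of_smooth (isSmoothMeanZero_truncF u.2.2.2.1 N) k
      have h1 : fourierCoef (cplx (truncF u N - u)) n =
          fourierCoef (cplx (truncF u N)) n - fourierCoef (cplx u) n := by
        have := fourierCoef_add (intervalIntegrable_of_memLp hsm.2.1)
          (intervalIntegrable_of_memLp (((sobolevZero ((k : ℝ) / 2)).smul_mem (-1) u.2).2.1)) n
        rw [fourierCoef_smul] at this
        rw [sub_eq_add_neg, ← neg_one_smul ℝ (u : ℝ → ℝ), this]
        push_cast
        ring
      rw [h1, fourierCoef_eq, fourierCoef_eq, coef_truncF]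
      split_ifs <;> simp
    have h0 : ∑' n : ℤ, (0 : ℝ) = 0 := tsum_zero
    have := tendsto_tsum_of_dominated_convergence (𝓕 := atTop) (f := fun (N : ℕ) (n : ℤ) =>
      (1 + (n : ℝ) ^ 2) ^ ((k : ℝ) / 2) * ‖fourierCoef (cplx (truncF u N - u)) n‖ ^ 2)
      (g := fun _ => 0) hu (fun n => ?_) (Eventually.of_forall fun N n => ?_)
    · rw [h0] at this
      have h2 := (Real.continuous_sqrt.tendsto 0).comp this
      rwa [Real.sqrt_zero] at h2
    · refine tendsto_const_nhds.congr' ?_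
      filter_upwards [eventually_ge_atTop n.natAbs] with N hN
      rw [hc, if_pos (by rw [Finset.mem_Icc]; omega), mul_zero]
    · have : 0 ≤ (1 + (n : ℝ) ^ 2) ^ ((k : ℝ) / 2) := by positivity
      rw [hc, Real.norm_of_nonneg (by split_ifs <;> positivity)]
      split_ifs
      · rw [mul_zero]
        positivity
      · exact le_rfl
  obtain ⟨N, hN⟩ := (hlim.eventually (gt_mem_nhds hε)).exists
  exact ⟨_, h _ (isSmoothMeanZero_truncF u.2.2.2.1 N) hN⟩

theorem GoodSymbol.tendsto_smE {g : ℤ → ℝ} {s : ℝ} (h : GoodSymbol g s) (k : ℕ)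
    (u : sobolevZero ((k : ℝ) / 2)) :
    Tendsto (smE g s k) (smoothNear ((k : ℝ) / 2) u) (𝓝 (engL g s k (embL k u))) :=
  tendsto_smoothNear (h.continuous_engL k) (fun _ hv => h.smE_eq_engL k hv) u

theorem energyILW_eq {δ : ℝ} (hδ : 0 < δ) (k : ℕ) (u : sobolevZero ((k : ℝ) / 2)) :
    energyILW δ k u = engL (gILW δ) δ⁻¹ k (embL k u) := by
  have := smoothNear_neBot k u
  have h := (goodSymbol_ILW hδ).tendsto_smE k u
  rw [← funext (smoothEnergyILW_eq δ k)] at h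
  exact h.limUnder_eq

theorem energyBO_eq (k : ℕ) (u : sobolevZero ((k : ℝ) / 2)) :
    energyBO k u = engL 1 0 k (embL k u) := by
  have := smoothNear_neBot k u
  have h := goodSymbol_BO.tendsto_smE k u
  rw [← funext (smoothEnergyBO_eq k)] at h
  exact h.limUnder_eq

/-- The continuous extension restricts to the original functional on smooth functions. -/
theorem energyILW_eq_smooth {δ : ℝ} (hδ : 0 < δ) (k : ℕ) {u : ℝ → ℝ} (hu : IsSmoothMeanZero u) :
    energyILW δ k u = smoothEnergyILW δ k u := by
  rw [smoothEnergyILW_eq]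
  exact (energyILW_eq hδ k ⟨u, mem_sobolevZero_of_smooth hu k⟩).trans
    ((goodSymbol_ILW hδ).smE_eq_engL k (u := ⟨u, mem_sobolevZero_of_smooth hu k⟩) hu).symm

theorem energyBO_eq_smooth (k : ℕ) {u : ℝ → ℝ} (hu : IsSmoothMeanZero u) :
    energyBO k u = smoothEnergyBO k u := by
  rw [smoothEnergyBO_eq]
  exact (energyBO_eq k ⟨u, mem_sobolevZero_of_smooth hu k⟩).trans
    (goodSymbol_BO.smE_eq_engL k (u := ⟨u, mem_sobolevZero_of_smooth hu k⟩) hu).symm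

theorem GoodSymbol.isCubicAndHigher {g : ℤ → ℝ} {s : ℝ} (h : GoodSymbol g s) (k : ℕ)
    {R : (ℝ → ℝ) → ℝ} (hR : ∀ u : sobolevZero ((k : ℝ) / 2),
      R u = engL g s k (embL k u) - 1 / 2 * quadL g k (embL k u)) :
    IsCubicAndHigher ((k : ℝ) / 2) (k + 2) R := by
  have hm : ∀ d, d ≤ k + 2 → ∃ K : ℝ, ∀ ν, ‖symN k d (symL g s) ν‖ ≤ K * sz ν ^ (k + 2 - d) :=
    fun d hd => symN_bound hd (h.linBound le_rfl)
  refine ⟨fun d => if hd : 3 ≤ d ∧ d ≤ k + 2 then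
    Complex.reLm.compMultilinearMap
      ((formL k hd.1 hd.2 (hm d hd.2)).compLinearMap fun _ => embL k) else 0, fun d => ?_,
    fun u => ?_⟩
  · by_cases hd : 3 ≤ d ∧ d ≤ k + 2
    · obtain ⟨B, hB⟩ := norm_formL_le k hd.1 hd.2 (hm d hd.2)
      refine ⟨B, fun v => ?_⟩
      simp only [dif_pos hd]
      refine (Complex.abs_re_le_norm _).trans ((hB fun i => embL k (v i)).trans_eq ?_)
      simp only [norm_embL]
    · refine ⟨0, fun v => ?_⟩
      simp [dif_neg hd]
  · rw [hR, engL, add_sub_cancel_left]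
    refine Finset.sum_congr rfl fun d hd => ?_
    simp only [dif_pos (Finset.mem_Icc.1 hd)]
    rfl

theorem embL_zero_coord (k : ℕ) (u : sobolevZero ((k : ℝ) / 2)) : embL k u 0 = 0 := by
  rw [embL_apply, fourierCoef_eq, coef_cplx_zero u.2.2.2.1, mul_zero, mul_zero]

/-! ### Derivatives of the energies along curves -/

/-- Rapid decrease, uniform in a parameter `t ∈ S`. -/
def UnifRapid (S : Set ℝ) (a : ℝ → ℤ → ℂ) : Prop :=
  ∀ N : ℕ, ∃ C : ℝ, 0 ≤ C ∧ ∀ t ∈ S, ∀ n, wt n ^ N * ‖a t n‖ ≤ C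

theorem UnifRapid.rapid {S : Set ℝ} {a : ℝ → ℤ → ℂ} (h : UnifRapid S a) {t : ℝ} (ht : t ∈ S) :
    Rapid (a t) :=
  rapid_of_pow_bound fun N => by
    obtain ⟨C, _, hC⟩ := h N
    exact ⟨C, hC t ht⟩

/-- The derivative of `formSum m` at `a` in the direction `b`. -/
def formDeriv {d : ℕ} (m : (Fin d → ℤ) → ℂ) (a b : ℤ → ℂ) : ℂ :=
  ∑' ν : Fin d → ℤ, if ∑ i, ν i = 0 then
    m ν * ∑ i, (∏ j ∈ Finset.univ.erase i, a (ν j)) • b (ν i) else 0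

/-- Termwise differentiation along a curve of rapidly decreasing sequences. -/
theorem hasDerivAt_formSum {d : ℕ} {m : (Fin d → ℤ) → ℂ} (hm : PolyBd m) {S : Set ℝ}
    (hS : IsOpen S) (hS' : IsPreconnected S) {a a' : ℝ → ℤ → ℂ}
    (h : ∀ t ∈ S, ∀ n, HasDerivAt (fun τ => a τ n) (a' t n) t)
    (ha : UnifRapid S a) (ha' : UnifRapid S a') {t : ℝ} (ht : t ∈ S) :
    HasDerivAt (fun τ => formSum m (a τ)) (formDeriv m (a t) (a' t)) t := by
  have hsum : Summable fun ν : Fin d → ℤ =>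
      if ∑ i, ν i = 0 then m ν * ∏ i, a t (ν i) else 0 := by
    refine Summable.of_norm_bounded (rapidOn_mono hm (ha.rapid ht)).summable fun ν => ?_
    split_ifs
    · exact le_rfl
    · rw [norm_zero]
      exact norm_nonneg _
  obtain ⟨K, M, hK⟩ := hm
  -- `M` powers absorb the growth of the symbol, the other two make the sum over `ν` converge
  obtain ⟨C₁, h1, hC₁⟩ := ha (M + 2)
  obtain ⟨C₂, h2, hC₂⟩ := ha' (M + 2)
  set C := max C₁ C₂ with hC
  have hC0 : 0 ≤ C := h1.trans (le_max_left _ _)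
  have hK0 : 0 ≤ K := by
    have := (norm_nonneg _).trans (hK 0)
    exact nonneg_of_mul_nonneg_left this (pow_pos (sz_pos _) M)
  have key : ∀ (n : ℤ) (z : ℂ), wt n ^ (M + 2) * ‖z‖ ≤ C → ‖z‖ ≤ (wt n ^ M)⁻¹ *
      (C * (wt n ^ 2)⁻¹) := by
    intro n z hz
    have hw := wt_pos n
    rw [← div_eq_mul_inv C, ← div_eq_inv_mul, div_div, le_div_iff₀ (by positivity)]
    calc _ = wt n ^ (M + 2) * ‖z‖ := by ring
      _ ≤ C := hz
  have hb1 : ∀ τ ∈ S, ∀ n, ‖a τ n‖ ≤ (wt n ^ M)⁻¹ * (C * (wt n ^ 2)⁻¹) := fun τ hτ n =>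
    key n _ ((hC₁ τ hτ n).trans (le_max_left _ _))
  have hb2 : ∀ τ ∈ S, ∀ n, ‖a' τ n‖ ≤ (wt n ^ M)⁻¹ * (C * (wt n ^ 2)⁻¹) := fun τ hτ n =>
    key n _ ((hC₂ τ hτ n).trans (le_max_right _ _))
  have hs := ((hasSum_pi_prod (d := d) (b := fun _ n => C * (wt n ^ 2)⁻¹)
    (fun i n => by have := wt_pos n; positivity)
    (fun i => summable_wt_inv_sq.mul_left C)).summable).mul_left (K * d)
  refine hasDerivAt_tsum_of_isPreconnected (g := fun (ν : Fin d → ℤ) (τ : ℝ) =>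
      if ∑ i, ν i = 0 then m ν * ∏ i, a τ (ν i) else 0)
    (g' := fun (ν : Fin d → ℤ) (τ : ℝ) => if ∑ i, ν i = 0 then
      m ν * ∑ i, (∏ j ∈ Finset.univ.erase i, a τ (ν j)) • a' τ (ν i) else 0)
    hs hS hS' (fun ν τ hτ => ?_) (fun ν τ hτ => ?_) ht hsum ht
  · split_ifs
    · exact (HasDerivAt.fun_finsetProd fun i _ => h τ hτ (ν i)).const_mul _
    · exact hasDerivAt_const _ _
  · have hp : 0 ≤ ∏ i, C * (wt (ν i) ^ 2)⁻¹ :=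
      Finset.prod_nonneg fun i _ => by have := wt_pos (ν i); positivity
    have hsz := sz_pos ν
    split_ifs
    swap
    · rw [norm_zero]
      positivity
    have hterm : ∀ i ∈ Finset.univ, ‖(∏ j ∈ Finset.univ.erase i, a τ (ν j)) • a' τ (ν i)‖ ≤
        (sz ν ^ M)⁻¹ * ∏ i, C * (wt (ν i) ^ 2)⁻¹ := by
      intro i hi
      have e1 : ‖(∏ j ∈ Finset.univ.erase i, a τ (ν j)) • a' τ (ν i)‖ ≤
          ∏ j, ((wt (ν j) ^ M)⁻¹ * (C * (wt (ν j) ^ 2)⁻¹)) := by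
        rw [norm_smul, norm_prod, ← Finset.prod_erase_mul _ _ hi]
        refine mul_le_mul (Finset.prod_le_prod (fun _ _ => norm_nonneg _) fun j _ =>
          hb1 τ hτ _) (hb2 τ hτ _) (norm_nonneg _) (Finset.prod_nonneg fun j _ => ?_)
        have := wt_pos (ν j)
        positivity
      refine e1.trans ?_
      rw [Finset.prod_mul_distrib]
      refine mul_le_mul_of_nonneg_right ?_ hp
      rw [Finset.prod_inv_distrib, Finset.prod_pow]
      exact inv_anti₀ (pow_pos hsz M) (pow_le_pow_left₀ hsz.le (sz_le_prod ν) M)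
    have h3 := (norm_sum_le _ _).trans (Finset.sum_le_card_nsmul _ _ _ hterm)
    rw [Finset.card_univ, Fintype.card_fin, nsmul_eq_mul] at h3
    rw [norm_mul]
    calc _ ≤ (K * sz ν ^ M) * (d * ((sz ν ^ M)⁻¹ * ∏ i, C * (wt (ν i) ^ 2)⁻¹)) :=
          mul_le_mul (hK ν) h3 (norm_nonneg _) (by positivity)
      _ = _ := by
          have := (pow_pos hsz M).ne'
          field_simp

theorem unifRapid_line {a b : ℤ → ℂ} (ha : Rapid a) (hb : Rapid b) :
    UnifRapid (Metric.ball 0 1) fun t n => a n + (t : ℂ) * b n := by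
  intro N
  refine ⟨∑' n, wt n ^ N * ‖a n‖ + ∑' n, wt n ^ N * ‖b n‖, ?_, fun t ht n => ?_⟩
  · exact add_nonneg
      (tsum_nonneg fun n => mul_nonneg (pow_nonneg (wt_pos n).le N) (norm_nonneg _))
      (tsum_nonneg fun n => mul_nonneg (pow_nonneg (wt_pos n).le N) (norm_nonneg _))
  · have hw := pow_pos (wt_pos n) N
    have h1 := (ha N).le_tsum n fun j _ => mul_nonneg (pow_nonneg (wt_pos j).le N) (norm_nonneg _)
    have h2 := (hb N).le_tsum n fun j _ => mul_nonneg (pow_nonneg (wt_pos j).le N) (norm_nonneg _)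
    have ht' : ‖(t : ℂ)‖ ≤ 1 := by
      rw [Complex.norm_real]
      simpa using (mem_ball_zero_iff.1 ht).le
    have h3 : ‖a n + (t : ℂ) * b n‖ ≤ ‖a n‖ + ‖b n‖ := by
      refine (norm_add_le _ _).trans (add_le_add_right ?_ _)
      rw [norm_mul]
      exact mul_le_of_le_one_left (norm_nonneg _) ht'
    calc _ ≤ wt n ^ N * (‖a n‖ + ‖b n‖) := mul_le_mul_of_nonneg_left h3 hw.le
      _ = wt n ^ N * ‖a n‖ + wt n ^ N * ‖b n‖ := mul_add _ _ _
      _ ≤ _ := add_le_add h1 h2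

theorem unifRapid_const {S : Set ℝ} {b : ℤ → ℂ} (hb : Rapid b) : UnifRapid S fun _ => b := by
  intro N
  have h0 : ∀ n, 0 ≤ wt n ^ N * ‖b n‖ := fun n =>
    mul_nonneg (pow_nonneg (wt_pos n).le N) (norm_nonneg _)
  exact ⟨∑' n, wt n ^ N * ‖b n‖, tsum_nonneg h0, fun t _ n => (hb N).le_tsum n fun j _ => h0 j⟩

/-- The derivative of the energy vanishes in the direction of the flow. Since it depends on the
curve only through its velocity, it is computed along a straight line, where the energy is a
polynomial whose linear coefficient is known to vanish. -/
theorem SymbolIdentities.sum_formDeriv_eq_zero {ℓ : ℤ → ℂ} (h : SymbolIdentities ℓ) {C : ℝ}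
    (hℓ : LinBound C ℓ) (s : ℂ) {U V : Sm}
    (hV : V = mulS hℓ.polyGrowth (dxS U) + Complex.I • dxS (dxS U) - s • dxS U + 2 * U * dxS U)
    (k : ℕ) :
    ∑ d ∈ Finset.range (k + 2 + 1), 2 * π * formDeriv (symE k d ℓ) (coef U) (coef V) = 0 := by
  set L := mulS hℓ.polyGrowth with hL
  set p : Polynomial Sm := engC (ℓ 0)
    (absChi (polyMap L) (Polynomial.C U + Polynomial.X * Polynomial.C V)) k with hp
  have hline : ∀ c : ℝ, ∑ d ∈ Finset.range (k + 2 + 1),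
      2 * π * formSum (symE k d ℓ) (fun n => coef U n + (c : ℂ) * coef V n) =
      ∑ i ∈ Finset.range (p.natDegree + 1), (c : ℂ) ^ i * intS (p.coeff i) := by
    intro c
    have h1 := engS_eq_formSum hℓ k (U + (c : ℂ) • V)
    have h2 : coef ((U + (c : ℂ) • V : Sm) : ℝ → ℂ) = fun n => coef U n + (c : ℂ) * coef V n := by
      funext n
      rw [coef_addS, coef_smulS]
    have h3 : engS hℓ.polyGrowth k (U + (c : ℂ) • V) = intS (evalAt (c : ℂ) p) := by
      have := map_engC (evalAt (c : ℂ)).toLinearMap (ℓ 0)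
        (absChi (polyMap L) (Polynomial.C U + Polynomial.X * Polynomial.C V)) k
      rw [engS]
      congr 1
      refine Eq.trans ?_ this.symm
      congr 1
      funext n
      exact (absChi_line L U V n c).symm
    rw [← h2, ← h1, h3, evalAt_apply, map_sum]
    simp only [map_smul, smul_eq_mul]
  have h0 : intS (p.coeff 1) = 0 := by
    have h6 := map_engC (intS ∘ₗ coeffL 1) (ℓ 0)
      (absChi (polyMap L) (Polynomial.C U + Polynomial.X * Polynomial.C V)) k
    refine h6.trans ((congrArg (fun J => engC (ℓ 0) J k) (funext fun n => ?_)).trans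
      (engC_zero (ℓ 0) k))
    exact (h.isDispersive hℓ.polyGrowth).coeff_one_eq_zero s hV n
  have hd1 : HasDerivAt (fun c : ℝ => ∑ d ∈ Finset.range (k + 2 + 1),
      2 * π * formSum (symE k d ℓ) (fun n => coef U n + (c : ℂ) * coef V n))
      (∑ d ∈ Finset.range (k + 2 + 1), 2 * π * formDeriv (symE k d ℓ) (coef U) (coef V)) 0 := by
    refine HasDerivAt.fun_sum fun d hd => HasDerivAt.const_mul _ ?_
    have hm := (isSymb_symE (Nat.lt_succ_iff.1 (Finset.mem_range.1 hd))).polyBd hℓ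
    have := hasDerivAt_formSum hm Metric.isOpen_ball
      (convex_ball (0 : ℝ) 1).isPreconnected (a := fun t n => coef U n + (t : ℂ) * coef V n)
      (a' := fun _ => coef V) (fun t _ n => ?_) (unifRapid_line (rapid_coef U.2) (rapid_coef V.2))
      (unifRapid_const (rapid_coef V.2)) (Metric.mem_ball_self one_pos)
    · simpa using this
    · simpa using (((hasDerivAt_id t).ofReal_comp).mul_const (coef V n)).const_add (coef U n)
  have hd2 : HasDerivAt (fun c : ℝ =>
      ∑ i ∈ Finset.range (p.natDegree + 1), (c : ℂ) ^ i * intS (p.coeff i)) 0 0 := by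
    have hi : ∀ i ∈ Finset.range (p.natDegree + 1),
        HasDerivAt (fun c : ℝ => (c : ℂ) ^ i * intS (p.coeff i)) 0 0 := by
      intro i _
      have h7 := (((hasDerivAt_id (0 : ℝ)).ofReal_comp).fun_pow i).mul_const (intS (p.coeff i))
      convert! h7 using 1
      match i with
      | 0 => simp
      | 1 => simp [h0]
      | i + 2 => simp
    simpa using HasDerivAt.fun_sum hi
  rw [← funext hline] at hd2
  exact hd1.unique hd2

/-! ### Smooth functions of time and space -/

/-- Functions of `(t, x)`, `t ∈ I`, that are jointly smooth and `2π`-periodic in `x`. -/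
structure IsSpaceTime (I : Set ℝ) (f : ℝ × ℝ → ℂ) : Prop where
  smooth : ContDiffOn ℝ ∞ f (I ×ˢ Set.univ)
  periodic : ∀ t ∈ I, ∀ x, f (t, x + 2 * π) = f (t, x)

/-- The partial derivative in space. -/
def dX (f : ℝ × ℝ → ℂ) (p : ℝ × ℝ) : ℂ := fderiv ℝ f p (0, 1)

/-- The partial derivative in time. -/
def dT (f : ℝ × ℝ → ℂ) (p : ℝ × ℝ) : ℂ := fderiv ℝ f p (1, 0)

namespace IsSpaceTime

variable {I : Set ℝ} {f : ℝ × ℝ → ℂ}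

theorem hasFDerivAt (h : IsSpaceTime I f) (hI : IsOpen I) {t : ℝ} (ht : t ∈ I) (x : ℝ) :
    HasFDerivAt f (fderiv ℝ f (t, x)) (t, x) :=
  ((h.smooth.contDiffAt ((hI.prod isOpen_univ).mem_nhds ⟨ht, trivial⟩)).differentiableAt
    (by simp)).hasFDerivAt

theorem hasDerivAt_space (h : IsSpaceTime I f) (hI : IsOpen I) {t : ℝ} (ht : t ∈ I) (x : ℝ) :
    HasDerivAt (fun y => f (t, y)) (dX f (t, x)) x :=
  (h.hasFDerivAt hI ht x).comp_hasDerivAt x ((hasDerivAt_const x t).prodMk (hasDerivAt_id x))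

theorem hasDerivAt_time (h : IsSpaceTime I f) (hI : IsOpen I) {t : ℝ} (ht : t ∈ I) (x : ℝ) :
    HasDerivAt (fun τ => f (τ, x)) (dT f (t, x)) t :=
  (h.hasFDerivAt hI ht x).comp_hasDerivAt t ((hasDerivAt_id t).prodMk (hasDerivAt_const t x))

theorem mem_Sm (h : IsSpaceTime I f) {t : ℝ} (ht : t ∈ I) : (fun x => f (t, x)) ∈ Sm := by
  refine ⟨?_, h.periodic t ht⟩
  have h1 : ContDiff ℝ ∞ fun x : ℝ => (t, x) := contDiff_prodMk_right t
  rw [← contDiffOn_univ] at h1 ⊢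
  exact h.smooth.comp h1 fun x _ => ⟨ht, trivial⟩

theorem dX (h : IsSpaceTime I f) (hI : IsOpen I) : IsSpaceTime I (ILW.dX f) := by
  refine ⟨?_, fun t ht x => ?_⟩
  · exact (h.smooth.fderiv_of_isOpen (hI.prod isOpen_univ) (by simp)).clm_apply contDiffOn_const
  · have h1 := (h.hasDerivAt_space hI ht (x + 2 * π)).comp_add_const x (2 * π)
    simp only [h.periodic t ht] at h1
    exact h1.unique (h.hasDerivAt_space hI ht x)

theorem dT (h : IsSpaceTime I f) (hI : IsOpen I) : IsSpaceTime I (ILW.dT f) := by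
  refine ⟨?_, fun t ht x => ?_⟩
  · exact (h.smooth.fderiv_of_isOpen (hI.prod isOpen_univ) (by simp)).clm_apply contDiffOn_const
  · have h1 := h.hasDerivAt_time hI ht (x + 2 * π)
    refine h1.unique ((h.hasDerivAt_time hI ht x).congr_of_eventuallyEq ?_)
    filter_upwards [hI.mem_nhds ht] with τ hτ
    exact h.periodic τ hτ x

theorem exists_bound (h : IsSpaceTime I f) {K : Set ℝ} (hK : IsCompact K) (hKI : K ⊆ I) :
    ∃ C, 0 ≤ C ∧ ∀ t ∈ K, ∀ x ∈ Set.Icc 0 (2 * π), ‖f (t, x)‖ ≤ C := by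
  obtain ⟨C, hC⟩ := (hK.prod (isCompact_Icc (a := 0) (b := 2 * π))).exists_bound_of_continuousOn
    (h.smooth.continuousOn.mono (Set.prod_mono hKI (Set.subset_univ _)))
  exact ⟨max C 0, le_max_right _ _, fun t ht x hx => (hC (t, x) ⟨ht, hx⟩).trans (le_max_left _ _)⟩

/-- Repeated integration by parts in `x`, with bounds uniform for `t` in a compact set. -/
theorem unifRapid (h : IsSpaceTime I f) (hI : IsOpen I) {K : Set ℝ} (hK : IsCompact K)
    (hKI : K ⊆ I) : UnifRapid K fun t => coef fun x => f (t, x) := by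
  have key : ∀ (N : ℕ) (f : ℝ × ℝ → ℂ), IsSpaceTime I f → ∃ C, 0 ≤ C ∧ ∀ t ∈ K, ∀ n : ℤ,
      |(n : ℝ)| ^ N * ‖coef (fun x => f (t, x)) n‖ ≤ C := by
    intro N
    induction N with
    | zero =>
      intro f h
      obtain ⟨C, hC0, hC⟩ := h.exists_bound hK hKI
      refine ⟨C, hC0, fun t ht n => ?_⟩
      rw [pow_zero, one_mul]
      exact norm_coef_le (hC t ht) n
    | succ N ih =>
      intro f h
      obtain ⟨C, hC0, hC⟩ := ih _ (h.dX hI)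
      refine ⟨C, hC0, fun t ht n => ?_⟩
      have ht' := hKI ht
      have h1 := coef_of_hasDerivAt (h.hasDerivAt_space hI ht')
        ((h.dX hI).mem_Sm ht').1.continuous (h.periodic t ht') n
      have h2 := hC t ht n
      rw [h1, norm_mul, norm_mul, Complex.norm_I, one_mul, Complex.norm_intCast] at h2
      rw [pow_succ, mul_assoc]
      exact h2
  intro N
  obtain ⟨C, hC0, hC⟩ := key N f h
  obtain ⟨D, hD0, hD⟩ := key 0 f h
  refine ⟨2 ^ N * (D + C), by positivity, fun t ht n => ?_⟩
  have h1 := hC t ht n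
  have h2 := hD t ht n
  rw [pow_zero, one_mul] at h2
  calc _ ≤ 2 ^ N * (1 + |(n : ℝ)| ^ N) * ‖coef (fun x => f (t, x)) n‖ :=
        mul_le_mul_of_nonneg_right (wt_pow_le n N) (norm_nonneg _)
    _ = 2 ^ N * (‖coef (fun x => f (t, x)) n‖ +
          |(n : ℝ)| ^ N * ‖coef (fun x => f (t, x)) n‖) := by ring
    _ ≤ _ := by gcongr

theorem hasDerivAt_coef (h : IsSpaceTime I f) (hI : IsOpen I) {t : ℝ} (ht : t ∈ I) (n : ℤ) :
    HasDerivAt (fun τ => coef (fun x => f (τ, x)) n) (coef (fun x => ILW.dT f (t, x)) n) t := by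
  obtain ⟨r, hr, hrI⟩ := Metric.nhds_basis_closedBall.mem_iff.1 (hI.mem_nhds ht)
  obtain ⟨C, _, hC⟩ := (h.dT hI).exists_bound (isCompact_closedBall t r) hrI
  have hc : ∀ {f : ℝ × ℝ → ℂ}, IsSpaceTime I f → ∀ τ ∈ I,
      Continuous fun x => f (τ, x) * chr (-n) x := fun h τ hτ =>
    (h.mem_Sm hτ).1.continuous.mul (continuous_chr _)
  simp only [coef_eq]
  refine HasDerivAt.const_mul _ ?_
  refine (intervalIntegral.hasDerivAt_integral_of_dominated_loc_of_deriv_le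
    (F := fun τ x => f (τ, x) * chr (-n) x) (F' := fun τ x => ILW.dT f (τ, x) * chr (-n) x)
    (bound := fun _ => C) (Metric.closedBall_mem_nhds t hr) ?_
    ((hc h t ht).intervalIntegrable _ _) (hc (h.dT hI) t ht).aestronglyMeasurable ?_
    intervalIntegrable_const ?_).2
  · filter_upwards [hI.mem_nhds ht] with τ hτ
    exact (hc h τ hτ).aestronglyMeasurable
  · refine Eventually.of_forall fun x hx τ hτ => ?_
    rw [Set.uIoc_of_le Real.two_pi_pos.le] at hx
    rw [norm_mul, norm_chr, mul_one]
    exact hC τ hτ x ⟨hx.1.le, hx.2⟩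
  · exact Eventually.of_forall fun x _ τ hτ => (h.hasDerivAt_time hI (hrI hτ) x).mul_const _

theorem hasDerivAt_sum_formSum (h : IsSpaceTime I f) (hI : IsOpen I) {t : ℝ} (ht : t ∈ I)
    {s : Finset ℕ} {m : (d : ℕ) → (Fin d → ℤ) → ℂ} (hm : ∀ d ∈ s, PolyBd (m d)) :
    HasDerivAt (fun τ => ∑ d ∈ s, 2 * π * formSum (m d) (coef fun x => f (τ, x)))
      (∑ d ∈ s, 2 * π *
        formDeriv (m d) (coef fun x => f (t, x)) (coef fun x => ILW.dT f (t, x))) t := by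
  obtain ⟨r, hr, hrI⟩ := Metric.nhds_basis_closedBall.mem_iff.1 (hI.mem_nhds ht)
  have hsub : Metric.ball t r ⊆ Metric.closedBall t r := Metric.ball_subset_closedBall
  have hur : ∀ {f : ℝ × ℝ → ℂ}, IsSpaceTime I f →
      UnifRapid (Metric.ball t r) fun t => coef fun x => f (t, x) := by
    intro f hf N
    obtain ⟨C, hC0, hC⟩ := hf.unifRapid hI (isCompact_closedBall t r) hrI N
    exact ⟨C, hC0, fun τ hτ => hC τ (hsub hτ)⟩
  refine HasDerivAt.fun_sum fun d hd => HasDerivAt.const_mul _ ?_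
  exact hasDerivAt_formSum (hm d hd) Metric.isOpen_ball (convex_ball t r).isPreconnected
    (a := fun t => coef fun x => f (t, x)) (a' := fun t => coef fun x => ILW.dT f (t, x))
    (fun τ hτ n => h.hasDerivAt_coef hI (hrI (hsub hτ)) n) (hur h) (hur (h.dT hI))
    (Metric.mem_ball_self hr)

end IsSpaceTime

/-! ### Conservation of the energies -/

theorem GoodSymbol.smE_eq_formSum {g : ℤ → ℝ} {s : ℝ} (h : GoodSymbol g s) (k : ℕ) {u : ℝ → ℝ}
    (hu : IsSmoothMeanZero u) : smE g s k u = (∑ d ∈ Finset.range (k + 2 + 1),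
      2 * π * formSum (symE k d (symL g s)) (coef (cplx u))).re := by
  rw [h.smE_eq_engS k hu, engS_eq_formSum (h.linBound le_rfl)]

theorem IsSmoothSolution.isSpaceTime {σ : ℤ → ℂ} {I : Set ℝ} {u : ℝ → ℝ → ℝ}
    (hu : IsSmoothSolution σ I u) : IsSpaceTime I fun p => (u p.1 p.2 : ℂ) := by
  refine ⟨Complex.ofRealCLM.contDiff.comp_contDiffOn hu.1, fun t ht x => ?_⟩
  exact congrArg _ ((hu.2.1 t ht).1 x)

theorem IsSmoothSolution.isSmoothMeanZero {σ : ℤ → ℂ} {I : Set ℝ} {u : ℝ → ℝ → ℝ}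
    (hu : IsSmoothSolution σ I u) {t : ℝ} (ht : t ∈ I) : IsSmoothMeanZero (u t) :=
  ⟨Complex.reCLM.contDiff.comp (hu.isSpaceTime.mem_Sm ht).1, hu.2.1 t ht⟩

/-- The equation as an identity in `Sm`. -/
theorem GoodSymbol.flow_eq {g : ℤ → ℝ} {s : ℝ} (h : GoodSymbol g s) {I : Set ℝ} (hI : IsOpen I)
    {u : ℝ → ℝ → ℝ} (hu : IsSmoothSolution (symS g) I u) {t : ℝ} (ht : t ∈ I) {U V : Sm}
    (hU : (U : ℝ → ℂ) = cplx (u t))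
    (hV : (V : ℝ → ℂ) = fun x => dT (fun p => (u p.1 p.2 : ℂ)) (t, x)) :
    V = mulS h.polyGrowth (dxS U) + Complex.I • dxS (dxS U) - (s : ℂ) • dxS U + 2 * U * dxS U := by
  have hd : ∀ x, HasDerivAt (u t) (deriv (u t) x) x := fun x =>
    ((hu.isSmoothMeanZero ht).1.differentiable (by simp) x).hasDerivAt
  have e1 : ((dxS U : Sm) : ℝ → ℂ) = fun x => ((deriv (u t) x : ℝ) : ℂ) := by
    funext x
    change deriv (U : ℝ → ℂ) x = _
    rw [hU]
    exact (hd x).ofReal_comp.deriv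
  have e2 : ((dxS (dxS U) : Sm) : ℝ → ℂ) = iteratedDeriv 2 (cplx (u t)) := by
    rw [iteratedDeriv_succ, iteratedDeriv_one, ← hU]
    rfl
  have e3 : ((mulS h.polyGrowth (dxS U) : Sm) : ℝ → ℂ) = opG g s (dxS U : Sm) :=
    (h.opG_eq (dxS U).2).symm
  refine Subtype.ext (funext fun x => ?_)
  have h1 := hu.2.2 t ht x
  have h3 : ((deriv (fun τ => u τ x) t : ℝ) : ℂ) = (V : ℝ → ℂ) x := by
    have h4 := hu.isSpaceTime.hasDerivAt_time hI ht x
    have h5 : DifferentiableAt ℝ (fun τ => u τ x) t :=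
      Complex.reCLM.differentiableAt.comp t h4.differentiableAt
    rw [hV]
    exact h5.hasDerivAt.ofReal_comp.unique h4
  have h6 : deriv (fun y => u t y ^ 2) x = 2 * u t x * deriv (u t) x := by
    have := ((hd x).fun_pow 2).deriv
    simpa using this
  have h8 : deriv ((dxS U : Sm) : ℝ → ℂ) = iteratedDeriv 2 (cplx (u t)) := by
    rw [← e2]
    rfl
  rw [h3, h6] at h1
  change (V : ℝ → ℂ) x = ((mulS h.polyGrowth (dxS U) : Sm) : ℝ → ℂ) x +
    Complex.I * ((dxS (dxS U) : Sm) : ℝ → ℂ) x - (s : ℂ) * ((dxS U : Sm) : ℝ → ℂ) x +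
    2 * (U : ℝ → ℂ) x * ((dxS U : Sm) : ℝ → ℂ) x
  rw [e3, opG, h8, e2, e1, hU, sub_eq_iff_eq_add.1 h1]
  simp only [cplx]
  push_cast
  ring

theorem GoodSymbol.smE_conserved {g : ℤ → ℝ} {s : ℝ} (h : GoodSymbol g s) (k : ℕ) {I : Set ℝ}
    (hI : IsOpen I) (hI' : I.OrdConnected) {u : ℝ → ℝ → ℝ} (hu : IsSmoothSolution (symS g) I u)
    {t₁ t₂ : ℝ} (h₁ : t₁ ∈ I) (h₂ : t₂ ∈ I) : smE g s k (u t₁) = smE g s k (u t₂) := by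
  have hℓ := h.linBound (le_refl s)
  have hst := hu.isSpaceTime
  have hder : ∀ t ∈ I, HasDerivAt (fun τ => smE g s k (u τ)) 0 t := by
    intro t ht
    have h1 := hst.hasDerivAt_sum_formSum hI ht (s := Finset.range (k + 2 + 1))
      (m := fun d => symE k d (symL g s))
      fun d hd => (isSymb_symE (Nat.lt_succ_iff.1 (Finset.mem_range.1 hd))).polyBd hℓ
    have h2 := h.identities.sum_formDeriv_eq_zero hℓ s
      (U := ⟨cplx (u t), cplx_mem_Sm (hu.isSmoothMeanZero ht)⟩)
      (V := ⟨_, (hst.dT hI).mem_Sm ht⟩) (h.flow_eq hI hu ht rfl rfl) k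
    replace h1 := h1.congr_deriv h2
    have h3 := Complex.reCLM.hasFDerivAt.comp_hasDerivAt t h1
    rw [map_zero] at h3
    refine h3.congr_of_eventuallyEq ?_
    filter_upwards [hI.mem_nhds ht] with τ hτ
    exact h.smE_eq_formSum k (hu.isSmoothMeanZero hτ)
  exact hI.is_const_of_deriv_eq_zero hI'.isPreconnected
    (fun t ht => (hder t ht).differentiableAt.differentiableWithinAt)
    (fun t ht => (hder t ht).deriv) h₁ h₂

end ILW

end

theorem theorem1 (k : ℕ) :
    -- positivity and normalization of the coefficients of the quadratic part
    (∀ l : ℕ, l ≤ k → Even l → 0 < ILW.aCoef k l) ∧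
    (∑ l ∈ (Finset.range (k + 1)).filter (fun l => Even l), ILW.aCoef k l = 1) ∧
    -- the quadratic part is comparable to the square of the homogeneous Sobolev norm
    (∀ δ₀ : ℝ, 0 < δ₀ → ∃ c : ℝ, 0 < c ∧ ∀ δ : ℝ, δ₀ ≤ δ →
      ∀ u : ILW.sobolevZero ((k : ℝ) / 2),
        c * ILW.homSq k u ≤ ILW.quadILW δ k u ∧ ILW.quadILW δ k u ≤ ILW.homSq k u) ∧
    -- smooth functions are dense
    (∀ u : ILW.sobolevZero ((k : ℝ) / 2), (ILW.smoothNear ((k : ℝ) / 2) u).NeBot) ∧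
    -- intermediate long wave equation
    (∀ δ : ℝ, 0 < δ →
      -- continuous extension from smooth functions
      (∀ u : ILW.sobolevZero ((k : ℝ) / 2),
        Tendsto (ILW.smoothEnergyILW δ k) (ILW.smoothNear ((k : ℝ) / 2) u)
          (𝓝 (ILW.energyILW δ k u))) ∧
      (∀ u : ℝ → ℝ, ILW.IsSmoothMeanZero u →
        ILW.energyILW δ k u = ILW.smoothEnergyILW δ k u) ∧
      -- quadratic part, up to cubic and higher order terms
      ILW.IsCubicAndHigher ((k : ℝ) / 2) (k + 2)
        (fun u => ILW.energyILW δ k u - 1 / 2 * ILW.quadILW δ k u) ∧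
      -- conservation
      (∀ (I : Set ℝ) (u : ℝ → ℝ → ℝ), IsOpen I → I.OrdConnected →
        ILW.IsSmoothSolution (ILW.symG δ) I u →
        ∀ s ∈ I, ∀ t ∈ I, ILW.energyILW δ k (u s) = ILW.energyILW δ k (u t))) ∧
    -- Benjamin-Ono equation
    ((∀ u : ILW.sobolevZero ((k : ℝ) / 2),
        Tendsto (ILW.smoothEnergyBO k) (ILW.smoothNear ((k : ℝ) / 2) u)
          (𝓝 (ILW.energyBO k u))) ∧
      (∀ u : ℝ → ℝ, ILW.IsSmoothMeanZero u →
        ILW.energyBO k u = ILW.smoothEnergyBO k u) ∧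
      ILW.IsCubicAndHigher ((k : ℝ) / 2) (k + 2)
        (fun u => ILW.energyBO k u - 1 / 2 * ILW.homSq k u) ∧
      (∀ (I : Set ℝ) (u : ℝ → ℝ → ℝ), IsOpen I → I.OrdConnected →
        ILW.IsSmoothSolution ILW.symH I u →
        ∀ s ∈ I, ∀ t ∈ I, ILW.energyBO k (u s) = ILW.energyBO k (u t))) ∧
    -- deep-water limit
    (∀ u : ILW.sobolevZero ((k : ℝ) / 2),
      Tendsto (fun δ : ℝ => ILW.energyILW δ k u) atTop (𝓝 (ILW.energyBO k u))) := by
  open ILW in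
  refine ⟨fun l hl _ => aCoef_pos hl, sum_aCoef k, fun δ₀ hδ₀ => ?_, smoothNear_neBot k,
    fun δ hδ => ⟨fun u => ?_, fun u hu => energyILW_eq_smooth hδ k hu, ?_, ?_⟩,
    ⟨fun u => ?_, fun u hu => energyBO_eq_smooth k hu, ?_, ?_⟩, fun u => ?_⟩
  · obtain ⟨c, hc, h⟩ := exists_le_quadILW k hδ₀
    exact ⟨c, hc, fun δ hδ u => ⟨h δ hδ u, quadILW_le_homSq (hδ₀.trans_le hδ) k u⟩⟩
  · rw [energyILW_eq hδ, funext (smoothEnergyILW_eq δ k)]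
    exact (goodSymbol_ILW hδ).tendsto_smE k u
  · refine (goodSymbol_ILW hδ).isCubicAndHigher k fun u => ?_
    rw [energyILW_eq hδ, quadILW_eq hδ, quadG_eq_quadL]
  · intro I u hI hI' hu s hs t ht
    rw [energyILW_eq_smooth hδ k (hu.isSmoothMeanZero hs),
      energyILW_eq_smooth hδ k (hu.isSmoothMeanZero ht), smoothEnergyILW_eq, smoothEnergyILW_eq]
    rw [symG_eq] at hu
    exact (goodSymbol_ILW hδ).smE_conserved k hI hI' hu hs ht
  · rw [energyBO_eq, funext (smoothEnergyBO_eq k)]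
    exact goodSymbol_BO.tendsto_smE k u
  · refine goodSymbol_BO.isCubicAndHigher k fun u => ?_
    rw [energyBO_eq, homSq_eq, quadG_eq_quadL]
  · intro I u hI hI' hu s hs t ht
    rw [energyBO_eq_smooth k (hu.isSmoothMeanZero hs),
      energyBO_eq_smooth k (hu.isSmoothMeanZero ht), smoothEnergyBO_eq, smoothEnergyBO_eq]
    rw [symH_eq] at hu
    exact goodSymbol_BO.smE_conserved k hI hI' hu hs ht
  · rw [energyBO_eq]
    refine (tendsto_engL k (embL_zero_coord k u)).congr' ?_
    filter_upwards [eventually_gt_atTop 0] with δ hδ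
    exact (energyILW_eq hδ k u).symm
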